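/- Let $d\ge 1$, let $\mathbb{T}^d=\mathbb{R}^d/\mathbb{Z}^d$ carry the uniform probability measure and the metric $\|x-y\|_2=\min_{n\in\mathbb{Z}^d}\big(\sum_{j}|x_j-y_j-n_j|^2\big)^{1/2}$, and let $\varphi_k(x)=e^{2\pi i k\cdot x}$, $k\in\mathbb{Z}^d$, be the trigonometric basis, with $\mathbb{Z}^d$ enumerated by ascending $\ell^\infty$ norm and ties broken lexicographically. For a natural number $s>d/2$ put \[ \|g\|_{W^s}^2=\sum_{k\in\mathbb{Z}^d}(1+4\pi^2\|k\|_2^2)^s|\hat g_k|^2,\qquad \hat g_k=\int_{\mathbb{T}^d}g\,\overline{\varphi_k}, \] and let $\|f\|_{C^r}=\max_{|\alpha|\le r}\sup|\partial^\alpha f|$. For a finite nonempty $X\subset\mathbb{T}^d$ let \[ h_X=\max_{y\in\mathbb{T}^d}\min_{x\in X}\|x-y\|_2,\qquad q_X=\tfrac12\min_{x,y\in X,\,x\ne y}\|x-y\|_2 . \] Let $p_X$ be the smallest natural number $p$ such that arbitrary data on $X$ can be interpolated from the span of the first $p$ basis functions (such a $p$ always exists). For data $y$ on $X$ and $p_X\le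 p\le\infty$, the minimum weighted norm interpolant $f_p$ of $(X,y)$ is the unique minimizer of $\|g\|_{W^s}$ among the functions $g$ in the $L^2$-closed span of the first $p$ basis functions (all of them if $p=\infty$) with $\|g\|_{W^s}<\infty$ and $g=y$ on $X$, where elements of $W^s$ are identified with their continuous representatives. Finally let $E_q(f,g)=\|f-g\|_{L^q(\mathbb{T}^d)}$. **Theorem.** Let $s>d/2$ be a natural number. There exists $h>0$ such that for every integer $r>d/2$ there is a constant $C>0$, depending only on $d,r,s$, with the following property. Let $X\subset\mathbb{T}^d$ be a finite nonempty set with $h_X\le h$, let $f\in C^r(\mathbb{T}^d)$ (real- or complex-valued), and let $f_p$, $p_X\le p\le\infty$, be the minimum weighted norm interpolant of $(X,f|_X)$, which exists and is unique. Then for each $1\le q\le\infty$, \[ \lim_{p\to\infty}E_q(f,f_p)=E_q(f,f_\infty)\le E_\infty(f,f_\infty), \] and \[ E_\infty(f,f_\infty)\le \begin{cases} C\,h_X^{\,s-d/2}\,\|f\|_{W^s} & \text{if } s\le r \text{ (in which case } \|f\|_{W^s}<\infty),\\[2pt] C\,h_X^{\,r-d/2}\,\big(h_X/q_X\big)^{s-r}\,\|f\|_{C^r}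 & \text{if } r<s . \end{cases} \] -/

import Mathlib

open MeasureTheory Filter Topology
open scoped ENNReal

noncomputable section

namespace TorusInterp

/-- The `d`-dimensional torus `(ℝ / ℤ)^d`. -/
abbrev Torus (d : ℕ) : Type := UnitAddTorus (Fin d)

/-- The uniform probability measure on the torus. -/
abbrev torusMeasure (d : ℕ) : Measure (Torus d) :=
  Measure.pi fun _ => AddCircle.haarAddCircle

/-- The Euclidean metric of the torus, `d(x, y)² = min_{n ∈ ℤ^d} ∑ⱼ |xⱼ - yⱼ - nⱼ|²`: the norm of
`ℝ / ℤ` is the distance of a representative to the nearest integer. -/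
def torusDist {d : ℕ} (x y : Torus d) : ℝ :=
  √(∑ j, ‖x j - y j‖ ^ 2)

/-- The mesh norm `h_X = max_y min_{x ∈ X} d(x, y)` of a nonempty finite set. -/
def meshNorm {d : ℕ} (X : Finset (Torus d)) : ℝ :=
  ⨆ y : Torus d, ⨅ x : X, torusDist x.1 y

/-- The separation radius `q_X = ½ min_{x ≠ y ∈ X} d(x, y)` of a finite set with at least two
points. -/
def sepRadius {d : ℕ} (X : Finset (Torus d)) : ℝ :=
  (1 / 2) * ⨅ p : {p : X × X // p.1 ≠ p.2}, torusDist p.1.1.1 p.1.2.1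

/-- The order in which the frequencies are enumerated: ascending `ℓ^∞` norm (the norm of a `Pi`
type is the maximum norm), ties broken lexicographically. -/
def FreqLT {d : ℕ} (k l : Fin d → ℤ) : Prop :=
  ‖k‖ < ‖l‖ ∨ (‖k‖ = ‖l‖ ∧ toLex k < toLex l)

/-- The first `p` frequencies (all frequencies if `p = ∞`): those with fewer than `p`
predecessors. -/
def firstFreqs (d : ℕ) (p : ℕ∞) : Set (Fin d → ℤ) :=
  {k | {l | FreqLT l k}.encard < p}

/-- The closed linear span in `L²` of the first `p` exponentials `x ↦ exp (2 π i k · x)`. -/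
def trigSpace (d : ℕ) (p : ℕ∞) : Submodule ℂ (Lp ℂ 2 (torusMeasure d)) :=
  (Submodule.span ℂ
    ((fun k => ContinuousMap.toLp 2 (torusMeasure d) ℂ (UnitAddTorus.mFourier k)) ''
      firstFreqs d p)).topologicalClosure

/-- The Sobolev weight `ω_k = (1 + 4 π² ‖k‖₂²)^s`. -/
def sobolevWeight {d : ℕ} (s : ℕ) (k : Fin d → ℤ) : ℝ :=
  (1 + 4 * Real.pi ^ 2 * ∑ j, (k j : ℝ) ^ 2) ^ s

/-- The weighted norm `‖g‖_{W^s} = (∑_k ω_k |ĝ_k|²)^{1/2} ∈ [0, ∞]`. -/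
def sobolevNorm {d : ℕ} (s : ℕ) (g : Torus d → ℂ) : ℝ≥0∞ :=
  (∑' k : Fin d → ℤ,
    ENNReal.ofReal (sobolevWeight s k * ‖UnitAddTorus.mFourierCoeff g k‖ ^ 2)) ^ (1 / 2 : ℝ)

/-- Arbitrary data on `X` can be interpolated from the span of the first `p` exponentials. -/
def Interpolates {d : ℕ} (X : Finset (Torus d)) (p : ℕ) : Prop :=
  ∀ y : X → ℂ, ∃ g ∈ Submodule.span ℂ (UnitAddTorus.mFourier '' firstFreqs d p),
    ∀ x : X, g x.1 = y x

/-- `X` is a sampling set for the trigonometric basis. -/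
def IsSamplingSet {d : ℕ} (X : Finset (Torus d)) : Prop :=
  ∃ p : ℕ, Interpolates X p

/-- `p_X`, the smallest `p` for which the first `p` exponentials interpolate arbitrary data
on `X`. -/
def samplingIndex {d : ℕ} (X : Finset (Torus d)) : ℕ :=
  sInf {p : ℕ | Interpolates X p}

/-- The functions of finite weighted norm in the closed span of the first `p` exponentials that
interpolate the data `y` on `X`. Elements of `W^s` are represented by continuous functions. -/
def interpolants {d : ℕ} (s : ℕ) (X : Finset (Torus d)) (y : Torus d → ℂ) (p : ℕ∞) :
    Set C(Torus d, ℂ) :=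
  {g | ContinuousMap.toLp 2 (torusMeasure d) ℂ g ∈ trigSpace d p ∧ sobolevNorm s g < ∞ ∧
    ∀ x ∈ X, g x = y x}

/-- `g` is a minimum weighted norm interpolant of the data `(X, y)`, from the closed span of the
first `p` exponentials (of all of them if `p = ∞`). -/
def IsMinNormInterpolant {d : ℕ} (s : ℕ) (X : Finset (Torus d)) (y : Torus d → ℂ) (p : ℕ∞)
    (g : C(Torus d, ℂ)) : Prop :=
  g ∈ interpolants s X y p ∧ ∀ g' ∈ interpolants s X y p, sobolevNorm s g ≤ sobolevNorm s g'

/-- The error `E_q(f, g) = ‖f - g‖_{L^q}`. -/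
def lqError {d : ℕ} (q : ℝ≥0∞) (f g : Torus d → ℂ) : ℝ≥0∞ :=
  eLpNorm (fun x => f x - g x) q (torusMeasure d)

/-- The `ℤ^d`-periodic function on `ℝ^d` that corresponds to a function on the torus. -/
def periodicLift {d : ℕ} (f : Torus d → ℂ) : (Fin d → ℝ) → ℂ :=
  fun x => f fun j => (x j : UnitAddCircle)

/-- `f ∈ C^r`. -/
def IsCr {d : ℕ} (r : ℕ) (f : Torus d → ℂ) : Prop :=
  ContDiff ℝ r (periodicLift f)

/-- The `C^r` norm: the maximum of `sup_x |∂_{i₁} ⋯ ∂_{iₘ} f(x)|` over all partial derivatives of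
order `m ≤ r`. -/
def crNorm {d : ℕ} (r : ℕ) (f : Torus d → ℂ) : ℝ≥0∞ :=
  ⨆ (m : ℕ) (_ : m ≤ r) (i : Fin m → Fin d) (x : Fin d → ℝ),
    ‖iteratedFDeriv ℝ m (periodicLift f) x fun l => Pi.single (i l) 1‖ₑ

end TorusInterp

end

noncomputable section

namespace TorusInterp

/-! ### Positive definite bumps and Poisson summation on the circle. -/

section

open scoped FourierTransform SchwartzMap Convolution ComplexConjugate

/-! Weighting Fourier coefficients by the square root of the Sobolev weight identifies `W^s` with
`ℓ²`; `sobolevMap` is the inverse map, well defined into continuous functions because `s > d/2`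
makes the reciprocal weights summable. Interpolants then form a translate of a closed subspace, so
the minimizer is a projection and every competitor `b` satisfies `‖b‖² = ‖a‖² + ‖b - a‖²`.
Existence, uniqueness and `f_p → f_∞` all come from this identity: truncations of the coefficients
of `f_∞`, corrected by finitely many fixed trigonometric polynomials, compete with `f_p` and tend to
`f_∞`. Convergence in `W^s` is uniform, hence holds in every `L^q`.

The error bounds rest on a zeros estimate, `exists_norm_sobolevMap_le_of_vanishing`: a function of
`W^t` that vanishes on `X` has sup norm at most `C h_X^{t-d/2}` times its `W^t` norm. Near any `x₀`
one picks points of `X` close to a grid of spacing comparable to `h_X` and combines the values there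
so that polynomials of low degree are reproduced at `x₀`. On the frequency `k` this combination
differs from evaluation at `x₀` by at most a constant times `min(1, (h_X |k|)^t)`, and
Cauchy–Schwarz against the Sobolev weight gives the power of `h_X`. For `s ≤ r` the estimate is
applied to `f - f_∞`, whose `W^s` norm is at most that of `f`.

For `r < s` the function `f` is only known to lie in `W^r`. By `exists_smooth_interpolant` there is
`b ∈ W^s` equal to `f` on `X`, with `W^r` norm at most `C ‖f‖_{W^r}` and `W^s` norm at most `C
q_X^{-(s-r)} ‖f‖_{W^r}`. The zeros estimate in `W^r` controls `f - b`, and in `W^s` it controls `b -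
f_∞`; the second contribution is `h_X^{s-d/2} q_X^{-(s-r)} = h_X^{r-d/2} (h_X/q_X)^{s-r}`. To build
`b`, frequencies up to `1/q_X` are kept and the values of the remainder on `X` are restored by bumps
of width comparable to `q_X`. Both the size of those values and the norm of the bump sum are
controlled by `exists_bessel`, a Bessel inequality for exponential sums over separated points, which
follows from compactly supported kernels with nonnegative Fourier coefficients. -/

theorem fourier_im_eq_zero_of_even {φ : ℝ → ℝ} (hφ : ∀ x, φ (-x) = φ x) (ξ : ℝ) :
    (𝓕 (fun x => (φ x : ℂ)) ξ).im = 0 := by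
  rw [← Complex.conj_eq_iff_im]
  rw [Real.fourier_real_eq_integral_exp_smul, ← integral_conj, ← integral_neg_eq_self]
  refine integral_congr_ae (.of_forall fun x => ?_)
  simp only [smul_eq_mul, map_mul, ← Complex.exp_conj, Complex.conj_ofReal, Complex.conj_I, hφ]
  congr 2
  push_cast
  ring

/-- A smooth bump of unit height supported in `[-1, 1]` whose Fourier transform is nonnegative,
and positive near the origin. -/
theorem exists_positiveDefinite_bump : ∃ (b : 𝓢(ℝ, ℂ)) (β : ℝ → ℝ),
    b 0 = 1 ∧ (∀ x, 1 ≤ |x| → b x = 0) ∧ (∀ ξ, 𝓕 b ξ = β ξ) ∧ (∀ ξ, 0 ≤ β ξ) ∧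
    ∃ δ c : ℝ, 0 < δ ∧ 0 < c ∧ ∀ ξ, |ξ| ≤ δ → c ≤ β ξ := by
  let η : ContDiffBump (0 : ℝ) := ⟨1 / 4, 1 / 2, by norm_num, by norm_num⟩
  have hη0 : ∀ x, 1 / 2 ≤ |x| → η x = 0 := fun x hx =>
    η.zero_of_le_dist (by rw [Real.dist_eq, sub_zero]; exact hx)
  let φ : 𝓢(ℝ, ℂ) := HasCompactSupport.toSchwartzMap (f := fun x => (η x : ℂ))
    (η.hasCompactSupport.comp_left Complex.ofReal_zero)
    (Complex.ofRealCLM.contDiff.comp η.contDiff)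
  have hφ : ∀ x, φ x = (η x : ℂ) := fun x => rfl
  set m : ℝ := ∫ x, η x ^ 2 with hm
  have hsupp : HasCompactSupport fun x => η x ^ 2 := by
    have := η.hasCompactSupport.comp_left (g := fun y : ℝ => y ^ 2) (by simp)
    exact this
  have hmpos : 0 < m := by
    refine Continuous.integral_pos_of_hasCompactSupport_nonneg_nonzero (x := 0)
      (η.continuous.pow 2) hsupp (fun x => sq_nonneg _) ?_
    have : η 0 = 1 := η.one_of_mem_closedBall (by simp [η])
    simp [this]
  -- Since `η` is real and even, `𝓕 φ` is real, so the transform `(𝓕 φ)²` of the self-convolution is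
  -- nonnegative. Radius `1/2` for `η` gives support in `[-1, 1]`, and `m = ∫ η²` is the height at
  -- the origin to be divided out.
  let b₀ : 𝓢(ℝ, ℂ) := SchwartzMap.convolution (ContinuousLinearMap.mul ℂ ℂ) φ φ
  have hb₀ : ∀ x, b₀ x = ∫ t, (η t : ℂ) * η (x - t) := fun x => by
    rw [SchwartzMap.convolution_apply]; rfl
  let g : ℝ → ℝ := fun ξ => (𝓕 φ ξ).re
  have hg : ∀ ξ, 𝓕 φ ξ = g ξ := fun ξ => by
    apply Complex.ext
    · simp [g]
    · rw [SchwartzMap.fourier_coe]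
      exact fourier_im_eq_zero_of_even (φ := η) (fun x => η.neg x) ξ
  have hFb₀ : ∀ ξ, 𝓕 b₀ ξ = (g ξ : ℂ) ^ 2 := fun ξ => by
    rw [SchwartzMap.fourier_convolution_apply, Real.fourier_bilin_convolution_eq _ φ.integrable
      φ.integrable, ← SchwartzMap.fourier_coe, hg]
    simp [sq]
  have hgc : Continuous g := Complex.continuous_re.comp (𝓕 φ).continuous
  have hg0 : 0 < g 0 := by
    have h1 : 𝓕 φ 0 = ((∫ x, η x : ℝ) : ℂ) := by
      rw [SchwartzMap.fourier_coe, Real.fourier_real_eq_integral_exp_smul, ← integral_complex_ofReal]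
      simp [hφ]
    have h2 : g 0 = ∫ x, η x := by simp only [g, h1, Complex.ofReal_re]
    rw [h2]; exact η.integral_pos
  obtain ⟨δ, hδ, hδg⟩ := Metric.continuousAt_iff.1 hgc.continuousAt (g 0 / 2) (by positivity)
  refine ⟨((m : ℂ)⁻¹) • b₀, fun ξ => m⁻¹ * g ξ ^ 2, ?_, ?_, ?_, ?_, δ / 2, m⁻¹ * (g 0 / 2) ^ 2,
    by positivity, by positivity, ?_⟩
  · have : b₀ 0 = (m : ℂ) := by
      rw [hb₀, hm, ← integral_complex_ofReal]
      simp [η.neg, sq]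
    simp [this, hmpos.ne']
  · intro x hx
    have : b₀ x = 0 := by
      rw [hb₀]
      refine integral_eq_zero_of_ae (.of_forall fun t => ?_)
      by_cases ht : 1 / 2 ≤ |t|
      · simp [hη0 t ht]
      · have : 1 / 2 ≤ |x - t| := by
          have := abs_sub_abs_le_abs_sub x t
          linarith
        simp [hη0 _ this]
    simp [this]
  · intro ξ
    rw [FourierTransform.fourier_smul]
    simp [hFb₀]
  · intro ξ
    positivity
  · intro ξ hξ
    have h1 := hδg (x := ξ) (by rw [Real.dist_eq, sub_zero]; linarith)
    rw [Real.dist_eq] at h1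
    have h2 := (abs_lt.1 h1).1
    dsimp only
    gcongr
    linarith

theorem fourier_comp_div (f : ℝ → ℂ) {ε : ℝ} (hε : 0 < ε) (ξ : ℝ) :
    𝓕 (fun x => f (x / ε)) ξ = ε * 𝓕 f (ε * ξ) := by
  rw [Real.fourier_real_eq_integral_exp_smul, Real.fourier_real_eq_integral_exp_smul]
  have := Measure.integral_comp_div
    (fun v : ℝ => Complex.exp (↑(-2 * Real.pi * v * (ε * ξ)) * Complex.I) • f v) ε
  rw [abs_of_pos hε] at this
  rw [← Complex.real_smul, ← this]
  congr 1 with v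
  congr 3
  have : (ε : ℂ) ≠ 0 := by exact_mod_cast hε.ne'
  push_cast
  field_simp

theorem exists_norm_mul_one_add_abs_pow_le (f : 𝓢(ℝ, ℂ)) (n : ℕ) :
    ∃ C : ℝ, 0 < C ∧ ∀ x, ‖f x‖ * (1 + |x|) ^ n ≤ C := by
  refine ⟨2 ^ n * (Finset.Iic (n, 0)).sup (fun m => SchwartzMap.seminorm ℝ m.1 m.2) f + 1,
    by positivity, fun x => ?_⟩
  have := SchwartzMap.one_add_le_sup_seminorm_apply (𝕜 := ℝ) (m := (n, 0)) le_rfl le_rfl f x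
  rw [norm_iteratedFDeriv_zero, Real.norm_eq_abs] at this
  linarith

/-- The Poisson summation formula for a bump of width `ε ≤ 1 / 2`. -/
theorem hasSum_bump_poisson {b : 𝓢(ℝ, ℂ)} {β : ℝ → ℝ} (hb0 : b 0 = 1)
    (hb : ∀ x, 1 ≤ |x| → b x = 0) (hβ : ∀ ξ, 𝓕 b ξ = β ξ) {ε : ℝ} (hε : 0 < ε) (hε' : ε ≤ 1 / 2) :
    Summable (fun n : ℤ => ε * |β (ε * n)|) ∧ ∃ ψ : UnitAddCircle → ℂ, ψ 0 = 1 ∧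
      (∀ z, ε ≤ ‖z‖ → ψ z = 0) ∧
      ∀ z, HasSum (fun n : ℤ => ((ε * β (ε * n) : ℝ) : ℂ) * fourier n z) (ψ z) := by
  let bε : 𝓢(ℝ, ℂ) := SchwartzMap.compCLMOfContinuousLinearEquiv ℂ
    (ContinuousLinearEquiv.unitsEquivAut ℝ (Units.mk0 ε⁻¹ (inv_ne_zero hε.ne'))) b
  have hbε : ∀ x, bε x = b (x / ε) := fun x => by
    simp [bε, div_eq_mul_inv]
  have hF : ∀ ξ, 𝓕 bε ξ = ((ε * β (ε * ξ) : ℝ) : ℂ) := fun ξ => by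
    have : (bε : ℝ → ℂ) = fun x => b (x / ε) := funext hbε
    rw [SchwartzMap.fourier_coe, this, fourier_comp_div _ hε, ← SchwartzMap.fourier_coe, hβ]
    push_cast; rfl
  have hsum : Summable (fun n : ℤ => 𝓕 bε n) :=
    summable_of_isBigO (Real.summable_abs_int_rpow one_lt_two)
      (((𝓕 bε).isBigO_cocompact_rpow (-2)).comp_tendsto Int.tendsto_coe_cofinite)
  have hsum' : Summable (fun n : ℤ => ε * |β (ε * n)|) := by
    refine hsum.norm.congr fun n => ?_
    rw [hF, Complex.norm_real, Real.norm_eq_abs, abs_mul, abs_of_pos hε]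
  refine ⟨hsum', fun z => ∑' n : ℤ, ((ε * β (ε * n) : ℝ) : ℂ) * fourier n z, ?_, ?_, ?_⟩
  -- By Poisson summation the series is the periodization of `bε`. At `0` only the translate `n = 0`
  -- meets the support; at distance at least `ε` from the integers no translate does.
  · have := bε.tsum_eq_tsum_fourier 0
    simp only [hF, Complex.ofReal_mul] at this
    have h0 : ((0 : ℝ) : UnitAddCircle) = 0 := rfl
    rw [h0] at this
    simp only [Complex.ofReal_mul]
    rw [← this, tsum_eq_single 0]
    · simp [hbε, hb0]
    · intro n hn
      rw [hbε]
      apply hb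
      rw [zero_add, abs_div, abs_of_pos hε, le_div_iff₀ hε]
      have : (1 : ℝ) ≤ |(n : ℝ)| := by exact_mod_cast Int.one_le_abs hn
      linarith
  · intro z hz
    induction z using QuotientAddGroup.induction_on with | H x =>
    have := bε.tsum_eq_tsum_fourier x
    simp only [hF] at this
    refine this.symm.trans ?_
    rw [← tsum_zero (α := ℂ) (β := ℤ)]
    congr 1 with n
    rw [hbε]
    apply hb
    rw [abs_div, abs_of_pos hε, le_div_iff₀ hε, one_mul]
    refine hz.trans ?_
    change ‖((x : ℝ) : UnitAddCircle)‖ ≤ _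
    rw [UnitAddCircle.norm_eq]
    simpa using round_le x (-n)
  · intro z
    refine Summable.hasSum (.of_norm (hsum'.congr fun n => ?_))
    rw [norm_mul, Complex.norm_real, Real.norm_eq_abs, abs_mul, abs_of_pos hε, fourier_apply,
      Circle.norm_coe, mul_one]

end

/-! ### Product kernels on the torus and a Bessel inequality for exponential sums. -/

section

open scoped FourierTransform SchwartzMap ComplexConjugate

theorem hasSum_pi_prod {ι : Type*} {d : ℕ} (f : Fin d → ι → ℂ) (s : Fin d → ℂ)
    (hf : ∀ j, Summable fun n => ‖f j n‖) (hs : ∀ j, HasSum (f j) (s j)) :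
    Summable (fun k : Fin d → ι => ‖∏ j, f j (k j)‖) ∧
      HasSum (fun k : Fin d → ι => ∏ j, f j (k j)) (∏ j, s j) := by
  induction d with
  | zero =>
    simp only [Finset.univ_eq_empty, Finset.prod_empty]
    exact ⟨(hasSum_unique _).summable, hasSum_unique _⟩
  | succ d ih =>
    obtain ⟨h1, h2⟩ := ih (fun j => f j.succ) (fun j => s j.succ) (fun j => hf _) (fun j => hs _)
    have h3 := summable_mul_of_summable_norm (hf 0) h1
    have h4 := (hs 0).mul h2 h3
    have h5 := (hf 0).mul_of_nonneg h1 (fun _ => norm_nonneg _) (fun _ => norm_nonneg _)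
    rw [← (Fin.consEquiv fun _ : Fin (d + 1) => ι).summable_iff,
      ← (Fin.consEquiv fun _ : Fin (d + 1) => ι).hasSum_iff]
    constructor
    · refine h5.congr fun p => ?_
      simp [Fin.consEquiv, Fin.prod_univ_succ]
    · rw [Fin.prod_univ_succ]
      refine h4.congr_fun fun p => ?_
      simp [Fin.consEquiv, Fin.prod_univ_succ]

/-- A family of kernels on the torus with small supports, unit height and nonnegative rapidly
decreasing Fourier coefficients. -/
theorem exists_torusKernel (d : ℕ) : ∃ β : ℝ → ℝ, (∀ ξ, 0 ≤ β ξ) ∧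
    (∃ δ c : ℝ, 0 < δ ∧ 0 < c ∧ ∀ ξ, |ξ| ≤ δ → c ≤ β ξ) ∧
    (∀ n : ℕ, ∃ C : ℝ, 0 < C ∧ ∀ ξ, β ξ * (1 + |ξ|) ^ n ≤ C) ∧
    ∀ ε : ℝ, 0 < ε → ε ≤ 1 / 2 →
      Summable (fun k : Fin d → ℤ => ε ^ d * ∏ j, β (ε * k j)) ∧
      ∃ ψ : Torus d → ℂ, ψ 0 = 1 ∧ (∀ z, (∃ j, ε ≤ ‖z j‖) → ψ z = 0) ∧
      ∀ z, HasSum (fun k : Fin d → ℤ => ((ε ^ d * ∏ j, β (ε * k j) : ℝ) : ℂ) *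
        UnitAddTorus.mFourier k z) (ψ z) := by
  obtain ⟨b, β, hb0, hb, hβ, hpos, hδ⟩ := exists_positiveDefinite_bump
  refine ⟨β, hpos, hδ, fun n => ?_, fun ε hε hε' => ?_⟩
  · obtain ⟨C, hC, h⟩ := exists_norm_mul_one_add_abs_pow_le (𝓕 b) n
    refine ⟨C, hC, fun ξ => ?_⟩
    have := h ξ
    rwa [hβ, Complex.norm_real, Real.norm_of_nonneg (hpos ξ)] at this
  · obtain ⟨hsum, ψ, h0, hz, hψ⟩ := hasSum_bump_poisson hb0 hb hβ hε hε'
    have key : ∀ z : Torus d, _ := fun z => hasSum_pi_prod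
      (fun j (n : ℤ) => ((ε * β (ε * n) : ℝ) : ℂ) * fourier n (z j)) (fun j => ψ (z j))
      (fun j => hsum.congr fun n => by
        rw [norm_mul, Complex.norm_real, Real.norm_eq_abs, abs_mul, abs_of_pos hε, fourier_apply,
          Circle.norm_coe, mul_one]) (fun j => hψ (z j))
    have hterm : ∀ (z : Torus d) (k : Fin d → ℤ),
        ∏ j, (((ε * β (ε * k j) : ℝ) : ℂ) * fourier (k j) (z j)) =
        ((ε ^ d * ∏ j, β (ε * k j) : ℝ) : ℂ) * UnitAddTorus.mFourier k z := fun z k => by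
      simp [Finset.prod_mul_distrib, UnitAddTorus.mFourier]
    refine ⟨?_, fun z => ∏ j, ψ (z j), by simp [h0], ?_, fun z => ?_⟩
    · refine (key 0).1.congr fun k => ?_
      rw [hterm, norm_mul, Complex.norm_real, Real.norm_of_nonneg]
      · simp [UnitAddTorus.mFourier]
      · exact mul_nonneg (by positivity) (Finset.prod_nonneg fun _ _ => hpos _)
    · rintro z ⟨j, hj⟩
      exact Finset.prod_eq_zero (Finset.mem_univ j) (hz _ hj)
    · simpa only [hterm] using (key z).2

theorem mFourier_sub_apply {d : ℕ} (k : Fin d → ℤ) (x y : Torus d) :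
    UnitAddTorus.mFourier k (x - y) =
      UnitAddTorus.mFourier k x * conj (UnitAddTorus.mFourier k y) := by
  simp only [UnitAddTorus.mFourier, ContinuousMap.coe_mk, map_prod, ← Finset.prod_mul_distrib]
  refine Finset.prod_congr rfl fun j _ => ?_
  rw [← fourier_neg]
  simp [fourier_apply, sub_eq_add_neg, AddCircle.toCircle_add]

@[simp]
theorem norm_mFourier_apply {d : ℕ} (k : Fin d → ℤ) (x : Torus d) :
    ‖UnitAddTorus.mFourier k x‖ = 1 := by
  simp only [UnitAddTorus.mFourier, ContinuousMap.coe_mk, norm_prod, fourier_apply,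
    Circle.norm_coe, Finset.prod_const_one]

/-- The product kernels are supported in boxes, while separation is Euclidean. If all coordinates
were below `q / (2 * d)`, the distance would be at most `q < 2 * q`. Hence a kernel of width `q / (2
* d)` vanishes at differences of distinct separated points. -/
theorem exists_le_norm_of_le_torusDist {d : ℕ} (hd : 0 < d) {x y : Torus d} {q : ℝ} (hq : 0 < q)
    (h : 2 * q ≤ torusDist x y) : ∃ j, q / (2 * d) ≤ ‖(x - y) j‖ := by
  by_contra! hlt
  have hd' : (1 : ℝ) ≤ d := by exact_mod_cast hd
  have h1 : ∑ j, ‖x j - y j‖ ^ 2 ≤ q ^ 2 := by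
    calc ∑ j, ‖x j - y j‖ ^ 2 ≤ ∑ _j : Fin d, (q / (2 * d)) ^ 2 := by
          refine Finset.sum_le_sum fun j _ => ?_
          have := (hlt j).le
          rw [Pi.sub_apply] at this
          gcongr
      _ = q ^ 2 / (4 * d) := by
          rw [Finset.sum_const, Finset.card_univ, Fintype.card_fin, nsmul_eq_mul]
          field_simp
          norm_num
      _ ≤ q ^ 2 := div_le_self (by positivity) (by linarith)
  have h2 : torusDist x y ≤ q := Real.sqrt_le_iff.2 ⟨hq.le, h1⟩
  linarith

theorem norm_sq_sum_mul_mFourier {d : ℕ} (X : Finset (Torus d)) (c : Torus d → ℂ)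
    (k : Fin d → ℤ) : ((‖∑ x ∈ X, c x * UnitAddTorus.mFourier k x‖ ^ 2 : ℝ) : ℂ) =
      ∑ x ∈ X, ∑ y ∈ X, c x * conj (c y) * UnitAddTorus.mFourier k (x - y) := by
  push_cast
  rw [← Complex.mul_conj', map_sum, Finset.sum_mul_sum]
  refine Finset.sum_congr rfl fun x _ => Finset.sum_congr rfl fun y _ => ?_
  rw [mFourier_sub_apply, map_mul]
  ring

/-- The matrix `ψ (x - y)` on `X` is the identity, so its quadratic form is `∑ ‖c x‖²`; the left
side is the same form expanded in the Fourier series of `ψ`. With nonnegative `a` this exact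
identity yields Bessel-type bounds. -/
theorem hasSum_kernel_quadraticForm {d : ℕ} {a : (Fin d → ℤ) → ℝ} {ψ : Torus d → ℂ}
    (h0 : ψ 0 = 1)
    (hψ : ∀ z, HasSum (fun k : Fin d → ℤ => (a k : ℂ) * UnitAddTorus.mFourier k z) (ψ z))
    (X : Finset (Torus d)) (hX : ∀ x ∈ X, ∀ y ∈ X, x ≠ y → ψ (x - y) = 0) (c : Torus d → ℂ) :
    HasSum (fun k : Fin d → ℤ => a k * ‖∑ x ∈ X, c x * UnitAddTorus.mFourier k x‖ ^ 2)
      (∑ x ∈ X, ‖c x‖ ^ 2) := by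
  rw [← Complex.hasSum_ofReal]
  have h1 : HasSum (fun k => ∑ x ∈ X, ∑ y ∈ X, c x * conj (c y) *
      ((a k : ℂ) * UnitAddTorus.mFourier k (x - y)))
      (∑ x ∈ X, ∑ y ∈ X, c x * conj (c y) * ψ (x - y)) :=
    hasSum_sum fun x _ => hasSum_sum fun y _ => (hψ _).mul_left _
  have h2 : ∑ x ∈ X, ∑ y ∈ X, c x * conj (c y) * ψ (x - y) = ((∑ x ∈ X, ‖c x‖ ^ 2 : ℝ) : ℂ) := by
    push_cast
    refine Finset.sum_congr rfl fun x hx => ?_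
    rw [Finset.sum_eq_single x, sub_self, h0, mul_one, Complex.mul_conj']
    · intro y hy hyx
      rw [hX x hx y hy hyx.symm, mul_zero]
    · exact fun h => absurd hx h
  rw [h2] at h1
  refine h1.congr_fun fun k => ?_
  rw [Complex.ofReal_mul, norm_sq_sum_mul_mFourier, Finset.mul_sum]
  refine Finset.sum_congr rfl fun x _ => ?_
  rw [Finset.mul_sum]
  exact Finset.sum_congr rfl fun y _ => by ring

/-- The squared Euclidean norm of a frequency. -/
def freqSq {d : ℕ} (k : Fin d → ℤ) : ℝ := ∑ j, (k j : ℝ) ^ 2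

theorem freqSq_nonneg {d : ℕ} (k : Fin d → ℤ) : 0 ≤ freqSq k :=
  Finset.sum_nonneg fun _ _ => sq_nonneg _

theorem norm_sq_le_freqSq {d : ℕ} (k : Fin d → ℤ) : ‖k‖ ^ 2 ≤ freqSq k := by
  rw [← Real.le_sqrt (norm_nonneg _) (freqSq_nonneg k), pi_norm_le_iff_of_nonneg (Real.sqrt_nonneg _)]
  intro j
  rw [Real.le_sqrt (norm_nonneg _) (freqSq_nonneg k), Int.norm_eq_abs, sq_abs]
  exact Finset.single_le_sum (f := fun j => (k j : ℝ) ^ 2) (fun _ _ => sq_nonneg _)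
    (Finset.mem_univ j)

/-- A single kernel has coefficients bounded below only at frequencies up to a multiple of `1/q`, so
kernels of all dyadic widths are superposed. The least `i` at which the scaled frequency enters
`[-δ, δ]` already gives the bound: every factor `β` is at least `c` there, and failure at the
previous scale makes `q ‖k‖` at least of order `2 ^ i`, which matches the weight `4 ^ (-t i)`. -/
theorem inv_pow_le_tsum_dyadic {d : ℕ} (hd : 0 < d) (t : ℕ) {β : ℝ → ℝ}
    {δ c : ℝ} (hδ : 0 < δ) (hc : 0 < c) (hβc : ∀ ξ, |ξ| ≤ δ → c ≤ β ξ) {q : ℝ} (hq : 0 < q)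
    (k : Fin d → ℤ) :
    ENNReal.ofReal ((1 + q ^ 2 * freqSq k) ^ t)⁻¹ ≤
      ENNReal.ofReal ((c ^ d)⁻¹ * (1 + (δ ^ (2 * t))⁻¹)) *
        ∑' i : ℕ, ENNReal.ofReal (((4 : ℝ) ^ (t * i))⁻¹ * ∏ j, β (q / (2 * d) / 2 ^ i * k j)) := by
  have hd' : (1 : ℝ) ≤ d := by exact_mod_cast hd
  have hex : ∃ i : ℕ, q / (2 * d) / 2 ^ i * ‖k‖ ≤ δ := by
    obtain ⟨i, hi⟩ := pow_unbounded_of_one_lt (q / (2 * d) * ‖k‖ / δ) (one_lt_two (α := ℝ))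
    refine ⟨i, ?_⟩
    rw [div_lt_iff₀ hδ] at hi
    rw [div_mul_eq_mul_div, div_le_iff₀ (by positivity)]
    linarith
  classical
  obtain ⟨i, hi, hmin⟩ : ∃ i : ℕ, q / (2 * d) / 2 ^ i * ‖k‖ ≤ δ ∧
      ∀ i' < i, ¬ q / (2 * d) / 2 ^ i' * ‖k‖ ≤ δ :=
    ⟨Nat.find hex, Nat.find_spec hex, fun i' h => Nat.find_min hex h⟩
  have hprod : c ^ d ≤ ∏ j, β (q / (2 * d) / 2 ^ i * k j) := by
    calc c ^ d = ∏ _j : Fin d, c := by simp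
      _ ≤ _ := Finset.prod_le_prod (fun _ _ => hc.le) fun j _ => hβc _ ?_
    rw [abs_mul, abs_of_pos (by positivity : (0 : ℝ) < q / (2 * d) / 2 ^ i)]
    refine le_trans ?_ hi
    gcongr
    rw [← Int.norm_eq_abs]
    exact norm_le_pi_norm k j
  refine le_trans ?_ (mul_le_mul_right (ENNReal.le_tsum i) _)
  rw [← ENNReal.ofReal_mul (by positivity)]
  apply ENNReal.ofReal_le_ofReal
  have hlow : (c ^ d)⁻¹ * (1 + (δ ^ (2 * t))⁻¹) * (((4 : ℝ) ^ (t * i))⁻¹ * c ^ d) ≤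
      (c ^ d)⁻¹ * (1 + (δ ^ (2 * t))⁻¹) *
        (((4 : ℝ) ^ (t * i))⁻¹ * ∏ j, β (q / (2 * d) / 2 ^ i * k j)) := by gcongr
  refine le_trans ?_ hlow
  have : (c ^ d)⁻¹ * (1 + (δ ^ (2 * t))⁻¹) * (((4 : ℝ) ^ (t * i))⁻¹ * c ^ d) =
      (1 + (δ ^ (2 * t))⁻¹) * ((4 : ℝ) ^ (t * i))⁻¹ := by field_simp
  rw [this]
  have hN := freqSq_nonneg k
  -- The summand `1` of the constant serves `i = 0`, where no lower bound on the frequency is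
  -- available; `(δ ^ (2 * t))⁻¹` serves the other levels.
  rcases i with _ | i
  · have h1 : ((1 + q ^ 2 * freqSq k) ^ t)⁻¹ ≤ 1 := inv_le_one_of_one_le₀
      (one_le_pow₀ (by nlinarith [mul_nonneg (sq_nonneg q) hN]))
    have h2 : 0 < (δ ^ (2 * t))⁻¹ := by positivity
    simp only [Nat.mul_zero, pow_zero, inv_one, mul_one]
    linarith
  · have h1 := not_le.1 (hmin i (Nat.lt_succ_self i))
    have h2 : δ * 2 ^ (i + 1) ≤ q * ‖k‖ := by
      rw [div_div, div_mul_eq_mul_div, lt_div_iff₀ (by positivity)] at h1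
      refine le_trans ?_ h1.le
      rw [pow_succ]
      have : 0 < δ * 2 ^ i := by positivity
      nlinarith
    have h3 : δ ^ 2 * 4 ^ (i + 1) ≤ 1 + q ^ 2 * freqSq k := by
      have h4 : (δ * 2 ^ (i + 1)) ^ 2 ≤ (q * ‖k‖) ^ 2 := by gcongr
      have h5 := mul_le_mul_of_nonneg_left (norm_sq_le_freqSq k) (sq_nonneg q)
      have h6 : (δ * 2 ^ (i + 1)) ^ 2 = δ ^ 2 * 4 ^ (i + 1) := by
        rw [mul_pow, ← pow_mul, mul_comm (i + 1) 2, pow_mul]; norm_num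
      rw [mul_pow] at h4
      nlinarith
    calc ((1 + q ^ 2 * freqSq k) ^ t)⁻¹ ≤ ((δ ^ 2 * 4 ^ (i + 1)) ^ t)⁻¹ := by gcongr
      _ = (δ ^ (2 * t))⁻¹ * ((4 : ℝ) ^ (t * (i + 1)))⁻¹ := by
        rw [mul_pow, ← pow_mul, ← pow_mul, mul_inv, mul_comm (i + 1) t]
      _ ≤ _ := by gcongr; linarith

/-- A Bessel inequality for exponential sums over separated sets. -/
theorem exists_bessel {d : ℕ} (hd : 0 < d) {t : ℕ} (ht : (d : ℝ) / 2 < t) :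
    ∃ C : ℝ, 0 < C ∧ ∀ q : ℝ, 0 < q → q ≤ 1 → ∀ X : Finset (Torus d),
      (∀ x ∈ X, ∀ y ∈ X, x ≠ y → 2 * q ≤ torusDist x y) → ∀ c : Torus d → ℂ,
      ∑' k : Fin d → ℤ, ENNReal.ofReal (((1 + q ^ 2 * freqSq k) ^ t)⁻¹ *
        ‖∑ x ∈ X, c x * UnitAddTorus.mFourier k x‖ ^ 2) ≤
        ENNReal.ofReal (C * (q ^ d)⁻¹ * ∑ x ∈ X, ‖c x‖ ^ 2) := by
  obtain ⟨β, hβ, ⟨δ, c₀, hδ, hc₀, hβc⟩, -, hK⟩ := exists_torusKernel d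
  have hd' : (1 : ℝ) ≤ d := by exact_mod_cast hd
  have hdt : d + 1 ≤ 2 * t := by
    have : (d : ℝ) < 2 * t := by linarith
    exact_mod_cast this
  set A : ℝ := (c₀ ^ d)⁻¹ * (1 + (δ ^ (2 * t))⁻¹) with hA
  have hApos : 0 < A := by positivity
  refine ⟨A * (2 * d) ^ d * 2, by positivity, fun q hq hq1 X hX c => ?_⟩
  set S : (Fin d → ℤ) → ℝ := fun k => ‖∑ x ∈ X, c x * UnitAddTorus.mFourier k x‖ ^ 2 with hS
  have hS0 : ∀ k, 0 ≤ S k := fun k => sq_nonneg _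
  set M : ℝ := ∑ x ∈ X, ‖c x‖ ^ 2
  have hM : 0 ≤ M := Finset.sum_nonneg fun _ _ => sq_nonneg _
  -- At level `i` the normalization of the kernel costs `ε ^ (-d)`, that is `q ^ (-d) * 2 ^ (i * d)`
  -- up to a constant. The weight `4 ^ (-t i)` leaves at most `2 ^ (-i)`, because `t > d / 2` gives
  -- `2 * t ≥ d + 1` for integers, so the levels sum geometrically.
  have hlevel : ∀ i : ℕ, ∑' k : Fin d → ℤ, ENNReal.ofReal (((4 : ℝ) ^ (t * i))⁻¹ *
      (∏ j, β (q / (2 * d) / 2 ^ i * k j)) * S k) ≤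
      ENNReal.ofReal ((2 * d) ^ d * (q ^ d)⁻¹ * M) * (2⁻¹ : ℝ≥0∞) ^ i := by
    intro i
    set ε : ℝ := q / (2 * d) / 2 ^ i with hε
    have hε0 : 0 < ε := by positivity
    have hεq : ε ≤ q / (2 * d) := div_le_self (by positivity) (one_le_pow₀ (by norm_num))
    have hεh : ε ≤ 1 / 2 := hεq.trans (by
      rw [div_le_div_iff₀ (by positivity) (by norm_num)]; nlinarith)
    obtain ⟨-, ψ, h0, hz, hψ⟩ := hK ε hε0 hεh
    have hsum := hasSum_kernel_quadraticForm h0 hψ X (fun x hx y hy hxy => hz _ (by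
      obtain ⟨j, hj⟩ := exists_le_norm_of_le_torusDist hd hq (hX x hx y hy hxy)
      exact ⟨j, hεq.trans hj⟩)) c
    have hsum2 := hsum.mul_left (((4 : ℝ) ^ (t * i))⁻¹ * (ε ^ d)⁻¹)
    have hterm : ∀ k : Fin d → ℤ, ((4 : ℝ) ^ (t * i))⁻¹ * (ε ^ d)⁻¹ *
        (ε ^ d * (∏ j, β (ε * k j)) * S k) = ((4 : ℝ) ^ (t * i))⁻¹ * (∏ j, β (ε * k j)) * S k :=
      fun k => by field_simp
    have hsum3 := hsum2.congr_fun fun k => (hterm k).symm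
    rw [← ENNReal.ofReal_tsum_of_nonneg (fun k => by
      have := Finset.prod_nonneg (s := Finset.univ) (f := fun j => β (ε * k j)) fun j _ => hβ _
      have := hS0 k
      positivity) hsum3.summable, hsum3.tsum_eq]
    have h2 : (2⁻¹ : ℝ≥0∞) ^ i = ENNReal.ofReal ((2 ^ i)⁻¹) := by
      rw [ENNReal.ofReal_inv_of_pos (by positivity), ENNReal.ofReal_pow (by norm_num), ENNReal.inv_pow]
      norm_num
    rw [h2, ← ENNReal.ofReal_mul (by positivity)]
    apply ENNReal.ofReal_le_ofReal
    have h3 : (ε ^ d)⁻¹ = (2 * d) ^ d * (q ^ d)⁻¹ * 2 ^ (i * d) := by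
      rw [hε, div_pow, div_pow, ← pow_mul]
      field_simp
    have h4 : ((4 : ℝ) ^ (t * i))⁻¹ * 2 ^ (i * d) ≤ (2 ^ i)⁻¹ := by
      have : (4 : ℝ) ^ (t * i) = 2 ^ (2 * t * i) := by
        rw [mul_assoc, pow_mul _ 2]; norm_num
      rw [this, inv_mul_le_iff₀ (by positivity), ← div_eq_mul_inv, le_div_iff₀ (by positivity),
        ← pow_add]
      refine pow_le_pow_right₀ (by norm_num) ?_
      nlinarith
    calc ((4 : ℝ) ^ (t * i))⁻¹ * (ε ^ d)⁻¹ * M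
        = (2 * d) ^ d * (q ^ d)⁻¹ * M * (((4 : ℝ) ^ (t * i))⁻¹ * 2 ^ (i * d)) := by rw [h3]; ring
      _ ≤ _ := by gcongr
  calc ∑' k : Fin d → ℤ, ENNReal.ofReal (((1 + q ^ 2 * freqSq k) ^ t)⁻¹ * S k)
      ≤ ∑' k : Fin d → ℤ, ENNReal.ofReal A * ∑' i : ℕ, ENNReal.ofReal (((4 : ℝ) ^ (t * i))⁻¹ *
          (∏ j, β (q / (2 * d) / 2 ^ i * k j)) * S k) := by
        refine ENNReal.tsum_le_tsum fun k => ?_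
        rw [ENNReal.ofReal_mul' (hS0 k)]
        refine (mul_le_mul_left (inv_pow_le_tsum_dyadic hd t hδ hc₀ hβc hq k) _).trans ?_
        rw [mul_assoc, ← ENNReal.tsum_mul_right]
        simp_rw [← ENNReal.ofReal_mul' (hS0 k)]
        exact le_rfl
    _ = ENNReal.ofReal A * ∑' i : ℕ, ∑' k : Fin d → ℤ, ENNReal.ofReal (((4 : ℝ) ^ (t * i))⁻¹ *
          (∏ j, β (q / (2 * d) / 2 ^ i * k j)) * S k) := by
        rw [ENNReal.tsum_mul_left, ENNReal.tsum_comm]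
    _ ≤ ENNReal.ofReal A * ∑' i : ℕ, ENNReal.ofReal ((2 * d) ^ d * (q ^ d)⁻¹ * M) *
          (2⁻¹ : ℝ≥0∞) ^ i := by
        gcongr with i
        exact hlevel i
    _ = ENNReal.ofReal (A * (2 * d) ^ d * 2 * (q ^ d)⁻¹ * M) := by
        rw [ENNReal.tsum_mul_left, ENNReal.tsum_geometric, ENNReal.one_sub_inv_two, inv_inv,
          show (2 : ℝ≥0∞) = ENNReal.ofReal 2 by norm_num, ← ENNReal.ofReal_mul (by positivity),
          ← ENNReal.ofReal_mul (by positivity)]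
        congr 1
        ring

/-- The one-point case of the Bessel inequality, in which the exponential sum has modulus one. -/
theorem exists_tsum_inv_pow_le {d : ℕ} (hd : 0 < d) {t : ℕ} (ht : (d : ℝ) / 2 < t) :
    ∃ C : ℝ, 0 < C ∧ ∀ q : ℝ, 0 < q → q ≤ 1 →
      ∑' k : Fin d → ℤ, ENNReal.ofReal ((1 + q ^ 2 * freqSq k) ^ t)⁻¹ ≤
        ENNReal.ofReal (C * (q ^ d)⁻¹) := by
  obtain ⟨C, hC, h⟩ := exists_bessel hd ht
  refine ⟨C, hC, fun q hq hq1 => ?_⟩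
  have := h q hq hq1 {0} (by simp) 1
  simpa using this

end

/-! ### The space `W^s` as a weighted `ℓ²` space of coefficients. -/

section

open scoped ComplexConjugate

theorem summable_mul_and_tsum_le_sqrt {ι : Type*} {f g : ι → ℝ} (hf : ∀ i, 0 ≤ f i)
    (hg : ∀ i, 0 ≤ g i) (hf2 : Summable fun i => f i ^ 2) (hg2 : Summable fun i => g i ^ 2) :
    (Summable fun i => f i * g i) ∧
      ∑' i, f i * g i ≤ √(∑' i, f i ^ 2) * √(∑' i, g i ^ 2) := by
  have := Real.summable_and_inner_le_Lp_mul_Lq_tsum_of_nonneg Real.HolderConjugate.two_two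
    hf hg (by simpa only [Real.rpow_two] using hf2) (by simpa only [Real.rpow_two] using hg2)
  simpa only [Real.rpow_two, ← Real.sqrt_eq_rpow] using this

theorem summable_of_tsum_ofReal_ne_top {ι : Type*} {f : ι → ℝ} (hf : ∀ i, 0 ≤ f i)
    (h : ∑' i, ENNReal.ofReal (f i) ≠ ∞) : Summable f := by
  refine (ENNReal.summable_toReal h).congr fun i => ?_
  rw [ENNReal.toReal_ofReal (hf i)]

theorem tsum_le_of_tsum_ofReal_le {ι : Type*} {f : ι → ℝ} (hf : ∀ i, 0 ≤ f i) {C : ℝ} (hC : 0 ≤ C)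
    (h : ∑' i, ENNReal.ofReal (f i) ≤ ENNReal.ofReal C) : Summable f ∧ ∑' i, f i ≤ C := by
  have hs := summable_of_tsum_ofReal_ne_top hf (h.trans_lt ENNReal.ofReal_lt_top).ne
  refine ⟨hs, ?_⟩
  rwa [← ENNReal.ofReal_tsum_of_nonneg hf hs, ENNReal.ofReal_le_ofReal_iff hC] at h

/-- Square-summable coefficient sequences. -/
abbrev CoeffSpace (d : ℕ) : Type := lp (fun _ : Fin d → ℤ => ℂ) 2

theorem CoeffSpace.hasSum_norm_sq {d : ℕ} (a : CoeffSpace d) :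
    HasSum (fun k => ‖a k‖ ^ 2) (‖a‖ ^ 2) := by
  have := lp.hasSum_norm (by norm_num : 0 < (2 : ℝ≥0∞).toReal) a
  simpa only [ENNReal.toReal_ofNat, Real.rpow_two] using this

/-- The element of the coefficient space given by a square-summable family. -/
def CoeffSpace.ofSummable {d : ℕ} (a : (Fin d → ℤ) → ℂ) (ha : Summable fun k => ‖a k‖ ^ 2) :
    CoeffSpace d :=
  ⟨a, (memℓp_gen_iff (by norm_num)).2 (by simpa only [ENNReal.toReal_ofNat, Real.rpow_two])⟩

@[simp]
theorem CoeffSpace.ofSummable_apply {d : ℕ} (a : (Fin d → ℤ) → ℂ)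
    (ha : Summable fun k => ‖a k‖ ^ 2) (k : Fin d → ℤ) : CoeffSpace.ofSummable a ha k = a k := rfl

theorem CoeffSpace.norm_le_sqrt {d : ℕ} (a : CoeffSpace d) {C : ℝ}
    (h : ∑' k, ‖a k‖ ^ 2 ≤ C) : ‖a‖ ≤ √C := by
  rw [a.hasSum_norm_sq.tsum_eq] at h
  exact Real.le_sqrt_of_sq_le h

theorem sobolevWeight_eq {d : ℕ} (s : ℕ) (k : Fin d → ℤ) :
    sobolevWeight s k = (1 + 4 * Real.pi ^ 2 * freqSq k) ^ s := rfl

theorem one_le_sobolevWeight {d : ℕ} (s : ℕ) (k : Fin d → ℤ) : 1 ≤ sobolevWeight s k := by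
  have := freqSq_nonneg k
  rw [sobolevWeight_eq]
  exact one_le_pow₀ (le_add_of_nonneg_right (by positivity))

theorem sobolevWeight_pos {d : ℕ} (s : ℕ) (k : Fin d → ℤ) : 0 < sobolevWeight s k :=
  one_pos.trans_le (one_le_sobolevWeight s k)

theorem one_add_le_weightBase {d : ℕ} {q : ℝ} (hq : 0 ≤ q) (hq1 : q ≤ 1) (k : Fin d → ℤ) :
    1 + q ^ 2 * freqSq k ≤ 1 + 4 * Real.pi ^ 2 * freqSq k := by
  have := freqSq_nonneg k
  have := Real.pi_gt_three
  gcongr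
  nlinarith

theorem summable_inv_sobolevWeight {d : ℕ} (hd : 0 < d) {s : ℕ} (hs : (d : ℝ) / 2 < s) :
    Summable fun k : Fin d → ℤ => (sobolevWeight s k)⁻¹ := by
  obtain ⟨C, hC, h⟩ := exists_tsum_inv_pow_le hd hs
  have hN := fun k : Fin d → ℤ => freqSq_nonneg k
  have h1 := (tsum_le_of_tsum_ofReal_le (fun k => by have := hN k; positivity) (by positivity)
    (h 1 one_pos le_rfl)).1
  refine Summable.of_nonneg_of_le (fun k => (inv_pos.2 (sobolevWeight_pos s k)).le) (fun k => ?_) h1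
  rw [sobolevWeight_eq]
  have := hN k
  have := one_add_le_weightBase zero_le_one le_rfl k
  exact inv_anti₀ (by positivity) (pow_le_pow_left₀ (by positivity) this s)

/-- The square root of the reciprocal Sobolev weight. -/
def invSqrtWeight {d : ℕ} (s : ℕ) (k : Fin d → ℤ) : ℝ := (√(sobolevWeight s k))⁻¹

theorem invSqrtWeight_pos {d : ℕ} (s : ℕ) (k : Fin d → ℤ) : 0 < invSqrtWeight s k :=
  inv_pos.2 (Real.sqrt_pos.2 (sobolevWeight_pos s k))

theorem invSqrtWeight_sq {d : ℕ} (s : ℕ) (k : Fin d → ℤ) :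
    invSqrtWeight s k ^ 2 = (sobolevWeight s k)⁻¹ := by
  rw [invSqrtWeight, inv_pow, Real.sq_sqrt (sobolevWeight_pos s k).le]

theorem summable_invSqrtWeight_sq {d s : ℕ} (hd : 0 < d) (hs : (d : ℝ) / 2 < s)
    : Summable fun k : Fin d → ℤ => invSqrtWeight s k ^ 2 := by
  simpa only [invSqrtWeight_sq] using summable_inv_sobolevWeight hd hs

theorem summable_norm_weighted {d s : ℕ} (hd : 0 < d) (hs : (d : ℝ) / 2 < s)
    (a : CoeffSpace d) :
    Summable fun k => ‖(invSqrtWeight s k : ℂ) * a k‖ := by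
  refine ((summable_mul_and_tsum_le_sqrt (fun k => (invSqrtWeight_pos s k).le)
    (fun k => norm_nonneg (a k)) (summable_invSqrtWeight_sq hd hs)
    a.hasSum_norm_sq.summable).1).congr fun k => ?_
  rw [norm_mul, Complex.norm_real, Real.norm_of_nonneg (invSqrtWeight_pos s k).le]

theorem summable_weighted_mFourier {d s : ℕ} (hd : 0 < d) (hs : (d : ℝ) / 2 < s)
    (a : CoeffSpace d) :
    Summable fun k => ((invSqrtWeight s k : ℂ) * a k) • UnitAddTorus.mFourier k := by
  refine .of_norm ((summable_norm_weighted hd hs a).congr fun k => ?_)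
  rw [norm_smul, UnitAddTorus.mFourier_norm, mul_one]

/-- The isometry from the coefficient space onto the Sobolev space `W^s`, with values in the
continuous functions. -/
def sobolevMap {d s : ℕ} (hd : 0 < d) (hs : (d : ℝ) / 2 < s) : CoeffSpace d →L[ℂ] C(Torus d, ℂ) :=
  LinearMap.mkContinuous
    { toFun := fun a => ∑' k, ((invSqrtWeight s k : ℂ) * a k) • UnitAddTorus.mFourier k
      map_add' := fun a b => by
        rw [← (summable_weighted_mFourier hd hs a).tsum_add (summable_weighted_mFourier hd hs b)]
        congr 1 with k : 1
        change ((invSqrtWeight s k : ℂ) * (a k + b k)) • _ = _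
        rw [mul_add]
        exact add_smul (R := ℂ) (M := C(Torus d, ℂ)) _ _ _
      map_smul' := fun c a => by
        rw [RingHom.id_apply, ← (summable_weighted_mFourier hd hs a).tsum_const_smul]
        congr 1 with k : 1
        rw [lp.coeFn_smul, Pi.smul_apply, smul_smul, smul_eq_mul]
        congr 1
        ring }
    (√(∑' k : Fin d → ℤ, invSqrtWeight s k ^ 2)) fun a => by
      have h1 := summable_norm_weighted hd hs a
      have h2 : ∀ k, ‖((invSqrtWeight s k : ℂ) * a k) • UnitAddTorus.mFourier k‖ =
          invSqrtWeight s k * ‖a k‖ := fun k => by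
        rw [norm_smul, UnitAddTorus.mFourier_norm, mul_one, norm_mul, Complex.norm_real,
          Real.norm_of_nonneg (invSqrtWeight_pos s k).le]
      refine (norm_tsum_le_tsum_norm ?_).trans ?_
      · refine h1.congr fun k => ?_
        rw [norm_smul, UnitAddTorus.mFourier_norm, mul_one]
      · simp_rw [h2]
        have := (summable_mul_and_tsum_le_sqrt (fun k => (invSqrtWeight_pos s k).le)
          (fun k => norm_nonneg (a k)) (summable_invSqrtWeight_sq hd hs)
          a.hasSum_norm_sq.summable).2
        rwa [a.hasSum_norm_sq.tsum_eq, Real.sqrt_sq (norm_nonneg a)] at this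

theorem hasSum_sobolevMap {d s : ℕ} (hd : 0 < d) (hs : (d : ℝ) / 2 < s) (a : CoeffSpace d) :
    HasSum (fun k => ((invSqrtWeight s k : ℂ) * a k) • UnitAddTorus.mFourier k)
      (sobolevMap hd hs a) :=
  (summable_weighted_mFourier hd hs a).hasSum

theorem hasSum_sobolevMap_apply {d s : ℕ} (hd : 0 < d) (hs : (d : ℝ) / 2 < s) (a : CoeffSpace d) (x : Torus d) :
    HasSum (fun k => ((invSqrtWeight s k : ℂ) * a k) * UnitAddTorus.mFourier k x)
      (sobolevMap hd hs a x) :=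
  (ContinuousMap.evalCLM ℂ x).hasSum (hasSum_sobolevMap hd hs a)

/-- The Fourier coefficient as a continuous linear functional on continuous functions. -/
def coeffCLM {d : ℕ} (k : Fin d → ℤ) : C(Torus d, ℂ) →L[ℂ] ℂ :=
  (innerSL ℂ (ContinuousMap.toLp 2 (torusMeasure d) ℂ (UnitAddTorus.mFourier k))).comp
    (ContinuousMap.toLp 2 (torusMeasure d) ℂ)

theorem coeffCLM_apply {d : ℕ} (k : Fin d → ℤ) (g : C(Torus d, ℂ)) :
    coeffCLM k g = UnitAddTorus.mFourierCoeff g k := by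
  rw [← UnitAddTorus.mFourierCoeff_toLp, ← UnitAddTorus.mFourierBasis_repr,
    UnitAddTorus.mFourierBasis.repr_apply_apply, UnitAddTorus.coe_mFourierBasis]
  rfl

theorem coeffCLM_mFourier {d : ℕ} (k l : Fin d → ℤ) :
    coeffCLM k (UnitAddTorus.mFourier l) = if k = l then 1 else 0 :=
  orthonormal_iff_ite.1 UnitAddTorus.orthonormal_mFourier k l

theorem coeffCLM_of_hasSum {d : ℕ} {c : (Fin d → ℤ) → ℂ} {g : C(Torus d, ℂ)}
    (h : HasSum (fun k => c k • UnitAddTorus.mFourier k) g) (k : Fin d → ℤ) :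
    coeffCLM k g = c k := by
  have h1 := (coeffCLM k).hasSum h
  refine h1.unique ?_
  have h2 := hasSum_single (f := fun l => coeffCLM k (c l • UnitAddTorus.mFourier l)) k
    fun l hl => by simp [coeffCLM_mFourier, hl.symm]
  simpa [coeffCLM_mFourier] using h2

theorem hasSum_of_summable_coeff {d : ℕ} {g : C(Torus d, ℂ)}
    (h : Summable fun k => coeffCLM k g) :
    HasSum (fun k => coeffCLM k g • UnitAddTorus.mFourier k) g := by
  simp only [coeffCLM_apply] at h ⊢
  exact UnitAddTorus.hasSum_mFourier_series_of_summable h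

/-- Each coefficient functional outside the set is continuous and kills the span, hence its closure.
Conversely the Fourier series converges in `L²`, and when those coefficients vanish its partial sums
lie in the span. -/
theorem toLp_mem_trigSpace_iff {d : ℕ} (p : ℕ∞) (g : C(Torus d, ℂ)) :
    ContinuousMap.toLp 2 (torusMeasure d) ℂ g ∈ trigSpace d p ↔
      ∀ k, k ∉ firstFreqs d p → coeffCLM k g = 0 := by
  constructor
  · intro hg k hk
    have hle : trigSpace d p ≤ LinearMap.ker (innerSL ℂ
        (ContinuousMap.toLp 2 (torusMeasure d) ℂ (UnitAddTorus.mFourier k))).toLinearMap := by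
      refine Submodule.topologicalClosure_minimal _ ?_ (ContinuousLinearMap.isClosed_ker _)
      rw [Submodule.span_le]
      rintro _ ⟨l, hl, rfl⟩
      have hkl : k ≠ l := fun h => hk (h ▸ hl)
      have := coeffCLM_mFourier k l
      rw [if_neg hkl] at this
      exact this
    exact hle hg
  · intro h
    have hsum := UnitAddTorus.hasSum_mFourier_series_L2
      (ContinuousMap.toLp 2 (torusMeasure d) ℂ g)
    refine (Submodule.isClosed_topologicalClosure _).mem_of_tendsto hsum (.of_forall fun F => ?_)
    refine Submodule.sum_mem _ fun k _ => ?_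
    have hc : UnitAddTorus.mFourierCoeff (ContinuousMap.toLp 2 (torusMeasure d) ℂ g) k =
        coeffCLM k g := by
      rw [coeffCLM_apply]; exact UnitAddTorus.mFourierCoeff_toLp g k
    rw [hc]
    by_cases hk : k ∈ firstFreqs d p
    · exact Submodule.smul_mem _ _ (Submodule.le_topologicalClosure _
        (Submodule.subset_span ⟨k, hk, rfl⟩))
    · rw [h k hk, zero_smul]
      exact Submodule.zero_mem _

section Isometry

variable {d s : ℕ} (hd : 0 < d) (hs : (d : ℝ) / 2 < s)

theorem coeffCLM_sobolevMap (a : CoeffSpace d) (k : Fin d → ℤ) :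
    coeffCLM k (sobolevMap hd hs a) = invSqrtWeight s k * a k :=
  coeffCLM_of_hasSum (hasSum_sobolevMap hd hs a) k

theorem sobolevNorm_sobolevMap (a : CoeffSpace d) :
    sobolevNorm s (sobolevMap hd hs a) = ENNReal.ofReal ‖a‖ := by
  have h1 : ∀ k, sobolevWeight s k *
      ‖UnitAddTorus.mFourierCoeff (sobolevMap hd hs a) k‖ ^ 2 = ‖a k‖ ^ 2 := fun k => by
    rw [← coeffCLM_apply, coeffCLM_sobolevMap, norm_mul, mul_pow, Complex.norm_real,
      Real.norm_of_nonneg (invSqrtWeight_pos s k).le, invSqrtWeight_sq, ← mul_assoc,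
      mul_inv_cancel₀ (sobolevWeight_pos s k).ne', one_mul]
  rw [sobolevNorm]
  simp_rw [h1]
  rw [← ENNReal.ofReal_tsum_of_nonneg (fun _ => sq_nonneg _) a.hasSum_norm_sq.summable,
    a.hasSum_norm_sq.tsum_eq, ENNReal.ofReal_rpow_of_nonneg (by positivity) (by norm_num),
    ← Real.sqrt_eq_rpow, Real.sqrt_sq (norm_nonneg a)]

theorem summable_of_sobolevNorm_lt_top {s : ℕ} {g : Torus d → ℂ} (hg : sobolevNorm s g < ∞) :
    Summable fun k => sobolevWeight s k * ‖UnitAddTorus.mFourierCoeff g k‖ ^ 2 := by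
  refine summable_of_tsum_ofReal_ne_top
    (fun k => mul_nonneg (sobolevWeight_pos s k).le (sq_nonneg _)) fun h => ?_
  rw [sobolevNorm, h, ENNReal.top_rpow_of_pos (by norm_num)] at hg
  exact lt_irrefl _ hg

/-- The weighted coefficients of `g` are square summable, so the Fourier series converges absolutely
and its sum is `g` itself. Together with the norm identity this makes `sobolevMap` an isometric
parametrization of `W^s`. -/
theorem exists_sobolevMap_eq (g : C(Torus d, ℂ)) (hg : sobolevNorm s g < ∞) :
    ∃ a, sobolevMap hd hs a = g := by
  have h1 : Summable fun k => ‖((invSqrtWeight s k)⁻¹ : ℂ) * coeffCLM k g‖ ^ 2 := by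
    refine (summable_of_sobolevNorm_lt_top hg).congr fun k => ?_
    rw [norm_mul, mul_pow, norm_inv, Complex.norm_real,
      Real.norm_of_nonneg (invSqrtWeight_pos s k).le, inv_pow, invSqrtWeight_sq, inv_inv,
      coeffCLM_apply]
  let a := CoeffSpace.ofSummable _ h1
  have h2 : ∀ k, (invSqrtWeight s k : ℂ) * a k = coeffCLM k g := fun k => by
    have : (invSqrtWeight s k : ℂ) ≠ 0 := by exact_mod_cast (invSqrtWeight_pos s k).ne'
    rw [CoeffSpace.ofSummable_apply, mul_inv_cancel_left₀ this]
  have h3 := hasSum_of_summable_coeff (g := g)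
    (.of_norm ((summable_norm_weighted hd hs a).congr fun k => by rw [h2]))
  refine ⟨a, (hasSum_sobolevMap hd hs a).unique (h3.congr_fun fun k => by rw [h2])⟩

end Isometry

end

/-! ### Minimum norm interpolants: existence, uniqueness and the limit `p → ∞`. -/

section

theorem finite_setOf_freqLT {d : ℕ} (k : Fin d → ℤ) : {l | FreqLT l k}.Finite := by
  refine (Set.finite_Icc (fun _ : Fin d => -⌈‖k‖⌉) (fun _ => ⌈‖k‖⌉)).subset fun l hl => ?_
  have h1 : ‖l‖ ≤ ‖k‖ := by
    rcases hl with h | h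
    · exact h.le
    · exact h.1.le
  have h2 : ∀ j, |l j| ≤ ⌈‖k‖⌉ := fun j => by
    have h3 := (norm_le_pi_norm l j).trans (h1.trans (Int.le_ceil _))
    rw [Int.norm_eq_abs] at h3
    exact_mod_cast h3
  exact ⟨fun j => (abs_le.1 (h2 j)).1, fun j => (abs_le.1 (h2 j)).2⟩

/-- At `p = ∞` the strict inequality in the definition demands finitely many predecessors, which
holds because the order refines the `ℓ^∞` norm. -/
theorem mem_firstFreqs_top {d : ℕ} (k : Fin d → ℤ) : k ∈ firstFreqs d ⊤ :=
  Set.encard_lt_top_iff.2 (finite_setOf_freqLT k)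

theorem firstFreqs_mono {d : ℕ} {p p' : ℕ∞} (h : p ≤ p') : firstFreqs d p ⊆ firstFreqs d p' :=
  fun _ hk => lt_of_lt_of_le hk h

theorem exists_mem_firstFreqs {d : ℕ} (k : Fin d → ℤ) : ∃ n : ℕ, k ∈ firstFreqs d n := by
  refine ⟨{l | FreqLT l k}.ncard + 1, ?_⟩
  change {l | FreqLT l k}.encard < _
  rw [← (finite_setOf_freqLT k).cast_ncard_eq]
  exact_mod_cast Nat.lt_succ_self _

theorem eventually_mem_firstFreqs {d : ℕ} (k : Fin d → ℤ) :
    ∀ᶠ n : ℕ in atTop, k ∈ firstFreqs d n := by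
  obtain ⟨n, hn⟩ := exists_mem_firstFreqs k
  filter_upwards [eventually_ge_atTop n] with m hm
  exact firstFreqs_mono (by exact_mod_cast hm) hn

/-- Trigonometric polynomials form an algebra that separates points, so factors equal to `1` at `x`
and `0` at one other point can be multiplied, as in Lagrange interpolation. -/
theorem exists_trigPolynomial_separating {d : ℕ} (X : Finset (Torus d)) (x : Torus d) :
    ∃ g ∈ UnitAddTorus.mFourierSubalgebra (Fin d), g x = 1 ∧ ∀ z ∈ X, z ≠ x → g z = 0 := by
  classical
  have h : ∀ z : Torus d, z ≠ x → ∃ g ∈ UnitAddTorus.mFourierSubalgebra (Fin d),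
      g x = 1 ∧ g z = 0 := by
    intro z hz
    obtain ⟨_, ⟨f, hf, rfl⟩, hne⟩ := UnitAddTorus.mFourierSubalgebra_separatesPoints hz.symm
    have hne' : f x - f z ≠ 0 := sub_ne_zero.2 hne
    refine ⟨(f x - f z)⁻¹ • (f - algebraMap ℂ _ (f z)), ?_, ?_, ?_⟩
    · exact SMulMemClass.smul_mem _ (sub_mem hf (algebraMap_mem _ _))
    · simp [hne']
    · simp
  choose! g hg hgx hgz using h
  refine ⟨∏ z ∈ X.erase x, g z, prod_mem fun z hz => hg z (Finset.ne_of_mem_erase hz), ?_, ?_⟩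
  · rw [ContinuousMap.prod_apply]
    exact Finset.prod_eq_one fun z hz => hgx z (Finset.ne_of_mem_erase hz)
  · intro z hz hzx
    rw [ContinuousMap.prod_apply]
    exact Finset.prod_eq_zero (Finset.mem_erase.2 ⟨hzx, hz⟩) (hgz z hzx)

theorem exists_mem_span_firstFreqs {d : ℕ} {g : C(Torus d, ℂ)}
    (hg : g ∈ UnitAddTorus.mFourierSubalgebra (Fin d)) :
    ∃ n : ℕ, g ∈ Submodule.span ℂ (UnitAddTorus.mFourier '' firstFreqs d n) := by
  have h1 : g ∈ Submodule.span ℂ (Set.range (UnitAddTorus.mFourier (d := Fin d))) := by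
    rw [← UnitAddTorus.mFourierSubalgebra_coe]; exact hg
  have h2 : Set.range (UnitAddTorus.mFourier (d := Fin d)) =
      ⋃ n : ℕ, UnitAddTorus.mFourier '' firstFreqs d n := by
    rw [← Set.image_iUnion, ← Set.image_univ]
    congr 1
    exact (Set.eq_univ_of_forall fun k => Set.mem_iUnion.2 (exists_mem_firstFreqs k)).symm
  rw [h2, Submodule.span_iUnion, Submodule.mem_iSup_of_directed] at h1
  · exact h1
  · exact Monotone.directed_le fun m n hmn => Submodule.span_mono
      (Set.image_mono (firstFreqs_mono (by exact_mod_cast hmn)))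

theorem isSamplingSet {d : ℕ} (X : Finset (Torus d)) : IsSamplingSet X := by
  classical
  choose g hg hgx hgz using exists_trigPolynomial_separating X
  choose n hn using fun x => exists_mem_span_firstFreqs (hg x)
  refine ⟨X.sup n, fun y => ⟨∑ x : X, y x • g x, Submodule.sum_mem _ fun x _ =>
    Submodule.smul_mem _ _ (Submodule.span_mono (Set.image_mono (firstFreqs_mono
      (by exact_mod_cast Finset.le_sup x.2))) (hn x)), fun x => ?_⟩⟩
  rw [ContinuousMap.sum_apply, Finset.sum_eq_single x]
  · simp [hgx]
  · intro z _ hz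
    simp [hgz z.1 x.1 x.2 (fun h => hz (Subtype.ext h.symm))]
  · simp

theorem interpolates_samplingIndex {d : ℕ} (X : Finset (Torus d)) :
    Interpolates X (samplingIndex X) := Nat.sInf_mem (isSamplingSet X)

/-- The element of least norm in a translate of a closed subspace, with its Pythagorean identity. -/
theorem exists_norm_sq_eq_add {E : Type*} [NormedAddCommGroup E] [InnerProductSpace ℂ E]
    [CompleteSpace E] (V : Submodule ℂ E) (hV : IsClosed (V : Set E)) (a₀ : E) :
    ∃ a, a - a₀ ∈ V ∧ ∀ b, b - a₀ ∈ V → ‖b‖ ^ 2 = ‖a‖ ^ 2 + ‖b - a‖ ^ 2 := by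
  have : CompleteSpace V := hV.completeSpace_coe
  obtain ⟨y, hy, z, hz, rfl⟩ := Submodule.exists_add_mem_mem_orthogonal (K := V) a₀
  refine ⟨z, by simpa using hy, fun b hb => ?_⟩
  have hbz : b - z ∈ V := by
    have := V.add_mem hb hy
    rwa [show b - (y + z) + y = b - z by abel] at this
  have h := norm_add_sq_eq_norm_sq_add_norm_sq_of_inner_eq_zero z (b - z)
    ((Submodule.mem_orthogonal' V z).1 hz _ hbz)
  rw [add_sub_cancel] at h
  rw [sq, sq, sq, h]

section Interpolants

variable {d s : ℕ} (hd : 0 < d) (hs : (d : ℝ) / 2 < s)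

/-- The coefficient sequences of the interpolants. -/
def coeffInterpolants (X : Finset (Torus d)) (y : Torus d → ℂ) (p : ℕ∞) : Set (CoeffSpace d) :=
  {a | (∀ k, k ∉ firstFreqs d p → a k = 0) ∧ ∀ x ∈ X, sobolevMap hd hs a x = y x}

theorem coeffInterpolants_mono (X : Finset (Torus d)) (y : Torus d → ℂ) {p p' : ℕ∞} (h : p ≤ p') :
    coeffInterpolants hd hs X y p ⊆ coeffInterpolants hd hs X y p' :=
  fun _ ha => ⟨fun k hk => ha.1 k fun hk' => hk (firstFreqs_mono h hk'), ha.2⟩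

theorem sobolevMap_mem_interpolants_iff (X : Finset (Torus d)) (y : Torus d → ℂ) (p : ℕ∞)
    (a : CoeffSpace d) :
    sobolevMap hd hs a ∈ interpolants s X y p ↔ a ∈ coeffInterpolants hd hs X y p := by
  have hv : ∀ k : Fin d → ℤ, (invSqrtWeight s k : ℂ) ≠ 0 := fun k => by
    exact_mod_cast (invSqrtWeight_pos s k).ne'
  rw [interpolants, Set.mem_ofPred_eq, toLp_mem_trigSpace_iff, sobolevNorm_sobolevMap]
  simp [coeffInterpolants, coeffCLM_sobolevMap, hv]

theorem exists_mem_coeffInterpolants {X : Finset (Torus d)} {y : Torus d → ℂ} {p : ℕ∞}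
    {g : C(Torus d, ℂ)} (hg : g ∈ interpolants s X y p) :
    ∃ a ∈ coeffInterpolants hd hs X y p, sobolevMap hd hs a = g := by
  obtain ⟨a, rfl⟩ := exists_sobolevMap_eq hd hs g hg.2.1
  exact ⟨a, (sobolevMap_mem_interpolants_iff hd hs X y p a).1 hg, rfl⟩

/-- The homogeneous version of `coeffInterpolants`. -/
def coeffNullspace (X : Finset (Torus d)) (p : ℕ∞) : Submodule ℂ (CoeffSpace d) where
  carrier := coeffInterpolants hd hs X 0 p
  zero_mem' := ⟨fun _ _ => rfl, fun x _ => by simp⟩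
  add_mem' := fun {a b} ha hb => ⟨fun k hk => by
    change a k + b k = 0
    rw [ha.1 k hk, hb.1 k hk, add_zero], fun x hx => by
    rw [map_add, ContinuousMap.add_apply, ha.2 x hx, hb.2 x hx]; simp⟩
  smul_mem' := fun c {a} ha => ⟨fun k hk => by
    change c * a k = 0
    rw [ha.1 k hk, mul_zero], fun x hx => by
    rw [map_smul, ContinuousMap.smul_apply, ha.2 x hx]; simp⟩

theorem isClosed_coeffNullspace (X : Finset (Torus d)) (p : ℕ∞) :
    IsClosed (coeffNullspace hd hs X p : Set (CoeffSpace d)) := by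
  have h : (coeffNullspace hd hs X p : Set (CoeffSpace d)) =
      (⋂ (k) (_ : k ∉ firstFreqs d p), {a | lp.evalCLM ℂ (fun _ : Fin d → ℤ => ℂ) 2 k a = 0}) ∩
      ⋂ x ∈ X, {a | sobolevMap hd hs a x = 0} := by
    ext a
    simp only [Set.mem_inter_iff, Set.mem_iInter]
    exact Iff.rfl
  rw [h]
  refine (isClosed_iInter fun k => isClosed_iInter fun _ => ?_).inter
    (isClosed_iInter fun x => isClosed_iInter fun _ => ?_)
  · exact isClosed_eq (lp.evalCLM ℂ (fun _ : Fin d → ℤ => ℂ) 2 k).continuous continuous_const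
  · exact isClosed_eq ((ContinuousMap.evalCLM ℂ x).comp (sobolevMap hd hs)).continuous
      continuous_const

theorem sub_mem_coeffNullspace_iff {X : Finset (Torus d)} {y : Torus d → ℂ} {p : ℕ∞}
    {a₀ : CoeffSpace d} (h₀ : a₀ ∈ coeffInterpolants hd hs X y p) (a : CoeffSpace d) :
    a - a₀ ∈ coeffNullspace hd hs X p ↔ a ∈ coeffInterpolants hd hs X y p := by
  change a - a₀ ∈ coeffInterpolants hd hs X 0 p ↔ _
  have h1 : ∀ k, (a - a₀) k = a k - a₀ k := fun k => rfl
  refine and_congr (forall₂_congr fun k hk => ?_) (forall₂_congr fun x hx => ?_)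
  · rw [h1, h₀.1 k hk, sub_zero]
  · rw [map_sub, ContinuousMap.sub_apply, h₀.2 x hx, Pi.zero_apply, sub_eq_zero]

theorem exists_sobolevMap_eq_of_mem_span {p : ℕ∞} {g : C(Torus d, ℂ)}
    (hg : g ∈ Submodule.span ℂ (UnitAddTorus.mFourier '' firstFreqs d p)) :
    ∃ a, sobolevMap hd hs a = g ∧ ∀ k, k ∉ firstFreqs d p → a k = 0 := by
  classical
  -- With no interpolation nodes, `coeffNullspace` imposes only the restriction on frequencies.
  have hle : Submodule.span ℂ (UnitAddTorus.mFourier '' firstFreqs d p) ≤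
      (coeffNullspace hd hs ∅ p).map (sobolevMap hd hs).toLinearMap := by
    rw [Submodule.span_le]
    rintro _ ⟨k, hk, rfl⟩
    have hv : (invSqrtWeight s k : ℂ) ≠ 0 := by exact_mod_cast (invSqrtWeight_pos s k).ne'
    refine ⟨lp.single 2 k ((invSqrtWeight s k : ℂ)⁻¹), ⟨fun l hl => ?_, by simp⟩, ?_⟩
    · exact lp.single_apply_ne 2 k _ fun h => hl (h ▸ hk)
    · have h1 := hasSum_sobolevMap hd hs (lp.single 2 k ((invSqrtWeight s k : ℂ)⁻¹))
      refine h1.unique ?_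
      have h2 := hasSum_single (f := fun l => ((invSqrtWeight s l : ℂ) *
        (lp.single (E := fun _ : Fin d → ℤ => ℂ) 2 k ((invSqrtWeight s k : ℂ)⁻¹)) l) •
          UnitAddTorus.mFourier l) k fun l hl => by
            rw [lp.single_apply_ne 2 k _ hl, mul_zero]
            exact zero_smul ℂ (UnitAddTorus.mFourier l)
      rw [lp.single_apply_self, mul_inv_cancel₀ hv, one_smul] at h2
      exact h2
  obtain ⟨a, ha, rfl⟩ := hle hg
  exact ⟨a, rfl, ha.1⟩

/-- Cardinal functions using only the first `p_X` frequencies. One family serves all `p ≥ p_X`, so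
corrections built from it depend continuously on the data to be corrected. -/
theorem exists_coeff_cardinal (X : Finset (Torus d)) : ∃ ρ : Torus d → CoeffSpace d,
    ∀ x ∈ X, (∀ k, k ∉ firstFreqs d (samplingIndex X) → ρ x k = 0) ∧
      sobolevMap hd hs (ρ x) x = 1 ∧ ∀ z ∈ X, z ≠ x → sobolevMap hd hs (ρ x) z = 0 := by
  classical
  have h : ∀ x ∈ X, ∃ a : CoeffSpace d,
      (∀ k, k ∉ firstFreqs d (samplingIndex X) → a k = 0) ∧
      sobolevMap hd hs a x = 1 ∧ ∀ z ∈ X, z ≠ x → sobolevMap hd hs a z = 0 := fun x hx => by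
    obtain ⟨g, hg, hgx⟩ := interpolates_samplingIndex X (Pi.single ⟨x, hx⟩ 1)
    obtain ⟨a, rfl, ha⟩ := exists_sobolevMap_eq_of_mem_span hd hs hg
    refine ⟨a, ha, ?_, fun z hz hzx => ?_⟩
    · simpa using hgx ⟨x, hx⟩
    · rw [hgx ⟨z, hz⟩, Pi.single_eq_of_ne]
      exact fun h => hzx (congr_arg Subtype.val h)
  choose! ρ hρ using h
  exact ⟨ρ, hρ⟩

theorem add_sum_smul_mem_coeffInterpolants {X : Finset (Torus d)} {ρ : Torus d → CoeffSpace d}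
    (hρ : ∀ x ∈ X, (∀ k, k ∉ firstFreqs d (samplingIndex X) → ρ x k = 0) ∧
      sobolevMap hd hs (ρ x) x = 1 ∧ ∀ z ∈ X, z ≠ x → sobolevMap hd hs (ρ x) z = 0)
    {p : ℕ∞} (hp : (samplingIndex X : ℕ∞) ≤ p) (y : Torus d → ℂ) {a : CoeffSpace d}
    (ha : ∀ k, k ∉ firstFreqs d p → a k = 0) :
    a + ∑ x ∈ X, (y x - sobolevMap hd hs a x) • ρ x ∈ coeffInterpolants hd hs X y p := by
  constructor
  · intro k hk
    change a k + (∑ x ∈ X, (y x - sobolevMap hd hs a x) • ρ x : CoeffSpace d) k = 0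
    rw [ha k hk, zero_add, lp.coeFn_sum, Finset.sum_apply]
    refine Finset.sum_eq_zero fun x hx => ?_
    rw [lp.coeFn_smul, Pi.smul_apply, (hρ x hx).1 k fun h => hk (firstFreqs_mono hp h), smul_zero]
  · intro z hz
    rw [map_add, map_sum, ContinuousMap.add_apply, ContinuousMap.sum_apply,
      Finset.sum_eq_single z]
    · simp [(hρ z hz).2.1]
    · intro x hx hxz
      simp [(hρ x hx).2.2 z hz hxz.symm]
    · exact fun h => absurd hz h

theorem coeffInterpolants_nonempty (X : Finset (Torus d)) (y : Torus d → ℂ) {p : ℕ∞}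
    (hp : (samplingIndex X : ℕ∞) ≤ p) : (coeffInterpolants hd hs X y p).Nonempty := by
  obtain ⟨ρ, hρ⟩ := exists_coeff_cardinal hd hs X
  exact ⟨_, add_sum_smul_mem_coeffInterpolants hd hs hρ hp y (a := 0) fun _ _ => rfl⟩

theorem exists_coeff_minimizer {X : Finset (Torus d)} {y : Torus d → ℂ} {p : ℕ∞}
    (h : (coeffInterpolants hd hs X y p).Nonempty) :
    ∃ a ∈ coeffInterpolants hd hs X y p, ∀ b ∈ coeffInterpolants hd hs X y p,
      ‖b‖ ^ 2 = ‖a‖ ^ 2 + ‖b - a‖ ^ 2 := by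
  obtain ⟨a₀, h₀⟩ := h
  obtain ⟨a, ha, h⟩ := exists_norm_sq_eq_add _ (isClosed_coeffNullspace hd hs X p) a₀
  exact ⟨a, (sub_mem_coeffNullspace_iff hd hs h₀ a).1 ha, fun b hb =>
    h b ((sub_mem_coeffNullspace_iff hd hs h₀ b).2 hb)⟩

/-- The projection `a'` is a competitor, so minimality of `a` forces `‖a - a'‖ = 0` in the
Pythagorean identity of `a'`. Thus bare minimality upgrades to that identity. -/
theorem IsMinNormInterpolant.exists_coeff {X : Finset (Torus d)} {y : Torus d → ℂ} {p : ℕ∞}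
    {g : C(Torus d, ℂ)} (hg : IsMinNormInterpolant s X y p g) :
    ∃ a ∈ coeffInterpolants hd hs X y p, sobolevMap hd hs a = g ∧
      ∀ b ∈ coeffInterpolants hd hs X y p, ‖b‖ ^ 2 = ‖a‖ ^ 2 + ‖b - a‖ ^ 2 := by
  obtain ⟨a, ha, rfl⟩ := exists_mem_coeffInterpolants hd hs hg.1
  obtain ⟨a', ha', h⟩ := exists_coeff_minimizer hd hs ⟨a, ha⟩
  have h1 := hg.2 _ ((sobolevMap_mem_interpolants_iff hd hs X y p a').2 ha')
  rw [sobolevNorm_sobolevMap, sobolevNorm_sobolevMap,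
    ENNReal.ofReal_le_ofReal_iff (norm_nonneg _)] at h1
  have h2 := h a ha
  have h3 : ‖a‖ ^ 2 ≤ ‖a'‖ ^ 2 := by gcongr
  have h4 : ‖a - a'‖ = 0 := by
    rw [← sq_eq_zero_iff]
    exact le_antisymm (by linarith) (sq_nonneg _)
  obtain rfl : a = a' := sub_eq_zero.1 (norm_eq_zero.1 h4)
  exact ⟨a, ha, rfl, h⟩

end Interpolants

theorem existsUnique_isMinNormInterpolant {d s : ℕ} (hd : 0 < d) (hs : (d : ℝ) / 2 < s)
    (X : Finset (Torus d)) (y : Torus d → ℂ) {p : ℕ∞}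
    (hp : (samplingIndex X : ℕ∞) ≤ p) : ∃! g, IsMinNormInterpolant s X y p g := by
  obtain ⟨a, ha, h⟩ := exists_coeff_minimizer hd hs (coeffInterpolants_nonempty hd hs X y hp)
  refine ⟨sobolevMap hd hs a,
    ⟨(sobolevMap_mem_interpolants_iff hd hs X y p a).2 ha, fun g' hg' => ?_⟩, fun g hg => ?_⟩
  · obtain ⟨b, hb, rfl⟩ := exists_mem_coeffInterpolants hd hs hg'
    rw [sobolevNorm_sobolevMap, sobolevNorm_sobolevMap]
    refine ENNReal.ofReal_le_ofReal (le_of_sq_le_sq ?_ (norm_nonneg b))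
    have := h b hb
    nlinarith [sq_nonneg ‖b - a‖]
  · obtain ⟨b, hb, rfl, hb'⟩ := IsMinNormInterpolant.exists_coeff hd hs hg
    have h1 := h b hb
    have h2 := hb' a ha
    have h3 : ‖b - a‖ = 0 := by
      rw [← sq_eq_zero_iff]
      nlinarith [sq_nonneg ‖b - a‖, sq_nonneg ‖a - b‖]
    rw [sub_eq_zero.1 (norm_eq_zero.1 h3)]

/-- The restriction of a coefficient sequence to a set of frequencies. -/
def CoeffSpace.restrict {d : ℕ} (S : Set (Fin d → ℤ)) (a : CoeffSpace d) : CoeffSpace d :=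
  CoeffSpace.ofSummable (S.indicator a) (by
    refine a.hasSum_norm_sq.summable.of_nonneg_of_le (fun k => sq_nonneg _) fun k => ?_
    gcongr
    exact norm_indicator_le_norm_self _ _)

theorem CoeffSpace.tendsto_restrict_firstFreqs {d : ℕ} (a : CoeffSpace d) :
    Tendsto (fun n : ℕ => a.restrict (firstFreqs d n)) atTop (𝓝 a) := by
  rw [tendsto_iff_norm_sub_tendsto_zero]
  have h1 : Tendsto (fun n : ℕ => ‖a.restrict (firstFreqs d n) - a‖ ^ 2) atTop (𝓝 0) := by
    have h2 : ∀ n : ℕ, ‖a.restrict (firstFreqs d n) - a‖ ^ 2 =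
        ∑' k, ‖(firstFreqs d n).indicator a k - a k‖ ^ 2 := fun n =>
      (CoeffSpace.hasSum_norm_sq _).tsum_eq.symm
    simp_rw [h2]
    rw [← tsum_zero (α := ℝ) (β := Fin d → ℤ)]
    refine tendsto_tsum_of_dominated_convergence a.hasSum_norm_sq.summable (fun k => ?_)
      (.of_forall fun n k => ?_)
    · refine tendsto_const_nhds.congr' ?_
      filter_upwards [eventually_mem_firstFreqs k] with n hn
      simp [Set.indicator_of_mem hn]
    · by_cases hk : k ∈ firstFreqs d n
      · simp [Set.indicator_of_mem hk]
      · simp [Set.indicator_of_notMem hk]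
  have h3 := h1.sqrt
  simpa [Real.sqrt_sq] using h3

/-- Truncating the limiting coefficients and repairing the values on `X` with cardinal functions
gives competitors `b n` that tend to `a ⊤`. The Pythagorean identity at level `∞` together with
minimality at level `n` gives `‖a n - a ⊤‖² = ‖a n‖² - ‖a ⊤‖² ≤ ‖b n‖² - ‖a ⊤‖²`, which tends to
zero. -/
theorem tendsto_isMinNormInterpolant {d s : ℕ} (hd : 0 < d) (hs : (d : ℝ) / 2 < s)
    {X : Finset (Torus d)} {y : Torus d → ℂ} {F : ℕ∞ → C(Torus d, ℂ)}
    (hF : ∀ p : ℕ∞, (samplingIndex X : ℕ∞) ≤ p → IsMinNormInterpolant s X y p (F p)) :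
    Tendsto (fun n : ℕ => F n) atTop (𝓝 (F ⊤)) := by
  have hex : ∀ p : ℕ∞, ∃ a : CoeffSpace d, (samplingIndex X : ℕ∞) ≤ p →
      a ∈ coeffInterpolants hd hs X y p ∧ sobolevMap hd hs a = F p ∧
      ∀ b ∈ coeffInterpolants hd hs X y p, ‖b‖ ^ 2 = ‖a‖ ^ 2 + ‖b - a‖ ^ 2 := fun p => by
    by_cases hp : (samplingIndex X : ℕ∞) ≤ p
    · obtain ⟨a, h⟩ := IsMinNormInterpolant.exists_coeff hd hs (hF p hp)
      exact ⟨a, fun _ => h⟩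
    · exact ⟨0, fun h => absurd h hp⟩
  choose a ha using hex
  obtain ⟨ρ, hρ⟩ := exists_coeff_cardinal hd hs X
  obtain ⟨htm, htF, htmin⟩ := ha ⊤ le_top
  let P : ℕ → CoeffSpace d := fun n => (a ⊤).restrict (firstFreqs d n)
  let b : ℕ → CoeffSpace d := fun n => P n + ∑ x ∈ X, (y x - sobolevMap hd hs (P n) x) • ρ x
  have hP : Tendsto P atTop (𝓝 (a ⊤)) := (a ⊤).tendsto_restrict_firstFreqs
  have hb : Tendsto b atTop (𝓝 (a ⊤)) := by
    have h1 : Tendsto b atTop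
        (𝓝 (a ⊤ + ∑ x ∈ X, (y x - sobolevMap hd hs (a ⊤) x) • ρ x)) := by
      refine hP.add (tendsto_finsetSum _ fun x _ => (tendsto_const_nhds.sub ?_).smul_const _)
      exact (((ContinuousMap.evalCLM ℂ x).comp (sobolevMap hd hs)).continuous.tendsto _).comp hP
    rwa [Finset.sum_eq_zero fun x hx => by rw [htm.2 x hx, sub_self, zero_smul], add_zero] at h1
  have hlim : Tendsto (fun n : ℕ => ‖a n - a ⊤‖) atTop (𝓝 0) := by
    have h1 : Tendsto (fun n : ℕ => √(‖b n‖ ^ 2 - ‖a ⊤‖ ^ 2)) atTop (𝓝 0) := by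
      have := ((hb.norm.pow 2).sub_const (‖a ⊤‖ ^ 2)).sqrt
      simpa using this
    refine squeeze_zero' (.of_forall fun n => norm_nonneg _) ?_ h1
    filter_upwards [eventually_ge_atTop (samplingIndex X)] with n hn
    have hn' : (samplingIndex X : ℕ∞) ≤ n := by exact_mod_cast hn
    obtain ⟨hm, -, hmin⟩ := ha n hn'
    have h2 := hmin (b n) (add_sum_smul_mem_coeffInterpolants hd hs hρ hn' y fun k hk =>
      Set.indicator_of_notMem hk _)
    have h3 := htmin (a n) (coeffInterpolants_mono hd hs X y le_top hm)
    refine Real.le_sqrt_of_sq_le ?_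
    nlinarith [sq_nonneg ‖b n - a n‖]
  have hlim' : Tendsto (fun n : ℕ => a n) atTop (𝓝 (a ⊤)) :=
    tendsto_iff_norm_sub_tendsto_zero.2 hlim
  have h4 := ((sobolevMap hd hs).continuous.tendsto _).comp hlim'
  rw [htF] at h4
  refine h4.congr' ?_
  filter_upwards [eventually_ge_atTop (samplingIndex X)] with n hn
  exact (ha n (by exact_mod_cast hn)).2.1

theorem eLpNorm_continuousMap_le {d : ℕ} (q : ℝ≥0∞) (g : C(Torus d, ℂ)) :
    eLpNorm g q (torusMeasure d) ≤ ENNReal.ofReal ‖g‖ := by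
  have := eLpNorm_le_of_ae_bound (p := q) (μ := torusMeasure d) (f := g) (C := ‖g‖)
    (.of_forall fun x => g.norm_coe_le_norm x)
  simpa using this

theorem tendsto_lqError {d : ℕ} {f : Torus d → ℂ} (hf : Continuous f) {G : ℕ → C(Torus d, ℂ)}
    {g : C(Torus d, ℂ)} (hG : Tendsto G atTop (𝓝 g)) {q : ℝ≥0∞} (hq : 1 ≤ q) :
    Tendsto (fun n => lqError q f (G n)) atTop (𝓝 (lqError q f g)) := by
  have hc : Tendsto (fun n => ENNReal.ofReal ‖G n - g‖) atTop (𝓝 0) := by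
    have := ENNReal.tendsto_ofReal (tendsto_iff_norm_sub_tendsto_zero.1 hG)
    simpa using this
  have htri : ∀ g₁ g₂ : C(Torus d, ℂ),
      lqError q f g₁ ≤ lqError q f g₂ + ENNReal.ofReal ‖g₁ - g₂‖ := fun g₁ g₂ => by
    have h1 : (fun x => f x - g₁ x) = (fun x => f x - g₂ x) + ⇑(g₂ - g₁) := by
      ext x; simp
    rw [lqError, h1, norm_sub_rev]
    refine (eLpNorm_add_le ?_ ?_ hq).trans ?_
    · exact (hf.sub g₂.continuous).aestronglyMeasurable
    · exact (g₂ - g₁).continuous.aestronglyMeasurable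
    · exact add_le_add le_rfl (eLpNorm_continuousMap_le q _)
  have hup : Tendsto (fun n => lqError q f g + ENNReal.ofReal ‖G n - g‖) atTop
      (𝓝 (lqError q f g)) := by simpa using hc.const_add (lqError q f g)
  -- Truncated subtraction on `[0, ∞]` is continuous here only because the error is finite.
  have hfin : lqError q f g ≠ ∞ := by
    have := eLpNorm_continuousMap_le q ((⟨f, hf⟩ : C(Torus d, ℂ)) - g)
    exact (this.trans_lt ENNReal.ofReal_lt_top).ne
  have hlow : Tendsto (fun n => lqError q f g - ENNReal.ofReal ‖G n - g‖) atTop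
      (𝓝 (lqError q f g)) := by
    have := ENNReal.Tendsto.sub (tendsto_const_nhds (x := lqError q f g)) hc (.inl hfin)
    simpa using this
  refine tendsto_of_tendsto_of_tendsto_of_le_of_le hlow hup (fun n => ?_) fun n => htri _ _
  rw [tsub_le_iff_right, norm_sub_rev]
  exact htri _ _

theorem lqError_le_lqError_top {d : ℕ} {f : Torus d → ℂ} (hf : Continuous f) (g : C(Torus d, ℂ))
    (q : ℝ≥0∞) : lqError q f g ≤ lqError ∞ f g :=
  eLpNorm_le_eLpNorm_of_exponent_le le_top (hf.sub g.continuous).aestronglyMeasurable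

end

/-! ### Local polynomial reproduction and functions vanishing on `X`. -/

section

/-- The matrix of the monomials of degree less than `t` in each variable at a family of points
indexed by the tensor grid. -/
def monomialMatrix {d t : ℕ} (ζ : (Fin d → Fin t) → Fin d → ℝ) :
    Matrix (Fin d → Fin t) (Fin d → Fin t) ℝ :=
  Matrix.of fun α β => ∏ j, ζ β j ^ (α j : ℕ)

/-- A left null vector is the coefficient vector of a polynomial of degree less than `t` in each
variable that vanishes on the grid `{0, …, t-1}^d`; such a polynomial is zero. -/
theorem det_monomialMatrix_grid_ne_zero (d t : ℕ) :
    (monomialMatrix fun (β : Fin d → Fin t) j => ((β j : ℕ) : ℝ)).det ≠ 0 := by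
  classical
  intro hdet
  obtain ⟨c, hc, hcM⟩ := Matrix.exists_vecMul_eq_zero_iff.2 hdet
  let e : (Fin d → Fin t) → (Fin d →₀ ℕ) := fun α => Finsupp.equivFunOnFinite.symm fun j => (α j : ℕ)
  have he : Function.Injective e := fun α α' h => by
    have := Finsupp.equivFunOnFinite.symm.injective h
    funext j
    exact Fin.ext (congr_fun this j)
  let P : MvPolynomial (Fin d) ℝ := ∑ α, MvPolynomial.monomial (e α) (c α)
  have hP : P = 0 := by
    refine MvPolynomial.eq_zero_of_eval_zero_at_prod_finset P
      (fun _ => (Finset.range t).image fun n : ℕ => (n : ℝ)) (fun i => ?_) fun x hx => ?_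
    · rw [Finset.card_image_of_injective _ Nat.cast_injective, Finset.card_range]
      by_cases ht : t = 0
      · subst ht
        exact absurd (funext fun α => (α i).elim0) hc
      have hmem : P ∈ MvPolynomial.restrictDegree (Fin d) ℝ (t - 1) := by
        refine Submodule.sum_mem _ fun α _ => ?_
        rw [MvPolynomial.mem_restrictDegree]
        intro s hs j
        have := Finset.mem_singleton.1 (MvPolynomial.support_monomial_subset hs)
        rw [this]
        exact Nat.le_sub_one_of_lt (α j).2
      rw [MvPolynomial.mem_restrictDegree_iff_sup] at hmem
      have h1 := hmem i
      rw [MvPolynomial.degreeOf_def]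
      omega
    · have hx' : ∀ i, ∃ n : Fin t, ((n : ℕ) : ℝ) = x i := fun i => by
        obtain ⟨n, hn, h⟩ := Finset.mem_image.1 (hx i)
        exact ⟨⟨n, Finset.mem_range.1 hn⟩, h⟩
      choose β hβ using hx'
      have := congr_fun hcM β
      simp only [Matrix.vecMul, dotProduct, monomialMatrix, Matrix.of_apply, Pi.zero_apply] at this
      rw [← this, map_sum]
      refine Finset.sum_congr rfl fun α _ => ?_
      rw [MvPolynomial.eval_monomial, Finsupp.prod_fintype _ _ (by simp)]
      simp [e, hβ]
  apply hc
  funext α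
  have h1 : MvPolynomial.coeff (e α) P = c α := by
    simp only [P, MvPolynomial.coeff_sum, MvPolynomial.coeff_monomial, he.eq_iff]
    simp
  rw [← h1, hP]
  simp

/-- Expanding the power of the linear form gives monomials with every exponent at most `m < t`, and
the trivial monomial occurs only for `m = 0`. Powers of linear forms are what the Taylor series of
an exponential requires. -/
theorem sum_mul_pow_eq_of_monomials {d t : ℕ} {ι : Type*} [Fintype ι] {ζ : ι → Fin d → ℝ}
    {a : ι → ℝ} (h : ∀ α : Fin d → ℕ, (∀ j, α j < t) →
      ∑ β, a β * ∏ j, ζ β j ^ α j = if α = 0 then 1 else 0)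
    (κ : Fin d → ℝ) {m : ℕ} (hm : m < t) :
    ∑ β, a β * (∑ j, κ j * ζ β j) ^ m = if m = 0 then 1 else 0 := by
  classical
  have h1 : ∀ β, a β * (∑ j, κ j * ζ β j) ^ m =
      ∑ f : Fin m → Fin d, (∏ i, κ (f i)) *
        (a β * ∏ j, ζ β j ^ (Finset.univ.filter fun i => f i = j).card) := fun β => by
    rw [Fintype.sum_pow, Finset.mul_sum]
    refine Finset.sum_congr rfl fun f _ => ?_
    rw [Finset.prod_mul_distrib, ← Finset.prod_fiberwise Finset.univ f (fun i => ζ β (f i))]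
    have : ∀ j, ∏ i with f i = j, ζ β (f i) = ζ β j ^ (Finset.univ.filter fun i => f i = j).card :=
      fun j => by
        rw [← Finset.prod_const]
        exact Finset.prod_congr rfl fun i hi => by rw [(Finset.mem_filter.1 hi).2]
    simp_rw [this]
    ring
  simp_rw [h1]
  rw [Finset.sum_comm]
  simp_rw [← Finset.mul_sum]
  rw [Finset.sum_congr rfl fun f _ => by rw [h _ fun j =>
    (Finset.card_le_univ _).trans_lt (by simpa using hm)]]
  by_cases hm0 : m = 0
  · subst hm0
    simp [funext_iff]
  · rw [if_neg hm0]
    refine Finset.sum_eq_zero fun f _ => ?_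
    rw [if_neg, mul_zero]
    intro h0
    have := congr_fun h0 (f ⟨0, Nat.pos_of_ne_zero hm0⟩)
    rw [Pi.zero_apply, Finset.card_eq_zero] at this
    exact Finset.filter_eq_empty_iff.1 this (Finset.mem_univ _) rfl

/-- Local polynomial reproduction: the value at the origin of a polynomial of degree less than `t`
is a combination, with bounded coefficients, of its values at slightly perturbed grid points. -/
theorem exists_local_reproduction (d : ℕ) {t : ℕ} (ht : 0 < t) : ∃ η A : ℝ, 0 < η ∧ 0 < A ∧
    ∀ ζ : (Fin d → Fin t) → Fin d → ℝ, (∀ β j, |ζ β j - (β j : ℕ)| ≤ η) →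
      ∃ a : (Fin d → Fin t) → ℝ, ∑ β, |a β| ≤ A ∧ ∀ (κ : Fin d → ℝ) (m : ℕ), m < t →
        ∑ β, a β * (∑ j, κ j * ζ β j) ^ m = if m = 0 then 1 else 0 := by
  classical
  let ζ₀ : (Fin d → Fin t) → Fin d → ℝ := fun β j => ((β j : ℕ) : ℝ)
  let o : Fin d → Fin t := fun _ => ⟨0, ht⟩
  -- Cramer's rule for the system that reproduces the value at the origin. The formula is continuous
  -- in the nodes wherever the determinant is nonzero, so near the grid the coefficients stay
  -- bounded by their sum there plus one.
  let sol : ((Fin d → Fin t) → Fin d → ℝ) → (Fin d → Fin t) → ℝ := fun ζ =>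
    (monomialMatrix ζ).det⁻¹ • ((monomialMatrix ζ).adjugate.mulVec (Pi.single o 1))
  have hM : Continuous (monomialMatrix (d := d) (t := t)) := by
    refine continuous_matrix fun α β => ?_
    simp only [monomialMatrix, Matrix.of_apply]
    fun_prop
  have hdet : (monomialMatrix ζ₀).det ≠ 0 := det_monomialMatrix_grid_ne_zero d t
  have hsol : ContinuousAt (fun ζ => ∑ β, |sol ζ β|) ζ₀ := by
    have h1 : ContinuousAt sol ζ₀ :=
      (hM.matrix_det.continuousAt.inv₀ hdet).smul
        (hM.matrix_adjugate.matrix_mulVec continuous_const).continuousAt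
    refine tendsto_finsetSum _ fun β _ => ?_
    exact ((continuous_apply β).continuousAt.comp h1).abs
  have hev : ∀ᶠ ζ in 𝓝 ζ₀, (monomialMatrix ζ).det ≠ 0 ∧ ∑ β, |sol ζ β| < ∑ β, |sol ζ₀ β| + 1 :=
    (hM.matrix_det.continuousAt.eventually_ne hdet).and
      (hsol.eventually_lt continuousAt_const (lt_add_one _))
  obtain ⟨η, hη, hball⟩ := Metric.nhds_basis_closedBall.eventually_iff.1 hev
  refine ⟨η, ∑ β, |sol ζ₀ β| + 1, hη,
    add_pos_of_nonneg_of_pos (Finset.sum_nonneg fun _ _ => abs_nonneg _) one_pos, fun ζ hζ => ?_⟩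
  obtain ⟨hdetζ, hA⟩ := hball (x := ζ) (by
    rw [Metric.mem_closedBall, dist_pi_le_iff hη.le]
    intro β
    rw [dist_pi_le_iff hη.le]
    intro j
    rw [Real.dist_eq]
    exact hζ β j)
  refine ⟨sol ζ, hA.le, fun κ m hm => sum_mul_pow_eq_of_monomials (t := t) (fun α hα => ?_) κ hm⟩
  have h2 : (monomialMatrix ζ).mulVec (sol ζ) = Pi.single o 1 := by
    simp only [sol]
    rw [Matrix.mulVec_smul, Matrix.mulVec_mulVec, Matrix.mul_adjugate, Matrix.smul_mulVec,
      Matrix.one_mulVec, smul_smul, inv_mul_cancel₀ hdetζ, one_smul]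
  have h3 := congr_fun h2 fun j => ⟨α j, hα j⟩
  simp only [Matrix.mulVec, dotProduct, monomialMatrix, Matrix.of_apply, Pi.single_apply] at h3
  rw [← Finset.sum_congr rfl fun β _ => mul_comm _ _, h3]
  congr 1
  simp [o, funext_iff, Fin.ext_iff]

/-- For `|θ| ≤ 1` the Taylor remainder is at most `e |θ| ^ t`; for `|θ| > 1` the exponential and the
`t` Taylor terms are each at most `|θ| ^ t`. The constant `t + 3` covers both ranges. -/
theorem norm_exp_sub_taylor_le (t : ℕ) (θ : ℝ) :
    ‖Complex.exp (θ * Complex.I) - ∑ m ∈ Finset.range t, (θ * Complex.I) ^ m / (m.factorial : ℂ)‖ ≤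
      (t + 3) * |θ| ^ t := by
  have hn : ‖(θ : ℂ) * Complex.I‖ = |θ| := by simp
  rcases le_or_gt |θ| 1 with h | h
  · have h1 := Complex.norm_exp_sub_sum_le_norm_mul_exp ((θ : ℂ) * Complex.I) t
    rw [hn] at h1
    refine h1.trans ?_
    rw [mul_comm]
    have h2 : Real.exp |θ| ≤ 3 := (Real.exp_le_exp.2 h).trans Real.exp_one_lt_three.le
    gcongr
    have : (0 : ℝ) ≤ t := Nat.cast_nonneg t
    linarith
  · have h0 : 1 ≤ |θ| ^ t := one_le_pow₀ h.le
    refine (norm_sub_le _ _).trans ?_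
    rw [Complex.norm_exp_ofReal_mul_I]
    have h1 : ‖∑ m ∈ Finset.range t, (θ * Complex.I) ^ m / (m.factorial : ℂ)‖ ≤ t * |θ| ^ t := by
      refine (norm_sum_le _ _).trans ?_
      calc ∑ m ∈ Finset.range t, ‖(θ * Complex.I) ^ m / (m.factorial : ℂ)‖
          ≤ ∑ _m ∈ Finset.range t, |θ| ^ t := by
            refine Finset.sum_le_sum fun m hm => ?_
            rw [norm_div, norm_pow, hn, Complex.norm_natCast]
            refine (div_le_self (by positivity) ?_).trans
              (pow_le_pow_right₀ h.le (Finset.mem_range.1 hm).le)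
            exact_mod_cast Nat.one_le_iff_ne_zero.2 (Nat.factorial_ne_zero m)
        _ = t * |θ| ^ t := by simp
    nlinarith

/-- The moment conditions send the Taylor polynomials of the exponentials to exactly `1`, so only
remainders survive. -/
theorem norm_sum_mul_exp_sub_one_le {ι : Type*} [Fintype ι] {t : ℕ} (ht : 0 < t) {a θ : ι → ℝ}
    {A B : ℝ} (hA : ∑ β, |a β| ≤ A) (hB : 0 ≤ B) (hθ : ∀ β, |θ β| ≤ B)
    (h : ∀ m < t, ∑ β, a β * θ β ^ m = if m = 0 then 1 else 0) :
    ‖∑ β, (a β : ℂ) * Complex.exp (θ β * Complex.I) - 1‖ ≤ A * ((t + 3) * B ^ t) := by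
  have h1 : ∑ β, (a β : ℂ) * ∑ m ∈ Finset.range t, (θ β * Complex.I) ^ m / (m.factorial : ℂ) =
      1 := by
    simp_rw [Finset.mul_sum]
    rw [Finset.sum_comm]
    have h2 : ∀ m ∈ Finset.range t, ∑ β, (a β : ℂ) * ((θ β * Complex.I) ^ m / (m.factorial : ℂ)) =
        if m = 0 then 1 else 0 := fun m hm => by
      have h3 : ∑ β, (a β : ℂ) * ((θ β * Complex.I) ^ m / (m.factorial : ℂ)) =
          ((∑ β, a β * θ β ^ m : ℝ) : ℂ) * (Complex.I ^ m / m.factorial) := by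
        push_cast
        rw [Finset.sum_mul]
        exact Finset.sum_congr rfl fun β _ => by ring
      rw [h3, h m (Finset.mem_range.1 hm)]
      by_cases hm0 : m = 0
      · subst hm0; simp
      · simp [hm0]
    rw [Finset.sum_congr rfl h2]
    simp [ht]
  rw [← h1, ← Finset.sum_sub_distrib]
  refine (norm_sum_le _ _).trans ?_
  calc ∑ β, ‖(a β : ℂ) * Complex.exp (θ β * Complex.I) -
        (a β : ℂ) * ∑ m ∈ Finset.range t, (θ β * Complex.I) ^ m / (m.factorial : ℂ)‖
      ≤ ∑ β, |a β| * ((t + 3) * B ^ t) := by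
        refine Finset.sum_le_sum fun β _ => ?_
        rw [← mul_sub, norm_mul, Complex.norm_real, Real.norm_eq_abs]
        refine mul_le_mul_of_nonneg_left ((norm_exp_sub_taylor_le t (θ β)).trans ?_) (abs_nonneg _)
        have := hθ β
        gcongr
    _ = (∑ β, |a β|) * ((t + 3) * B ^ t) := by rw [Finset.sum_mul]
    _ ≤ _ := by gcongr

theorem mFourier_coe {d : ℕ} (k : Fin d → ℤ) (ξ : Fin d → ℝ) :
    UnitAddTorus.mFourier k (fun j => (ξ j : UnitAddCircle)) =
      Complex.exp ((2 * Real.pi * ∑ j, k j * ξ j : ℝ) * Complex.I) := by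
  simp only [UnitAddTorus.mFourier, ContinuousMap.coe_mk, fourier_coe_apply, ← Complex.exp_sum]
  congr 1
  push_cast
  rw [Finset.mul_sum, Finset.sum_mul]
  exact Finset.sum_congr rfl fun j _ => by ring

theorem norm_sub_le_torusDist {d : ℕ} (x y : Torus d) (j : Fin d) :
    ‖x j - y j‖ ≤ torusDist x y := by
  refine Real.le_sqrt_of_sq_le ?_
  exact Finset.single_le_sum (f := fun j => ‖x j - y j‖ ^ 2) (fun _ _ => sq_nonneg _)
    (Finset.mem_univ j)

theorem torusDist_nonneg {d : ℕ} (x y : Torus d) : 0 ≤ torusDist x y := Real.sqrt_nonneg _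

theorem bddAbove_range_iInf_torusDist {d : ℕ} (X : Finset (Torus d)) (hX : X.Nonempty) :
    BddAbove (Set.range fun y : Torus d => ⨅ x : X, torusDist x.1 y) := by
  obtain ⟨x₀, hx₀⟩ := hX
  refine ⟨√(∑ _j : Fin d, (1 : ℝ)), ?_⟩
  rintro _ ⟨y, rfl⟩
  refine (ciInf_le ⟨0, ?_⟩ (⟨x₀, hx₀⟩ : X)).trans ?_
  · rintro _ ⟨x, rfl⟩
    exact torusDist_nonneg _ _
  · refine Real.sqrt_le_sqrt (Finset.sum_le_sum fun j _ => ?_)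
    have h1 : ‖x₀ j - y j‖ ≤ 1 / 2 := by
      have := AddCircle.norm_le_half_period (1 : ℝ) (x := x₀ j - y j) one_ne_zero
      simpa using this
    have h2 := norm_nonneg (x₀ j - y j)
    nlinarith

theorem iInf_torusDist_le_meshNorm {d : ℕ} {X : Finset (Torus d)} (hX : X.Nonempty) (y : Torus d) :
    ⨅ x : X, torusDist x.1 y ≤ meshNorm X :=
  le_ciSup (bddAbove_range_iInf_torusDist X hX) y

theorem exists_torusDist_le_meshNorm {d : ℕ} {X : Finset (Torus d)} (hX : X.Nonempty)
    (y : Torus d) : ∃ x ∈ X, torusDist x y ≤ meshNorm X := by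
  have : Nonempty X := hX.to_subtype
  obtain ⟨x, hx⟩ := exists_eq_ciInf_of_finite (f := fun x : X => torusDist x.1 y)
  exact ⟨x.1, x.2, hx.le.trans (iInf_torusDist_le_meshNorm hX y)⟩

theorem exists_coe_eq_abs_eq_norm (z : UnitAddCircle) : ∃ u : ℝ, (u : UnitAddCircle) = z ∧ |u| = ‖z‖ := by
  induction z using QuotientAddGroup.induction_on with | H u =>
  refine ⟨u - round u, ?_, ?_⟩
  · have : ((round u : ℝ) : UnitAddCircle) = 0 := by
      rw [AddCircle.coe_eq_zero_iff]
      exact ⟨round u, by simp⟩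
    rw [AddCircle.coe_sub, this, sub_zero]
  · exact (UnitAddCircle.norm_eq (x := u)).symm

theorem sum_abs_le_card_mul_sqrt_freqSq {d : ℕ} (k : Fin d → ℤ) :
    ∑ j, |(k j : ℝ)| ≤ d * √(freqSq k) := by
  calc ∑ j, |(k j : ℝ)| ≤ ∑ _j : Fin d, √(freqSq k) := by
        refine Finset.sum_le_sum fun j _ => Real.abs_le_sqrt ?_
        exact Finset.single_le_sum (f := fun j => (k j : ℝ) ^ 2) (fun _ _ => sq_nonneg _)
          (Finset.mem_univ j)
    _ = d * √(freqSq k) := by simp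

theorem exists_mem_near_lift {d : ℕ} {X : Finset (Torus d)} (hX : X.Nonempty) (ξ : Fin d → ℝ) :
    ∃ x ∈ X, ∃ τ : Fin d → ℝ, (∀ j, |τ j| ≤ meshNorm X) ∧
      x = fun j => ((ξ j + τ j : ℝ) : UnitAddCircle) := by
  let y : Torus d := fun j => (ξ j : UnitAddCircle)
  obtain ⟨x, hx, hd⟩ := exists_torusDist_le_meshNorm hX y
  have hex : ∀ j, ∃ u : ℝ, (u : UnitAddCircle) = x j - y j ∧ |u| ≤ meshNorm X := fun j => by
    obtain ⟨u, hu, hu'⟩ := exists_coe_eq_abs_eq_norm (x j - y j)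
    exact ⟨u, hu, hu'.le.trans ((norm_sub_le_torusDist x y j).trans hd)⟩
  choose τ hτ1 hτ2 using hex
  refine ⟨x, hx, τ, hτ2, funext fun j => ?_⟩
  rw [AddCircle.coe_add, hτ1]
  exact (add_sub_cancel (y j) (x j)).symm

theorem norm_sum_mul_mFourier_sub_le {d t : ℕ} (ht : 0 < t) {ι : Type*} [Fintype ι] {A L R : ℝ}
    (hL : 0 ≤ L) (hR : 0 ≤ R) {a : ι → ℝ} (haA : ∑ β, |a β| ≤ A) {ζ : ι → Fin d → ℝ}
    (hζ : ∀ β j, |ζ β j| ≤ R)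
    (ha : ∀ (κ : Fin d → ℝ) (m : ℕ), m < t →
      ∑ β, a β * (∑ j, κ j * ζ β j) ^ m = if m = 0 then 1 else 0)
    (ξ : Fin d → ℝ) (k : Fin d → ℤ) :
    ‖∑ β, (a β : ℂ) * UnitAddTorus.mFourier k (fun j => ((ξ j + L * ζ β j : ℝ) : UnitAddCircle)) -
        UnitAddTorus.mFourier k (fun j => (ξ j : UnitAddCircle))‖ ≤ A + 1 ∧
    ‖∑ β, (a β : ℂ) * UnitAddTorus.mFourier k (fun j => ((ξ j + L * ζ β j : ℝ) : UnitAddCircle)) -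
        UnitAddTorus.mFourier k (fun j => (ξ j : UnitAddCircle))‖ ≤
      A * ((t + 3) * (2 * Real.pi * L * R * d * √(freqSq k)) ^ t) := by
  have hpi := Real.pi_pos
  set θ : ι → ℝ := fun β => ∑ j, (2 * Real.pi * L * k j) * ζ β j with hθ
  have hexp : ∀ β, UnitAddTorus.mFourier k (fun j => ((ξ j + L * ζ β j : ℝ) : UnitAddCircle)) =
      UnitAddTorus.mFourier k (fun j => (ξ j : UnitAddCircle)) *
        Complex.exp (θ β * Complex.I) := fun β => by
    rw [mFourier_coe, mFourier_coe, ← Complex.exp_add, ← add_mul, ← Complex.ofReal_add]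
    congr 3
    simp only [hθ]
    rw [Finset.mul_sum, Finset.mul_sum, ← Finset.sum_add_distrib]
    exact Finset.sum_congr rfl fun j _ => by ring
  have hfac : ∑ β, (a β : ℂ) *
      UnitAddTorus.mFourier k (fun j => ((ξ j + L * ζ β j : ℝ) : UnitAddCircle)) -
      UnitAddTorus.mFourier k (fun j => (ξ j : UnitAddCircle)) =
      UnitAddTorus.mFourier k (fun j => (ξ j : UnitAddCircle)) *
        (∑ β, (a β : ℂ) * Complex.exp (θ β * Complex.I) - 1) := by
    rw [mul_sub, mul_one, Finset.mul_sum]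
    congr 1
    exact Finset.sum_congr rfl fun β _ => by rw [hexp]; ring
  rw [hfac, norm_mul, norm_mFourier_apply, one_mul]
  constructor
  · refine (norm_sub_le _ _).trans ?_
    rw [norm_one]
    gcongr
    refine (norm_sum_le _ _).trans (le_trans (le_of_eq ?_) haA)
    refine Finset.sum_congr rfl fun β _ => ?_
    rw [norm_mul, Complex.norm_exp_ofReal_mul_I, mul_one, Complex.norm_real, Real.norm_eq_abs]
  · refine norm_sum_mul_exp_sub_one_le ht haA (by positivity) (fun β => ?_) fun m hm => ha _ m hm
    calc |θ β| ≤ ∑ j, 2 * Real.pi * L * |(k j : ℝ)| * R := by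
          refine (Finset.abs_sum_le_sum_abs _ _).trans (Finset.sum_le_sum fun j _ => ?_)
          rw [abs_mul, abs_mul, abs_of_nonneg (by positivity : 0 ≤ 2 * Real.pi * L)]
          gcongr
          exact hζ β j
      _ = 2 * Real.pi * L * R * ∑ j, |(k j : ℝ)| := by
          rw [Finset.mul_sum]
          exact Finset.sum_congr rfl fun j _ => by ring
      _ ≤ 2 * Real.pi * L * R * (d * √(freqSq k)) := by
          gcongr
          exact sum_abs_le_card_mul_sqrt_freqSq k
      _ = _ := by ring

/-- Point evaluation is reproduced, up to a small error on low frequencies, by a bounded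
combination of values on `X`. -/
theorem exists_quadrature (d : ℕ) {t : ℕ} (ht : 0 < t) : ∃ B D : ℝ, 0 < B ∧ 1 ≤ D ∧
    ∀ X : Finset (Torus d), X.Nonempty → 0 < meshNorm X → ∀ x₀ : Torus d,
      ∃ (a : (Fin d → Fin t) → ℝ) (x : (Fin d → Fin t) → Torus d), (∀ β, x β ∈ X) ∧
      ∀ k : Fin d → ℤ,
        ‖∑ β, (a β : ℂ) * UnitAddTorus.mFourier k (x β) - UnitAddTorus.mFourier k x₀‖ ≤ B ∧
        ‖∑ β, (a β : ℂ) * UnitAddTorus.mFourier k (x β) - UnitAddTorus.mFourier k x₀‖ ≤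
          B * (D * meshNorm X * √(freqSq k)) ^ t := by
  obtain ⟨η, A, hη, hA, hrep⟩ := exists_local_reproduction d ht
  have hpi := Real.pi_pos
  -- The first constant dominates both `A + 1` and `A * (t + 3)`; the summand `1` in the second only
  -- secures `1 ≤ D`.
  refine ⟨(A + 1) * (t + 3), 2 * Real.pi * η⁻¹ * (t + η) * d + 1, by positivity,
    le_add_of_nonneg_left (by positivity), fun X hX hh x₀ => ?_⟩
  set h := meshNorm X with hh_def
  choose ξ hξ _ using fun j => exists_coe_eq_abs_eq_norm (x₀ j)
  obtain rfl : (fun j => (ξ j : UnitAddCircle)) = x₀ := funext hξ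
  -- The grid has spacing `h / η`: moving a node to a point of `X` displaces each coordinate by at
  -- most `h`, which is at most `η` in units of the spacing.
  choose x hxX τ hτ hx using fun β : Fin d → Fin t =>
    exists_mem_near_lift hX (fun j => ξ j + h / η * ((β j : ℕ) : ℝ))
  have hτ' : ∀ β j, |η / h * τ β j| ≤ η := fun β j => by
    rw [abs_mul, abs_of_pos (by positivity : 0 < η / h)]
    calc η / h * |τ β j| ≤ η / h * h := by gcongr; exact hτ β j
      _ = η := by field_simp
  set ζ : (Fin d → Fin t) → Fin d → ℝ := fun β j => ((β j : ℕ) : ℝ) + η / h * τ β j with hζ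
  have hx' : ∀ β, x β = fun j => ((ξ j + h / η * ζ β j : ℝ) : UnitAddCircle) := fun β => by
    rw [hx β]
    funext j
    congr 1
    simp only [hζ]
    field_simp
    ring
  have hζR : ∀ β j, |ζ β j| ≤ t + η := fun β j => by
    refine (abs_add_le _ _).trans (add_le_add ?_ (hτ' β j))
    rw [Nat.abs_cast]
    exact_mod_cast (β j).2.le
  obtain ⟨a, haA, ha⟩ := hrep ζ (fun β j => by
    simp only [hζ, add_sub_cancel_left]
    exact hτ' β j)
  refine ⟨a, x, hxX, fun k => ?_⟩
  simp only [hx']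
  obtain ⟨h1, h2⟩ := norm_sum_mul_mFourier_sub_le ht (L := h / η) (by positivity)
    (by positivity : 0 ≤ t + η) haA hζR ha ξ k
  refine ⟨h1.trans ?_, h2.trans ?_⟩
  · have : (0 : ℝ) ≤ t := Nat.cast_nonneg t
    nlinarith
  · rw [← mul_assoc]
    have h3 : 2 * Real.pi * (h / η) * (t + η) * d * √(freqSq k) =
        2 * Real.pi * η⁻¹ * (t + η) * d * h * √(freqSq k) := by rw [div_eq_mul_inv]; ring
    rw [h3]
    gcongr
    · linarith
    · linarith

/-- The error of the reproduction, weighted by the reciprocal Sobolev weight. -/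
theorem sq_mul_inv_sobolevWeight_le {d t : ℕ} {B D h E : ℝ} (hB : 0 < B) (hD : 1 ≤ D)
    (hh : 0 < h) (k : Fin d → ℤ) (hE0 : 0 ≤ E) (hE : E ≤ B)
    (hE' : E ≤ B * (D * h * √(freqSq k)) ^ t) :
    E ^ 2 * (sobolevWeight t k)⁻¹ ≤
      2 ^ t * B ^ 2 * D ^ (2 * t) * h ^ (2 * t) * ((1 + h ^ 2 * freqSq k) ^ t)⁻¹ := by
  have hN := freqSq_nonneg k
  have hw := sobolevWeight_pos t k
  have hwN : freqSq k ^ t ≤ sobolevWeight t k := by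
    rw [sobolevWeight_eq]
    gcongr
    have hpi : 1 ≤ 4 * Real.pi ^ 2 := by nlinarith [Real.pi_gt_three]
    nlinarith [mul_le_mul_of_nonneg_right hpi hN]
  have hpos : 0 < 1 + h ^ 2 * freqSq k := by positivity
  rw [← div_eq_mul_inv, ← div_eq_mul_inv, div_le_div_iff₀ hw (by positivity)]
  -- Below frequency `1 / h` the power bound on `E` is the useful one, above it the trivial bound
  -- `B`.
  rcases le_or_gt (h ^ 2 * freqSq k) 1 with hle | hlt
  · have h1 : E ^ 2 ≤ B ^ 2 * D ^ (2 * t) * h ^ (2 * t) * freqSq k ^ t := by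
      calc E ^ 2 ≤ (B * (D * h * √(freqSq k)) ^ t) ^ 2 := by gcongr
        _ = B ^ 2 * D ^ (2 * t) * h ^ (2 * t) * (√(freqSq k) ^ 2) ^ t := by
          rw [mul_pow, mul_pow, mul_pow]; ring
        _ = _ := by rw [Real.sq_sqrt hN]
    have h2 : (1 + h ^ 2 * freqSq k) ^ t ≤ 2 ^ t := by gcongr; linarith
    calc E ^ 2 * (1 + h ^ 2 * freqSq k) ^ t
        ≤ (B ^ 2 * D ^ (2 * t) * h ^ (2 * t) * sobolevWeight t k) * 2 ^ t := by
          gcongr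
          exact h1.trans (by gcongr)
      _ = _ := by ring
  · have h1 : (1 + h ^ 2 * freqSq k) ^ t ≤ 2 ^ t * h ^ (2 * t) * freqSq k ^ t := by
      calc (1 + h ^ 2 * freqSq k) ^ t ≤ (2 * (h ^ 2 * freqSq k)) ^ t := by gcongr; linarith
        _ = _ := by rw [mul_pow, mul_pow]; ring
    calc E ^ 2 * (1 + h ^ 2 * freqSq k) ^ t
        ≤ B ^ 2 * (2 ^ t * h ^ (2 * t) * sobolevWeight t k) := by
          gcongr
          exact h1.trans (by gcongr)
      _ = 2 ^ t * B ^ 2 * 1 * h ^ (2 * t) * sobolevWeight t k := by ring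
      _ ≤ _ := by
          gcongr
          exact one_le_pow₀ hD

/-- A Sobolev function that vanishes on `X` is small. -/
theorem exists_norm_sobolevMap_le_of_vanishing {d t : ℕ} (hd : 0 < d) (ht : (d : ℝ) / 2 < t) :
    ∃ C : ℝ, 0 < C ∧ ∀ X : Finset (Torus d), X.Nonempty → 0 < meshNorm X → meshNorm X ≤ 1 →
      ∀ a : CoeffSpace d, (∀ x ∈ X, sobolevMap hd ht a x = 0) →
        ‖sobolevMap hd ht a‖ ≤ C * meshNorm X ^ ((t : ℝ) - d / 2) * ‖a‖ := by
  have ht0 : 0 < t := by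
    have : (0 : ℝ) < t := lt_of_le_of_lt (by positivity) ht
    exact_mod_cast this
  obtain ⟨B, D, hB, hD, hquad⟩ := exists_quadrature d ht0
  obtain ⟨C₁, hC₁, hsum⟩ := exists_tsum_inv_pow_le hd ht
  set C₂ : ℝ := 2 ^ t * B ^ 2 * D ^ (2 * t) with hC₂
  have hC₂pos : 0 < C₂ := by positivity
  refine ⟨√(C₂ * C₁), by positivity, fun X hX hh hh1 a ha => ?_⟩
  set h := meshNorm X
  rw [ContinuousMap.norm_le _ (by positivity)]
  intro x₀
  obtain ⟨c, x, hxX, hE⟩ := hquad X hX hh x₀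
  set E : (Fin d → ℤ) → ℂ := fun k =>
    ∑ β, (c β : ℂ) * UnitAddTorus.mFourier k (x β) - UnitAddTorus.mFourier k x₀ with hEdef
  -- The values at the nodes are zero, so the reproduction error applied to the Fourier series is
  -- exactly minus the value at `x₀`. Cauchy–Schwarz then separates `E` with its weight from `a`,
  -- and the weighted sum is of order `h ^ (2 * t - d)`.
  have h1 : HasSum (fun k => ((invSqrtWeight t k : ℂ) * a k) * E k) (-sobolevMap hd ht a x₀) := by
    have h2 : HasSum (fun k => ∑ β, (c β : ℂ) *
        (((invSqrtWeight t k : ℂ) * a k) * UnitAddTorus.mFourier k (x β)))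
        (∑ β, (c β : ℂ) * sobolevMap hd ht a (x β)) :=
      hasSum_sum fun β _ => (hasSum_sobolevMap_apply hd ht a (x β)).mul_left _
    have h3 := h2.sub (hasSum_sobolevMap_apply hd ht a x₀)
    rw [Finset.sum_eq_zero fun β _ => by rw [ha _ (hxX β), mul_zero], zero_sub] at h3
    refine h3.congr_fun fun k => ?_
    simp only [hEdef]
    rw [mul_sub, Finset.mul_sum]
    congr 1
    exact Finset.sum_congr rfl fun β _ => by ring
  have hN := fun k : Fin d → ℤ => freqSq_nonneg k
  obtain ⟨hS, hSle⟩ := tsum_le_of_tsum_ofReal_le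
    (f := fun k : Fin d → ℤ => ((1 + h ^ 2 * freqSq k) ^ t)⁻¹)
    (fun k => by have := hN k; positivity) (by positivity) (hsum h hh hh1)
  have hle : ∀ k, (‖E k‖ * invSqrtWeight t k) ^ 2 ≤
      C₂ * h ^ (2 * t) * ((1 + h ^ 2 * freqSq k) ^ t)⁻¹ := fun k => by
    rw [mul_pow, invSqrtWeight_sq]
    exact sq_mul_inv_sobolevWeight_le hB hD hh k (norm_nonneg _) (hE k).1 (hE k).2
  have hS' := hS.mul_left (C₂ * h ^ (2 * t))
  have hS2 : Summable fun k => (‖E k‖ * invSqrtWeight t k) ^ 2 :=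
    hS'.of_nonneg_of_le (fun k => sq_nonneg _) hle
  obtain ⟨h4, h5⟩ := summable_mul_and_tsum_le_sqrt
    (fun k => mul_nonneg (norm_nonneg (E k)) (invSqrtWeight_pos t k).le)
    (fun k => norm_nonneg (a k)) hS2 a.hasSum_norm_sq.summable
  have h6 : ∀ k, ‖((invSqrtWeight t k : ℂ) * a k) * E k‖ = ‖E k‖ * invSqrtWeight t k * ‖a k‖ :=
    fun k => by
      rw [norm_mul, norm_mul, Complex.norm_real, Real.norm_of_nonneg (invSqrtWeight_pos t k).le]
      ring
  rw [← norm_neg, ← h1.tsum_eq]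
  refine (norm_tsum_le_tsum_norm (h4.congr fun k => (h6 k).symm)).trans ?_
  simp_rw [h6]
  refine h5.trans ?_
  rw [a.hasSum_norm_sq.tsum_eq, Real.sqrt_sq (norm_nonneg a)]
  gcongr
  have h7 : ∑' k, (‖E k‖ * invSqrtWeight t k) ^ 2 ≤ C₂ * h ^ (2 * t) * (C₁ * (h ^ d)⁻¹) := by
    refine (hS2.tsum_le_tsum hle hS').trans ?_
    rw [tsum_mul_left]
    gcongr
  refine (Real.sqrt_le_sqrt h7).trans (le_of_eq ?_)
  have h8 : C₂ * h ^ (2 * t) * (C₁ * (h ^ d)⁻¹) = C₂ * C₁ * (h ^ ((t : ℝ) - d / 2)) ^ 2 := by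
    rw [← Real.rpow_natCast _ 2, ← Real.rpow_mul hh.le, ← Real.rpow_natCast h (2 * t),
      ← Real.rpow_natCast h d, ← Real.rpow_neg hh.le]
    have : h ^ (((t : ℝ) - d / 2) * (2 : ℕ)) = h ^ ((2 * t : ℕ) : ℝ) * h ^ (-(d : ℝ)) := by
      rw [← Real.rpow_add hh]
      congr 1
      push_cast
      ring
    rw [this]
    ring
  rw [h8, Real.sqrt_mul (by positivity), Real.sqrt_sq (by positivity)]

end

/-! ### Derivatives, Fourier coefficients and the embedding of `C^r` into `W^r`. -/

section

/-- The partial derivative of a function on the torus. -/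
def partialDeriv {d : ℕ} (j : Fin d) (g : Torus d → ℂ) : Torus d → ℂ :=
  fun z => deriv (fun t : ℝ => g (z + Pi.single j (t : UnitAddCircle))) 0

theorem periodicLift_add_smul {d : ℕ} (j : Fin d) (g : Torus d → ℂ) (x : Fin d → ℝ) (t : ℝ) :
    periodicLift g (x + t • Pi.single j 1) =
      g ((fun i => (x i : UnitAddCircle)) + Pi.single j (t : UnitAddCircle)) := by
  rw [periodicLift]
  congr 1
  funext i
  by_cases h : i = j
  · subst h; simp
  · simp [h]

theorem exists_coe_eq {d : ℕ} (z : Torus d) : ∃ x : Fin d → ℝ, (fun j => (x j : UnitAddCircle)) = z := by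
  choose x hx _ using fun j => exists_coe_eq_abs_eq_norm (z j)
  exact ⟨x, funext hx⟩

theorem periodicLift_partialDeriv {d : ℕ} (j : Fin d) {g : Torus d → ℂ} {x : Fin d → ℝ}
    (hg : DifferentiableAt ℝ (periodicLift g) x) :
    periodicLift (partialDeriv j g) x = fderiv ℝ (periodicLift g) x (Pi.single j 1) := by
  rw [← hg.lineDeriv_eq_fderiv, lineDeriv]
  simp_rw [periodicLift_add_smul]
  rfl

theorem IsCr.of_le {d r m : ℕ} {f : Torus d → ℂ} (hf : IsCr r f) (h : m ≤ r) : IsCr m f :=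
  ContDiff.of_le hf (by exact_mod_cast h)

theorem IsCr.differentiable {d m : ℕ} {g : Torus d → ℂ} (hg : IsCr (m + 1) g) :
    Differentiable ℝ (periodicLift g) :=
  ContDiff.differentiable hg (by simp)

theorem IsCr.partialDeriv {d m : ℕ} (j : Fin d) {g : Torus d → ℂ} (hg : IsCr (m + 1) g) :
    IsCr m (partialDeriv j g) := by
  have h1 : periodicLift (TorusInterp.partialDeriv j g) =
      fun x => fderiv ℝ (periodicLift g) x (Pi.single j 1) :=
    funext fun x => periodicLift_partialDeriv j (hg.differentiable x)
  rw [IsCr, h1]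
  exact (ContDiff.fderiv_right hg (by norm_cast)).clm_apply contDiff_const

theorem IsCr.iterate_partialDeriv {d m n : ℕ} (j : Fin d) {g : Torus d → ℂ} (hg : IsCr (m + n) g) :
    IsCr m ((TorusInterp.partialDeriv j)^[n] g) := by
  induction n generalizing m with
  | zero => exact hg
  | succ n ih =>
    rw [Function.iterate_succ_apply']
    exact IsCr.partialDeriv j (ih (m := m + 1) (by rwa [add_assoc, add_comm 1 n]))

theorem periodicLift_iterate_partialDeriv {d n : ℕ} (j : Fin d) {g : Torus d → ℂ} (hg : IsCr n g)
    (x : Fin d → ℝ) : periodicLift ((partialDeriv j)^[n] g) x =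
      iteratedFDeriv ℝ n (periodicLift g) x fun _ => Pi.single j 1 := by
  induction n generalizing x with
  | zero => simp
  | succ n ih =>
    have hg' : IsCr n g := hg.of_le (Nat.le_succ n)
    have h1 : IsCr (0 + 1) ((partialDeriv j)^[n] g) :=
      IsCr.iterate_partialDeriv j (by rwa [zero_add, add_comm])
    rw [Function.iterate_succ_apply', periodicLift_partialDeriv j (h1.differentiable x),
      funext fun y => ih hg' y, iteratedFDeriv_succ_apply_left]
    have h2 : DifferentiableAt ℝ (iteratedFDeriv ℝ n (periodicLift g)) x :=
      (ContDiff.differentiable_iteratedFDeriv (by exact_mod_cast Nat.lt_succ_self n) hg) x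
    rw [fderiv_continuousMultilinear_apply_const_apply h2]
    rfl

theorem IsCr.continuous {d m : ℕ} {g : Torus d → ℂ} (hg : IsCr m g) : Continuous g := by
  have hq : IsOpenQuotientMap (Pi.map fun _ : Fin d => ((↑) : ℝ → UnitAddCircle)) :=
    IsOpenQuotientMap.piMap fun _ => QuotientAddGroup.isOpenQuotientMap_mk
  rw [hq.isQuotientMap.continuous_iff]
  exact ContDiff.continuous hg

theorem hasDerivAt_translate {d : ℕ} (j : Fin d) {g : Torus d → ℂ} (hg : IsCr (0 + 1) g)
    (z : Torus d) (t : ℝ) :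
    HasDerivAt (fun t : ℝ => g (z + Pi.single j (t : UnitAddCircle)))
      (partialDeriv j g (z + Pi.single j (t : UnitAddCircle))) t := by
  obtain ⟨x, rfl⟩ := exists_coe_eq z
  simp_rw [← periodicLift_add_smul]
  have h1 := (hg.differentiable (x + t • Pi.single j 1)).hasFDerivAt
  have h2 : HasDerivAt (fun t : ℝ => x + t • (Pi.single j 1 : Fin d → ℝ)) (Pi.single j 1) t := by
    simpa using ((hasDerivAt_id t).smul_const (Pi.single j 1 : Fin d → ℝ)).const_add x
  have h3 := h1.comp_hasDerivAt t h2
  rwa [← periodicLift_partialDeriv j (hg.differentiable _)] at h3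

theorem mFourier_single_apply {d : ℕ} (k : Fin d → ℤ) (j : Fin d) (t : ℝ) :
    UnitAddTorus.mFourier k (Pi.single j (t : UnitAddCircle)) =
      Complex.exp (t * (2 * Real.pi * Complex.I * k j)) := by
  have h : (Pi.single j (t : UnitAddCircle) : Torus d) =
      fun i => ((Pi.single j t : Fin d → ℝ) i : UnitAddCircle) := by
    funext i
    by_cases h : i = j
    · subst h; simp
    · simp [h]
  rw [h, mFourier_coe]
  simp only [Pi.single_apply, mul_ite, mul_zero, Finset.sum_ite_eq', Finset.mem_univ, if_true]
  congr 1
  push_cast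
  ring

theorem mFourierCoeff_translate {d : ℕ} (g : Torus d → ℂ) (k : Fin d → ℤ) (w : Torus d) :
    UnitAddTorus.mFourierCoeff (fun z => g (z + w)) k =
      UnitAddTorus.mFourier k w * UnitAddTorus.mFourierCoeff g k := by
  change ∫ z, UnitAddTorus.mFourier (-k) z • g (z + w) ∂torusMeasure d =
    _ * ∫ z, UnitAddTorus.mFourier (-k) z • g z ∂torusMeasure d
  rw [← integral_const_mul,
    ← integral_add_right_eq_self (μ := torusMeasure d) (fun z => UnitAddTorus.mFourier k w *
      UnitAddTorus.mFourier (-k) z • g z) w]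
  refine integral_congr_ae (.of_forall fun z => ?_)
  dsimp only
  have h1 := mFourier_sub_apply (-k) (z + w) w
  rw [add_sub_cancel_right, ← UnitAddTorus.mFourier_neg, neg_neg] at h1
  rw [h1, smul_eq_mul, smul_eq_mul]
  ring

theorem hasDerivAt_mFourierCoeff_translate {d : ℕ} (j : Fin d) {g : Torus d → ℂ}
    (hg : IsCr (0 + 1) g) (k : Fin d → ℤ) :
    HasDerivAt (fun t : ℝ => ∫ z, UnitAddTorus.mFourier (-k) z *
      g (z + Pi.single j (t : UnitAddCircle)) ∂torusMeasure d)
      (∫ z, UnitAddTorus.mFourier (-k) z *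
        partialDeriv j g (z + Pi.single j ((0 : ℝ) : UnitAddCircle)) ∂torusMeasure d) 0 := by
  have hgc : Continuous g := hg.continuous
  have hDc : Continuous (partialDeriv j g) := (IsCr.partialDeriv j hg).continuous
  obtain ⟨M, hM⟩ : ∃ M : ℝ, ∀ z, ‖partialDeriv j g z‖ ≤ M :=
    ⟨‖(⟨_, hDc⟩ : C(Torus d, ℂ))‖, fun z => ContinuousMap.norm_coe_le_norm ⟨_, hDc⟩ z⟩
  have hF : ∀ {u : Torus d → ℂ}, Continuous u → ∀ w : Torus d, Continuous fun z : Torus d =>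
      UnitAddTorus.mFourier (-k) z * u (z + w) := fun hu w =>
    (UnitAddTorus.mFourier (-k)).continuous.mul (hu.comp (continuous_id.add continuous_const))
  have hinteg : Integrable (fun z : Torus d => UnitAddTorus.mFourier (-k) z *
      g (z + Pi.single j ((0 : ℝ) : UnitAddCircle))) (torusMeasure d) :=
    (hF hgc _).integrable_of_hasCompactSupport (HasCompactSupport.of_compactSpace _)
  have hder : ∀ (z : Torus d) (t : ℝ), HasDerivAt (fun t : ℝ => UnitAddTorus.mFourier (-k) z *
      g (z + Pi.single j (t : UnitAddCircle)))
      (UnitAddTorus.mFourier (-k) z * partialDeriv j g (z + Pi.single j (t : UnitAddCircle))) t :=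
    fun z t => (hasDerivAt_translate j hg z t).const_mul _
  have hbd : ∀ (z : Torus d) (t : ℝ), ‖UnitAddTorus.mFourier (-k) z *
      partialDeriv j g (z + Pi.single j (t : UnitAddCircle))‖ ≤ M := fun z t => by
    rw [norm_mul, norm_mFourier_apply, one_mul]
    exact hM _
  let F : ℝ → Torus d → ℂ := fun t z =>
    UnitAddTorus.mFourier (-k) z * g (z + Pi.single j (t : UnitAddCircle))
  let F' : ℝ → Torus d → ℂ := fun t z =>
    UnitAddTorus.mFourier (-k) z * partialDeriv j g (z + Pi.single j (t : UnitAddCircle))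
  have hF1 : ∀ᶠ t in 𝓝 (0 : ℝ), AEStronglyMeasurable (F t) (torusMeasure d) :=
    .of_forall fun t => (hF hgc (Pi.single j (t : UnitAddCircle))).aestronglyMeasurable
  have hF2 : AEStronglyMeasurable (F' 0) (torusMeasure d) :=
    (hF hDc (Pi.single j ((0 : ℝ) : UnitAddCircle))).aestronglyMeasurable
  have hF3 : ∀ᵐ z ∂torusMeasure d, ∀ t ∈ (Set.univ : Set ℝ), ‖F' t z‖ ≤ M :=
    .of_forall fun z t _ => hbd z t
  have hF4 : ∀ᵐ z ∂torusMeasure d, ∀ t ∈ (Set.univ : Set ℝ), HasDerivAt (F · z) (F' t z) t :=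
    .of_forall fun z t _ => hder z t
  have hc : Integrable (fun _ : Torus d => M) (torusMeasure d) := integrable_const M
  exact (hasDerivAt_integral_of_dominated_loc_of_deriv_le (F := F) (F' := F') univ_mem hF1 hinteg hF2
    hF3 hc hF4).2

/-- In place of integration by parts, the coefficient of the translate of `g` along the axis `j` is
differentiated at zero in two ways: under the integral sign, and from its closed form as an
exponential times the coefficient of `g`. -/
theorem mFourierCoeff_partialDeriv {d : ℕ} (j : Fin d) {g : Torus d → ℂ} (hg : IsCr (0 + 1) g)
    (k : Fin d → ℤ) : UnitAddTorus.mFourierCoeff (partialDeriv j g) k =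
      2 * Real.pi * Complex.I * k j * UnitAddTorus.mFourierCoeff g k := by
  have h1 := hasDerivAt_mFourierCoeff_translate j hg k
  have h2 : ∀ t : ℝ, ∫ z, UnitAddTorus.mFourier (-k) z *
      g (z + Pi.single j (t : UnitAddCircle)) ∂torusMeasure d =
      Complex.exp (t * (2 * Real.pi * Complex.I * k j)) *
        UnitAddTorus.mFourierCoeff g k := fun t => by
    rw [← mFourier_single_apply, ← mFourierCoeff_translate]
    rfl
  simp_rw [h2] at h1
  have h3 : HasDerivAt (fun t : ℝ => Complex.exp (t * (2 * Real.pi * Complex.I * k j)) *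
      UnitAddTorus.mFourierCoeff g k)
      (2 * Real.pi * Complex.I * k j * UnitAddTorus.mFourierCoeff g k) 0 := by
    have h4 : HasDerivAt (fun t : ℝ => Complex.exp (t * (2 * Real.pi * Complex.I * k j)))
        (Complex.exp (((0 : ℝ) : ℂ) * (2 * Real.pi * Complex.I * k j)) *
          (1 * (2 * Real.pi * Complex.I * k j))) 0 :=
      ((Complex.ofRealCLM.hasDerivAt (x := (0 : ℝ))).mul_const _).cexp
    simpa using h4.mul_const (UnitAddTorus.mFourierCoeff g k)
  rw [← h1.unique h3, AddCircle.coe_zero, Pi.single_zero]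
  simp only [add_zero]
  rfl

theorem mFourierCoeff_iterate_partialDeriv {d n : ℕ} (j : Fin d) {g : Torus d → ℂ}
    (hg : IsCr n g) (k : Fin d → ℤ) : UnitAddTorus.mFourierCoeff ((partialDeriv j)^[n] g) k =
      (2 * Real.pi * Complex.I * k j) ^ n * UnitAddTorus.mFourierCoeff g k := by
  induction n with
  | zero => simp
  | succ n ih =>
    rw [Function.iterate_succ_apply', mFourierCoeff_partialDeriv j
      (IsCr.iterate_partialDeriv j (by rwa [zero_add, add_comm])), ih (hg.of_le (Nat.le_succ n))]
    ring

theorem tsum_norm_sq_mFourierCoeff_le {d : ℕ} {g : Torus d → ℂ} (hg : Continuous g) {M : ℝ}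
    (hM : ∀ z, ‖g z‖ ≤ M) :
    ∑' k, ENNReal.ofReal (‖UnitAddTorus.mFourierCoeff g k‖ ^ 2) ≤ ENNReal.ofReal (M ^ 2) := by
  have hM0 : 0 ≤ M := (norm_nonneg _).trans (hM 0)
  let G : C(Torus d, ℂ) := ⟨g, hg⟩
  have hG : ‖ContinuousMap.toLp 2 (torusMeasure d) ℂ G‖ ≤ M := by
    rw [Lp.norm_def, eLpNorm_congr_ae (ContinuousMap.coeFn_toLp (torusMeasure d) G)]
    refine ENNReal.toReal_le_of_le_ofReal hM0 ((eLpNorm_continuousMap_le 2 G).trans ?_)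
    exact ENNReal.ofReal_le_ofReal ((ContinuousMap.norm_le G hM0).2 hM)
  have hcoe : ∀ k, UnitAddTorus.mFourierCoeff g k = inner ℂ
      (UnitAddTorus.mFourierLp 2 k) (ContinuousMap.toLp 2 (torusMeasure d) ℂ G) :=
    fun k => (coeffCLM_apply k G).symm
  simp_rw [hcoe]
  have hon := UnitAddTorus.orthonormal_mFourier (d := Fin d)
  rw [← ENNReal.ofReal_tsum_of_nonneg (fun _ => sq_nonneg _) (hon.inner_products_summable _)]
  refine ENNReal.ofReal_le_ofReal ((hon.tsum_inner_products_le _).trans ?_)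
  gcongr

/-- The power mean inequality for the `d + 1` numbers `1` and `(2πk_j)²`, indexed by `Option (Fin
d)`. It reduces the Sobolev norm to `f` and its pure derivatives of order `s`. -/
theorem sobolevWeight_le {d : ℕ} {s : ℕ} (hs : 0 < s) (k : Fin d → ℤ) :
    sobolevWeight s k ≤ (d + 1) ^ (s - 1) * (1 + ∑ j, ((2 * Real.pi * k j) ^ s) ^ 2) := by
  obtain ⟨n, rfl⟩ : ∃ n, s = n + 1 := ⟨s - 1, by omega⟩
  have h1 := pow_sum_div_card_le_sum_pow (s := (Finset.univ : Finset (Option (Fin d))))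
    (f := fun i => i.elim (1 : ℝ) fun j => (2 * Real.pi * k j) ^ 2) (fun i _ => by cases i <;> simp [sq_nonneg]) n
  rw [div_le_iff₀ (by simp; positivity), Fintype.sum_option, Fintype.sum_option] at h1
  simp only [Option.elim, one_pow, Finset.card_univ, Fintype.card_option, Fintype.card_fin] at h1
  have h2 : sobolevWeight (n + 1) k = (1 + ∑ j, (2 * Real.pi * (k j : ℝ)) ^ 2) ^ (n + 1) := by
    rw [sobolevWeight, Finset.mul_sum]
    congr 2
    exact Finset.sum_congr rfl fun j _ => by ring
  rw [h2, Nat.add_sub_cancel, mul_comm (_ ^ n)]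
  push_cast at h1
  refine h1.trans (le_of_eq ?_)
  congr 2
  exact Finset.sum_congr rfl fun j _ => pow_right_comm _ _ _

theorem sobolevNorm_le_of_bound {d s : ℕ} (hs : 0 < s) {f : Torus d → ℂ} (hf : IsCr s f) {M : ℝ}
    (hM : ∀ z, ‖f z‖ ≤ M) (hMj : ∀ j z, ‖(partialDeriv j)^[s] f z‖ ≤ M) :
    sobolevNorm s f ≤ ENNReal.ofReal ((d + 1) ^ s * M) := by
  have hM0 : 0 ≤ M := (norm_nonneg _).trans (hM 0)
  have h1 : ∑' k, ENNReal.ofReal (sobolevWeight s k * ‖UnitAddTorus.mFourierCoeff f k‖ ^ 2) ≤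
      ENNReal.ofReal (((d + 1) ^ s * M) ^ 2) := by
    calc ∑' k, ENNReal.ofReal (sobolevWeight s k * ‖UnitAddTorus.mFourierCoeff f k‖ ^ 2)
        ≤ ∑' k, ENNReal.ofReal ((d + 1) ^ (s - 1)) *
          (ENNReal.ofReal (‖UnitAddTorus.mFourierCoeff f k‖ ^ 2) +
            ∑ j, ENNReal.ofReal (‖UnitAddTorus.mFourierCoeff ((partialDeriv j)^[s] f) k‖ ^ 2)) := by
          refine ENNReal.tsum_le_tsum fun k => ?_
          rw [← ENNReal.ofReal_sum_of_nonneg (fun _ _ => sq_nonneg _),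
            ← ENNReal.ofReal_add (sq_nonneg _) (Finset.sum_nonneg fun _ _ => sq_nonneg _),
            ← ENNReal.ofReal_mul (by positivity)]
          refine ENNReal.ofReal_le_ofReal ?_
          refine (mul_le_mul_of_nonneg_right (sobolevWeight_le hs k) (sq_nonneg _)).trans
            (le_of_eq ?_)
          rw [mul_assoc, add_mul, one_mul, Finset.sum_mul]
          congr 2
          refine Finset.sum_congr rfl fun j _ => ?_
          rw [mFourierCoeff_iterate_partialDeriv j hf, norm_mul, norm_pow]
          have h3 : ‖(2 * Real.pi * Complex.I * k j : ℂ)‖ = |2 * Real.pi * k j| := by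
            simp [abs_mul]
          rw [h3, ← abs_pow, mul_pow |_|, sq_abs]
      _ ≤ ENNReal.ofReal ((d + 1) ^ (s - 1)) *
          (ENNReal.ofReal (M ^ 2) + ∑ _j : Fin d, ENNReal.ofReal (M ^ 2)) := by
          rw [ENNReal.tsum_mul_left, ENNReal.tsum_add, Summable.tsum_finsetSum
            fun _ _ => ENNReal.summable]
          gcongr with j _
          · exact tsum_norm_sq_mFourierCoeff_le hf.continuous hM
          · exact tsum_norm_sq_mFourierCoeff_le
              (IsCr.iterate_partialDeriv (m := 0) j (by rwa [zero_add])).continuous (hMj j)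
      _ = ENNReal.ofReal ((d + 1) ^ s * M ^ 2) := by
          rw [← ENNReal.ofReal_sum_of_nonneg (fun _ _ => sq_nonneg _),
            ← ENNReal.ofReal_add (sq_nonneg _) (Finset.sum_nonneg fun _ _ => sq_nonneg _),
            ← ENNReal.ofReal_mul (by positivity)]
          congr 1
          obtain ⟨n, rfl⟩ : ∃ n, s = n + 1 := ⟨s - 1, by omega⟩
          simp only [Finset.sum_const, Finset.card_univ, Fintype.card_fin, nsmul_eq_mul,
            Nat.add_sub_cancel]
          ring
      _ ≤ _ := by
          refine ENNReal.ofReal_le_ofReal ?_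
          rw [mul_pow]
          gcongr
          rw [← pow_mul]
          exact pow_le_pow_right₀ (by linarith [(Nat.cast_nonneg d : (0 : ℝ) ≤ d)]) (by omega)
  rw [sobolevNorm]
  refine (ENNReal.rpow_le_rpow h1 (by norm_num)).trans (le_of_eq ?_)
  rw [ENNReal.ofReal_rpow_of_nonneg (by positivity) (by norm_num), ← Real.sqrt_eq_rpow,
    Real.sqrt_sq (by positivity)]

theorem IsCr.sobolevNorm_lt_top {d s : ℕ} (hs : 0 < s) {f : Torus d → ℂ} (hf : IsCr s f) :
    sobolevNorm s f < ∞ := by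
  let G : C(Torus d, ℂ) := ⟨f, hf.continuous⟩
  let H : Fin d → C(Torus d, ℂ) := fun j => ⟨(TorusInterp.partialDeriv j)^[s] f,
    (IsCr.iterate_partialDeriv (m := 0) j (by rwa [zero_add])).continuous⟩
  refine (sobolevNorm_le_of_bound hs hf (M := ‖G‖ + ∑ j, ‖H j‖) (fun z => ?_)
    fun j z => ?_).trans_lt ENNReal.ofReal_lt_top
  · exact (G.norm_coe_le_norm z).trans
      (le_add_of_nonneg_right (Finset.sum_nonneg fun _ _ => norm_nonneg _))
  · refine ((H j).norm_coe_le_norm z).trans ?_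
    have := Finset.single_le_sum (f := fun j => ‖H j‖) (fun _ _ => norm_nonneg _)
      (Finset.mem_univ j)
    have h2 := norm_nonneg G
    linarith

theorem norm_iteratedFDeriv_le_crNorm {d r m : ℕ} (f : Torus d → ℂ) (hm : m ≤ r)
    (i : Fin m → Fin d) (x : Fin d → ℝ) :
    ‖iteratedFDeriv ℝ m (periodicLift f) x fun l => Pi.single (i l) 1‖ₑ ≤ crNorm r f :=
  le_iSup_of_le m (le_iSup_of_le hm (le_iSup_of_le i (le_iSup_of_le x le_rfl)))

theorem sobolevNorm_le_crNorm {d r : ℕ} (hr : 0 < r) {f : Torus d → ℂ} (hf : IsCr r f) :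
    sobolevNorm r f ≤ ENNReal.ofReal ((d + 1) ^ r) * crNorm r f := by
  by_cases htop : crNorm r f = ∞
  · rw [htop, ENNReal.mul_top]
    · exact le_top
    · rw [Ne, ENNReal.ofReal_eq_zero, not_le]
      positivity
  · have hb : ∀ w : ℂ, ‖w‖ₑ ≤ crNorm r f → ‖w‖ ≤ (crNorm r f).toReal := fun w hw => by
      rw [← toReal_enorm]
      exact ENNReal.toReal_mono htop hw
    rw [← ENNReal.ofReal_toReal htop, ← ENNReal.ofReal_mul (by positivity)]
    refine sobolevNorm_le_of_bound hr hf (fun z => hb _ ?_) fun j z => hb _ ?_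
    · obtain ⟨x, rfl⟩ := exists_coe_eq z
      have := norm_iteratedFDeriv_le_crNorm f (Nat.zero_le r) Fin.elim0 x
      rwa [iteratedFDeriv_zero_apply] at this
    · obtain ⟨x, rfl⟩ := exists_coe_eq z
      have := norm_iteratedFDeriv_le_crNorm f (le_refl r) (fun _ => j) x
      rwa [← periodicLift_iterate_partialDeriv j hf] at this

end

/-! ### Smooth interpolation of the values of a rougher function. -/

section

open scoped ComplexConjugate

theorem one_add_sum_le_prod_one_add {ι : Type*} (s : Finset ι) {f : ι → ℝ} (hf : ∀ i, 0 ≤ f i) :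
    1 + ∑ i ∈ s, f i ≤ ∏ i ∈ s, (1 + f i) := by
  classical
  induction s using Finset.induction_on with
  | empty => simp
  | insert i s hi ih =>
    rw [Finset.sum_insert hi, Finset.prod_insert hi]
    have h1 := Finset.sum_nonneg fun j (_ : j ∈ s) => hf j
    nlinarith [hf i, mul_nonneg (hf i) h1, mul_le_mul_of_nonneg_left ih (hf i)]

theorem one_add_freqSq_le_prod {d : ℕ} (ε : ℝ) (k : Fin d → ℤ) :
    1 + ε ^ 2 * freqSq k ≤ ∏ j, (1 + |ε * k j|) ^ 2 := by
  have h1 : 1 + ∑ j, (ε * k j) ^ 2 ≤ ∏ j, (1 + (ε * k j) ^ 2) :=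
    one_add_sum_le_prod_one_add _ fun j => sq_nonneg _
  have h2 : ε ^ 2 * freqSq k = ∑ j, (ε * k j) ^ 2 := by
    rw [freqSq, Finset.mul_sum]
    exact Finset.sum_congr rfl fun j _ => by ring
  rw [h2]
  refine h1.trans (Finset.prod_le_prod (fun j _ => by positivity) fun j _ => ?_)
  nlinarith [abs_nonneg (ε * k j), sq_abs (ε * k j)]

/-- Decay in each variable gives decay in `|k|`, because `1 + ε² |k|²` is at most the product of the
`(1 + |ε k_j|)²`. -/
theorem sq_prod_kernel_le {d : ℕ} {β : ℝ → ℝ} (hβ : ∀ ξ, 0 ≤ β ξ) {m : ℕ} {C : ℝ}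
    (hC : ∀ ξ, β ξ * (1 + |ξ|) ^ (2 * m) ≤ C) (ε : ℝ) (k : Fin d → ℤ) :
    (∏ j, β (ε * k j)) ^ 2 * (1 + ε ^ 2 * freqSq k) ^ m ≤ C ^ (2 * d) := by
  have hN := freqSq_nonneg k
  have hone : 1 ≤ 1 + ε ^ 2 * freqSq k := le_add_of_nonneg_right (by positivity)
  have hP : 0 ≤ ∏ j, β (ε * k j) := Finset.prod_nonneg fun _ _ => hβ _
  have h1 : (∏ j, β (ε * k j)) * (1 + ε ^ 2 * freqSq k) ^ m ≤ C ^ d := by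
    calc (∏ j, β (ε * k j)) * (1 + ε ^ 2 * freqSq k) ^ m
        ≤ (∏ j, β (ε * k j)) * (∏ j, (1 + |ε * k j|) ^ 2) ^ m := by
          gcongr
          exact one_add_freqSq_le_prod ε k
      _ = ∏ j, β (ε * k j) * (1 + |ε * k j|) ^ (2 * m) := by
          rw [← Finset.prod_pow, ← Finset.prod_mul_distrib]
          exact Finset.prod_congr rfl fun j _ => by rw [pow_mul]
      _ ≤ ∏ _j : Fin d, C := Finset.prod_le_prod (fun j _ => mul_nonneg (hβ _) (by positivity))
          fun j _ => hC _
      _ = C ^ d := by simp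
  calc (∏ j, β (ε * k j)) ^ 2 * (1 + ε ^ 2 * freqSq k) ^ m
      ≤ (∏ j, β (ε * k j)) ^ 2 * (1 + ε ^ 2 * freqSq k) ^ (2 * m) := by
        exact mul_le_mul_of_nonneg_left (pow_le_pow_right₀ hone (by omega)) (sq_nonneg _)
    _ = ((∏ j, β (ε * k j)) * (1 + ε ^ 2 * freqSq k) ^ m) ^ 2 := by ring
    _ ≤ (C ^ d) ^ 2 := by gcongr
    _ = C ^ (2 * d) := by ring

theorem weightBase_le {d : ℕ} {q : ℝ} (hq : 0 < q) (hq1 : q ≤ 1) (k : Fin d → ℤ) :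
    1 + 4 * Real.pi ^ 2 * freqSq k ≤ 64 * (q ^ 2)⁻¹ * (1 + q ^ 2 * freqSq k) := by
  have hN := freqSq_nonneg k
  have hpi : 4 * Real.pi ^ 2 ≤ 64 := by nlinarith [Real.pi_lt_four, Real.pi_pos]
  have h1 : 1 ≤ (q ^ 2)⁻¹ := one_le_inv_iff₀.2 ⟨by positivity, pow_le_one₀ hq.le hq1⟩
  have h2 : 64 * (q ^ 2)⁻¹ * (1 + q ^ 2 * freqSq k) = 64 * (q ^ 2)⁻¹ + 64 * freqSq k := by
    field_simp
  rw [h2]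
  nlinarith [mul_le_mul_of_nonneg_right hpi hN]

/-- Decay of order `2 * (σ + r)` is spent twice: `σ` powers absorb the Sobolev weight at the price
`q ^ (-2σ)`, and `r` powers are left over as the weight of the Bessel inequality. -/
theorem exists_sobolevWeight_mul_kernel_le {d : ℕ} (hd : 0 < d) {β : ℝ → ℝ} (hβ : ∀ ξ, 0 ≤ β ξ)
    (hdecay : ∀ n : ℕ, ∃ C : ℝ, 0 < C ∧ ∀ ξ, β ξ * (1 + |ξ|) ^ n ≤ C) (σ r : ℕ) :
    ∃ C : ℝ, 0 < C ∧ ∀ q : ℝ, 0 < q → q ≤ 1 → ∀ k : Fin d → ℤ,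
      sobolevWeight σ k * (∏ j, β (q / (2 * d) * k j)) ^ 2 ≤
        C * (q ^ (2 * σ))⁻¹ * ((1 + q ^ 2 * freqSq k) ^ r)⁻¹ := by
  obtain ⟨C, hC, h⟩ := hdecay (2 * (σ + r))
  have hd' : (1 : ℝ) ≤ d := by exact_mod_cast hd
  refine ⟨64 ^ σ * ((4 * d ^ 2) ^ (σ + r) * C ^ (2 * d)), by positivity, fun q hq hq1 k => ?_⟩
  have hN := freqSq_nonneg k
  set ε := q / (2 * d) with hε
  set B := ∏ j, β (ε * k j)
  have h1 := sq_prod_kernel_le hβ h ε k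
  have h2 : 1 + q ^ 2 * freqSq k ≤ 4 * d ^ 2 * (1 + ε ^ 2 * freqSq k) := by
    have : 4 * (d : ℝ) ^ 2 * (1 + ε ^ 2 * freqSq k) = 4 * d ^ 2 + q ^ 2 * freqSq k := by
      rw [hε]; field_simp; ring
    rw [this]
    nlinarith
  have h3 : B ^ 2 * (1 + q ^ 2 * freqSq k) ^ (σ + r) ≤ (4 * d ^ 2) ^ (σ + r) * C ^ (2 * d) := by
    calc B ^ 2 * (1 + q ^ 2 * freqSq k) ^ (σ + r)
        ≤ B ^ 2 * (4 * d ^ 2 * (1 + ε ^ 2 * freqSq k)) ^ (σ + r) := by gcongr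
      _ = (4 * d ^ 2) ^ (σ + r) * (B ^ 2 * (1 + ε ^ 2 * freqSq k) ^ (σ + r)) := by
          rw [mul_pow (4 * (d : ℝ) ^ 2)]; ring
      _ ≤ _ := by gcongr
  rw [← div_eq_mul_inv _ ((1 + q ^ 2 * freqSq k) ^ r), le_div_iff₀ (by positivity),
    sobolevWeight_eq]
  calc (1 + 4 * Real.pi ^ 2 * freqSq k) ^ σ * B ^ 2 * (1 + q ^ 2 * freqSq k) ^ r
      ≤ (64 * (q ^ 2)⁻¹ * (1 + q ^ 2 * freqSq k)) ^ σ * B ^ 2 * (1 + q ^ 2 * freqSq k) ^ r := by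
        gcongr
        exact weightBase_le hq hq1 k
    _ = 64 ^ σ * (q ^ (2 * σ))⁻¹ * (B ^ 2 * (1 + q ^ 2 * freqSq k) ^ (σ + r)) := by
        rw [mul_pow, mul_pow, inv_pow, ← pow_mul]; ring
    _ ≤ 64 ^ σ * (q ^ (2 * σ))⁻¹ * ((4 * d ^ 2) ^ (σ + r) * C ^ (2 * d)) := by gcongr
    _ = _ := by ring

/-- A Bernstein inequality: at frequencies up to `1 / q`, each extra power of the base `1 + 4π²
|k|²` costs at most `128 * q⁻²`. -/
theorem sobolevWeight_le_mul_of_low {d : ℕ} {σ r : ℕ} (hσ : r ≤ σ) {q : ℝ} (hq : 0 < q)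
    (hq1 : q ≤ 1) {k : Fin d → ℤ} (hk : q ^ 2 * freqSq k ≤ 1) :
    sobolevWeight σ k ≤ 128 ^ (σ - r) * (q ^ (2 * (σ - r)))⁻¹ * sobolevWeight r k := by
  have hN := freqSq_nonneg k
  have h1 : sobolevWeight σ k = (1 + 4 * Real.pi ^ 2 * freqSq k) ^ (σ - r) * sobolevWeight r k := by
    rw [sobolevWeight_eq, sobolevWeight_eq, ← pow_add, Nat.sub_add_cancel hσ]
  have h2 : 1 + 4 * Real.pi ^ 2 * freqSq k ≤ 128 * (q ^ 2)⁻¹ := by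
    refine (weightBase_le hq hq1 k).trans ?_
    have : 0 < (q ^ 2)⁻¹ := by positivity
    nlinarith
  have hw := sobolevWeight_pos r k
  rw [h1]
  gcongr
  calc (1 + 4 * Real.pi ^ 2 * freqSq k) ^ (σ - r) ≤ (128 * (q ^ 2)⁻¹) ^ (σ - r) := by gcongr
    _ = _ := by rw [mul_pow, inv_pow, ← pow_mul]

theorem inv_sobolevWeight_le_of_high {d r : ℕ} {q : ℝ} {k : Fin d → ℤ}
    (hk : 1 < q ^ 2 * freqSq k) :
    (sobolevWeight r k)⁻¹ ≤ 2 ^ r * q ^ (2 * r) * ((1 + q ^ 2 * freqSq k) ^ r)⁻¹ := by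
  have hN := freqSq_nonneg k
  have hw := sobolevWeight_pos r k
  rw [← div_eq_mul_inv, le_div_iff₀ (by positivity), inv_mul_le_iff₀ hw, sobolevWeight_eq,
    pow_mul, ← mul_pow, ← mul_pow]
  gcongr
  have hpi : 1 ≤ 4 * Real.pi ^ 2 := by nlinarith [Real.pi_gt_three]
  have h1 := mul_le_mul_of_nonneg_right hpi hN
  have h2 := mul_le_mul_of_nonneg_left h1 (sq_nonneg q)
  nlinarith [sq_nonneg q]

/-- Values on a separated set of a Sobolev function without low frequencies. -/
theorem exists_sum_norm_sq_le_of_high {d r : ℕ} (hd : 0 < d) (hr : (d : ℝ) / 2 < r) :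
    ∃ C : ℝ, 0 < C ∧ ∀ q : ℝ, 0 < q → q ≤ 1 → ∀ X : Finset (Torus d),
      (∀ x ∈ X, ∀ y ∈ X, x ≠ y → 2 * q ≤ torusDist x y) → ∀ φ : CoeffSpace d,
      (∀ k, q ^ 2 * freqSq k ≤ 1 → φ k = 0) →
      ∑ x ∈ X, ‖sobolevMap hd hr φ x‖ ^ 2 ≤ C * q ^ (2 * r) * (q ^ d)⁻¹ * ‖φ‖ ^ 2 := by
  obtain ⟨C, hC, hbessel⟩ := exists_bessel hd hr
  refine ⟨2 ^ r * C, by positivity, fun q hq hq1 X hX φ hφ => ?_⟩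
  set u : Torus d → ℂ := fun x => sobolevMap hd hr φ x with hu
  set U : ℝ := ∑ x ∈ X, ‖u x‖ ^ 2 with hU
  have hU0 : 0 ≤ U := Finset.sum_nonneg fun _ _ => sq_nonneg _
  set g : (Fin d → ℤ) → ℂ := fun k => ∑ x ∈ X, conj (u x) * UnitAddTorus.mFourier k x with hg
  have hN := fun k : Fin d → ℤ => freqSq_nonneg k
  obtain ⟨hS, hSle⟩ := tsum_le_of_tsum_ofReal_le
    (f := fun k : Fin d → ℤ => ((1 + q ^ 2 * freqSq k) ^ r)⁻¹ * ‖g k‖ ^ 2)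
    (fun k => by have := hN k; positivity) (by positivity)
    (hbessel q hq hq1 X hX fun x => conj (u x))
  simp only [RCLike.norm_conj] at hSle
  -- Duality: pairing the values with their own conjugates turns `U` into a sum over frequencies
  -- against the exponential sum `g`. Cauchy–Schwarz and the Bessel inequality then bound `U` by the
  -- norm of `φ` times a multiple of `√U`, and `√U` cancels.
  have h1 : HasSum (fun k => ((invSqrtWeight r k : ℂ) * φ k) * g k) (U : ℂ) := by
    have h2 : HasSum (fun k => ∑ x ∈ X, conj (u x) *
        (((invSqrtWeight r k : ℂ) * φ k) * UnitAddTorus.mFourier k x))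
        (∑ x ∈ X, conj (u x) * u x) :=
      hasSum_sum fun x _ => (hasSum_sobolevMap_apply hd hr φ x).mul_left _
    have h3 : ∑ x ∈ X, conj (u x) * u x = (U : ℂ) := by
      rw [hU]
      push_cast
      exact Finset.sum_congr rfl fun x _ => by rw [mul_comm, Complex.mul_conj']
    rw [h3] at h2
    refine h2.congr_fun fun k => ?_
    simp only [hg]
    rw [Finset.mul_sum]
    exact Finset.sum_congr rfl fun x _ => by ring
  set ν : (Fin d → ℤ) → ℝ := fun k => if q ^ 2 * freqSq k ≤ 1 then 0 else
    invSqrtWeight r k * ‖g k‖ with hν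
  have hν0 : ∀ k, 0 ≤ ν k := fun k => by
    simp only [hν]
    split_ifs
    · exact le_rfl
    · exact mul_nonneg (invSqrtWeight_pos r k).le (norm_nonneg _)
  have hνle : ∀ k, ν k ^ 2 ≤ 2 ^ r * q ^ (2 * r) * (((1 + q ^ 2 * freqSq k) ^ r)⁻¹ * ‖g k‖ ^ 2) :=
    fun k => by
      have := hN k
      simp only [hν]
      split_ifs with hk
      · rw [zero_pow two_ne_zero]; positivity
      · rw [mul_pow, invSqrtWeight_sq, ← mul_assoc]
        gcongr
        exact inv_sobolevWeight_le_of_high (not_le.1 hk)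
  have hS' := hS.mul_left (2 ^ r * q ^ (2 * r))
  have hν2 : Summable fun k => ν k ^ 2 := hS'.of_nonneg_of_le (fun k => sq_nonneg _) hνle
  obtain ⟨h4, h5⟩ := summable_mul_and_tsum_le_sqrt hν0 (fun k => norm_nonneg (φ k)) hν2
    φ.hasSum_norm_sq.summable
  have h6 : ∀ k, ‖((invSqrtWeight r k : ℂ) * φ k) * g k‖ = ν k * ‖φ k‖ := fun k => by
    simp only [hν]
    split_ifs with hk
    · rw [hφ k hk]; simp
    · rw [norm_mul, norm_mul, Complex.norm_real, Real.norm_of_nonneg (invSqrtWeight_pos r k).le]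
      ring
  have h7 : U ≤ √(2 ^ r * q ^ (2 * r) * (C * (q ^ d)⁻¹ * U)) * ‖φ‖ := by
    have h8 : U = ‖(U : ℂ)‖ := by rw [Complex.norm_real, Real.norm_of_nonneg hU0]
    rw [h8, ← h1.tsum_eq]
    refine (norm_tsum_le_tsum_norm (h4.congr fun k => (h6 k).symm)).trans ?_
    simp_rw [h6]
    refine h5.trans ?_
    rw [φ.hasSum_norm_sq.tsum_eq, Real.sqrt_sq (norm_nonneg φ), h1.tsum_eq, ← h8]
    gcongr
    refine (hν2.tsum_le_tsum hνle hS').trans ?_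
    rw [tsum_mul_left]
    gcongr
  rcases hU0.eq_or_lt with h0 | hpos
  · rw [← h0]; positivity
  · have h9 : U ^ 2 ≤ 2 ^ r * q ^ (2 * r) * (C * (q ^ d)⁻¹ * U) * ‖φ‖ ^ 2 := by
      calc U ^ 2 ≤ (√(2 ^ r * q ^ (2 * r) * (C * (q ^ d)⁻¹ * U)) * ‖φ‖) ^ 2 := by gcongr
        _ = _ := by rw [mul_pow, Real.sq_sqrt (by positivity)]
    refine le_of_mul_le_mul_right ?_ hpos
    calc U * U = U ^ 2 := by ring
      _ ≤ _ := h9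
      _ = _ := by ring

/-- The coefficients of a smooth function that agrees on `X` with the Sobolev function with
coefficient sequence `φ`: low frequencies are kept, and the remainder on `X` is restored by narrow
bumps. -/
def smoothedCoeff {d : ℕ} (r : ℕ) (q : ℝ) (b : (Fin d → ℤ) → ℝ) (X : Finset (Torus d))
    (u : Torus d → ℂ) (φ : CoeffSpace d) (k : Fin d → ℤ) : ℂ :=
  invSqrtWeight r k * φ.restrict {k | q ^ 2 * freqSq k ≤ 1} k +
    b k * ∑ y ∈ X, u y * conj (UnitAddTorus.mFourier k y)

theorem norm_sum_mul_conj_mFourier {d : ℕ} (X : Finset (Torus d)) (u : Torus d → ℂ)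
    (k : Fin d → ℤ) : ‖∑ y ∈ X, u y * conj (UnitAddTorus.mFourier k y)‖ =
      ‖∑ y ∈ X, conj (u y) * UnitAddTorus.mFourier k y‖ := by
  rw [← RCLike.norm_conj]
  simp [map_sum, map_mul]

/-- On `X` the bumps do not interact and have unit height, so the bump sum takes exactly the values
of the discarded high-frequency part. -/
theorem hasSum_smoothedCoeff {d r : ℕ} (hd : 0 < d) (hr : (d : ℝ) / 2 < r) (q : ℝ)
    {b : (Fin d → ℤ) → ℝ} {ψ : Torus d → ℂ} (h0 : ψ 0 = 1)
    (hψ : ∀ z, HasSum (fun k : Fin d → ℤ => (b k : ℂ) * UnitAddTorus.mFourier k z) (ψ z))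
    {X : Finset (Torus d)} (hX : ∀ x ∈ X, ∀ y ∈ X, x ≠ y → ψ (x - y) = 0) (φ : CoeffSpace d)
    {x : Torus d} (hx : x ∈ X) :
    HasSum (fun k => smoothedCoeff r q b X
        (sobolevMap hd hr (φ.restrict {k | q ^ 2 * freqSq k ≤ 1}ᶜ)) φ k * UnitAddTorus.mFourier k x)
      (sobolevMap hd hr φ x) := by
  set S : Set (Fin d → ℤ) := {k | q ^ 2 * freqSq k ≤ 1} with hS
  set u : C(Torus d, ℂ) := sobolevMap hd hr (φ.restrict Sᶜ) with hu
  have h1 := hasSum_sobolevMap_apply hd hr (φ.restrict S) x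
  have h2 : HasSum (fun k => ∑ y ∈ X, u y * ((b k : ℂ) * UnitAddTorus.mFourier k (x - y)))
      (∑ y ∈ X, u y * ψ (x - y)) := hasSum_sum fun y _ => (hψ (x - y)).mul_left _
  have h3 : ∑ y ∈ X, u y * ψ (x - y) = u x := by
    rw [Finset.sum_eq_single x, sub_self, h0, mul_one]
    · intro y hy hyx
      rw [hX x hx y hy hyx.symm, mul_zero]
    · exact fun h => absurd hx h
  have h4 : φ.restrict S + φ.restrict Sᶜ = φ := by
    ext k
    exact congr_fun (Set.indicator_self_add_compl S (φ : (Fin d → ℤ) → ℂ)) k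
  have h5 : sobolevMap hd hr (φ.restrict S) x + u x = sobolevMap hd hr φ x := by
    rw [hu, ← ContinuousMap.add_apply, ← map_add, h4]
  rw [h3] at h2
  rw [← h5]
  refine (h1.add h2).congr_fun fun k => ?_
  rw [smoothedCoeff, add_mul, mul_assoc (b k : ℂ), Finset.sum_mul, Finset.mul_sum]
  congr 1
  refine Finset.sum_congr rfl fun y _ => ?_
  rw [mFourier_sub_apply]
  ring

theorem norm_restrict_le {d : ℕ} (S : Set (Fin d → ℤ)) (φ : CoeffSpace d) : ‖φ.restrict S‖ ≤ ‖φ‖ := by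
  refine le_of_sq_le_sq ?_ (norm_nonneg φ)
  rw [← (φ.restrict S).hasSum_norm_sq.tsum_eq, ← φ.hasSum_norm_sq.tsum_eq]
  refine (φ.restrict S).hasSum_norm_sq.summable.tsum_le_tsum (fun k => ?_)
    φ.hasSum_norm_sq.summable
  gcongr
  exact norm_indicator_le_norm_self _ _

/-- The low part loses `q ^ (-2(σ - r))` by the Bernstein bound. The bump part has the same size: `q
^ (2d)` from the squared kernel normalization, `q ^ (-2σ)` from the weight, `q ^ (-d)` from the
Bessel inequality and `q ^ (2r - d)` from the values of the high part on `X`. -/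
theorem exists_smoothedCoeff_bound {d r σ : ℕ} (hd : 0 < d) (hr : (d : ℝ) / 2 < r) (hσ : r ≤ σ)
    {β : ℝ → ℝ} (hβ : ∀ ξ, 0 ≤ β ξ)
    (hdecay : ∀ n : ℕ, ∃ C : ℝ, 0 < C ∧ ∀ ξ, β ξ * (1 + |ξ|) ^ n ≤ C) :
    ∃ C : ℝ, 0 < C ∧ ∀ q : ℝ, 0 < q → q ≤ 1 → ∀ X : Finset (Torus d),
      (∀ x ∈ X, ∀ y ∈ X, x ≠ y → 2 * q ≤ torusDist x y) → ∀ φ : CoeffSpace d,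
      ∀ c : (Fin d → ℤ) → ℂ, c = smoothedCoeff r q
        (fun k => (q / (2 * d)) ^ d * ∏ j, β (q / (2 * d) * k j)) X
        (sobolevMap hd hr (φ.restrict {k | q ^ 2 * freqSq k ≤ 1}ᶜ)) φ →
      (Summable fun k => sobolevWeight σ k * ‖c k‖ ^ 2) ∧
      ∑' k, sobolevWeight σ k * ‖c k‖ ^ 2 ≤ C * (q ^ (2 * (σ - r)))⁻¹ * ‖φ‖ ^ 2 := by
  obtain ⟨C₁, hC₁, hbessel⟩ := exists_bessel hd hr
  obtain ⟨C₂, hC₂, hhigh⟩ := exists_sum_norm_sq_le_of_high hd hr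
  obtain ⟨C₃, hC₃, hker⟩ := exists_sobolevWeight_mul_kernel_le hd hβ hdecay σ r
  have hd' : (1 : ℝ) ≤ d := by exact_mod_cast hd
  refine ⟨2 * 128 ^ (σ - r) + 2 * (C₃ * (C₁ * C₂)), by positivity, fun q hq hq1 X hX φ c hc => ?_⟩
  set S : Set (Fin d → ℤ) := {k | q ^ 2 * freqSq k ≤ 1} with hS
  set u : C(Torus d, ℂ) := sobolevMap hd hr (φ.restrict Sᶜ) with hu
  set ε : ℝ := q / (2 * d) with hε
  have hε0 : 0 < ε := by positivity
  have hεq : ε ≤ q := div_le_self hq.le (by linarith)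
  set g : (Fin d → ℤ) → ℝ := fun k => ‖∑ y ∈ X, conj (u y) * UnitAddTorus.mFourier k y‖ with hg
  set U : ℝ := ∑ x ∈ X, ‖u x‖ ^ 2 with hU
  have hU0 : 0 ≤ U := Finset.sum_nonneg fun _ _ => sq_nonneg _
  have hUle : U ≤ C₂ * q ^ (2 * r) * (q ^ d)⁻¹ * ‖φ‖ ^ 2 := by
    refine (hhigh q hq hq1 X hX (φ.restrict Sᶜ) fun k hk =>
      Set.indicator_of_notMem (not_not_intro hk : k ∉ Sᶜ) _).trans ?_
    have := norm_restrict_le Sᶜ φ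
    gcongr
  have hN := fun k : Fin d → ℤ => freqSq_nonneg k
  obtain ⟨hB, hBle⟩ := tsum_le_of_tsum_ofReal_le
    (f := fun k : Fin d → ℤ => ((1 + q ^ 2 * freqSq k) ^ r)⁻¹ * g k ^ 2)
    (fun k => by have := hN k; positivity) (by positivity)
    (hbessel q hq hq1 X hX fun x => conj (u x))
  simp only [RCLike.norm_conj] at hBle
  set A : ℝ := 2 * (128 ^ (σ - r) * (q ^ (2 * (σ - r)))⁻¹) with hA
  set A' : ℝ := 2 * (q ^ (2 * d) * (C₃ * (q ^ (2 * σ))⁻¹)) with hA'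
  have hA'0 : 0 ≤ A' := by positivity
  have hle : ∀ k, sobolevWeight σ k * ‖c k‖ ^ 2 ≤
      A * ‖φ k‖ ^ 2 + A' * (((1 + q ^ 2 * freqSq k) ^ r)⁻¹ * g k ^ 2) := fun k => by
    have hw := sobolevWeight_pos σ k
    have hw' := sobolevWeight_pos r k
    have hNk := hN k
    set low : ℂ := invSqrtWeight r k * φ.restrict S k with hlow
    set bk : ℝ := ε ^ d * ∏ j, β (ε * k j) with hbk
    have h1 : ‖c k‖ ^ 2 ≤ 2 * ‖low‖ ^ 2 + 2 * (bk ^ 2 * g k ^ 2) := by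
      have h2 : ‖c k‖ ≤ ‖low‖ + |bk| * g k := by
        rw [hc]
        refine (norm_add_le _ _).trans ?_
        rw [norm_mul (bk : ℂ), norm_sum_mul_conj_mFourier, Complex.norm_real, Real.norm_eq_abs]
      have h3 : ‖c k‖ ^ 2 ≤ (‖low‖ + |bk| * g k) ^ 2 := by gcongr
      have h4 : (|bk| * g k) ^ 2 = bk ^ 2 * g k ^ 2 := by rw [mul_pow, sq_abs]
      nlinarith [sq_nonneg (‖low‖ - |bk| * g k)]
    have h5 : sobolevWeight σ k * ‖low‖ ^ 2 ≤
        128 ^ (σ - r) * (q ^ (2 * (σ - r)))⁻¹ * ‖φ k‖ ^ 2 := by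
      by_cases hk : k ∈ S
      · have h6 : φ.restrict S k = φ k := Set.indicator_of_mem hk _
        rw [hlow, h6, norm_mul, mul_pow, Complex.norm_real,
          Real.norm_of_nonneg (invSqrtWeight_pos r k).le, invSqrtWeight_sq, ← mul_assoc]
        refine mul_le_mul_of_nonneg_right ?_ (sq_nonneg _)
        rw [← div_eq_mul_inv (sobolevWeight σ k), div_le_iff₀ hw']
        exact sobolevWeight_le_mul_of_low hσ hq hq1 hk
      · have h6 : φ.restrict S k = 0 := Set.indicator_of_notMem hk _
        rw [hlow, h6]
        simp only [mul_zero, norm_zero, ne_eq, OfNat.ofNat_ne_zero, not_false_eq_true, zero_pow]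
        positivity
    have h7 : sobolevWeight σ k * (bk ^ 2 * g k ^ 2) ≤
        q ^ (2 * d) * (C₃ * (q ^ (2 * σ))⁻¹) * (((1 + q ^ 2 * freqSq k) ^ r)⁻¹ * g k ^ 2) := by
      calc sobolevWeight σ k * (bk ^ 2 * g k ^ 2)
          = ε ^ (2 * d) * (sobolevWeight σ k * (∏ j, β (ε * k j)) ^ 2) * g k ^ 2 := by
            rw [hbk]; ring
        _ ≤ q ^ (2 * d) * (C₃ * (q ^ (2 * σ))⁻¹ * ((1 + q ^ 2 * freqSq k) ^ r)⁻¹) * g k ^ 2 := by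
            have h8 := hker q hq hq1 k
            have h9 : ε ^ (2 * d) ≤ q ^ (2 * d) := by gcongr
            exact mul_le_mul_of_nonneg_right
              (mul_le_mul h9 h8 (by positivity) (by positivity)) (sq_nonneg _)
        _ = _ := by ring
    calc sobolevWeight σ k * ‖c k‖ ^ 2
        ≤ sobolevWeight σ k * (2 * ‖low‖ ^ 2 + 2 * (bk ^ 2 * g k ^ 2)) := by gcongr
      _ = 2 * (sobolevWeight σ k * ‖low‖ ^ 2) + 2 * (sobolevWeight σ k * (bk ^ 2 * g k ^ 2)) := by
          ring
      _ ≤ _ := by rw [hA, hA']; linarith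
  have hsum := (φ.hasSum_norm_sq.summable.mul_left A).add (hB.mul_left A')
  have hsum' : Summable fun k => sobolevWeight σ k * ‖c k‖ ^ 2 :=
    hsum.of_nonneg_of_le (fun k => mul_nonneg (sobolevWeight_pos σ k).le (sq_nonneg _)) hle
  refine ⟨hsum', (hsum'.tsum_le_tsum hle hsum).trans ?_⟩
  rw [(φ.hasSum_norm_sq.summable.mul_left A).tsum_add (hB.mul_left A'), tsum_mul_left,
    tsum_mul_left, φ.hasSum_norm_sq.tsum_eq]
  have h8 : A' * ∑' k, ((1 + q ^ 2 * freqSq k) ^ r)⁻¹ * g k ^ 2 ≤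
      A' * (C₁ * (q ^ d)⁻¹ * (C₂ * q ^ (2 * r) * (q ^ d)⁻¹ * ‖φ‖ ^ 2)) := by
    gcongr
    exact hBle.trans (by gcongr)
  have h9 : A' * (C₁ * (q ^ d)⁻¹ * (C₂ * q ^ (2 * r) * (q ^ d)⁻¹ * ‖φ‖ ^ 2)) =
      2 * (C₃ * (C₁ * C₂)) * (q ^ (2 * (σ - r)))⁻¹ * ‖φ‖ ^ 2 := by
    have h10 : q ^ (2 * σ) = q ^ (2 * (σ - r)) * q ^ (2 * r) := by
      rw [← pow_add]; congr 1; omega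
    rw [hA', h10, two_mul d, pow_add]
    field_simp
  rw [h9] at h8
  refine (add_le_add_right h8 _).trans (le_of_eq ?_)
  rw [hA]
  ring

theorem exists_sobolevMap_of_summable {d σ : ℕ} (hd : 0 < d) (hσ : (d : ℝ) / 2 < σ)
    {c : (Fin d → ℤ) → ℂ} (hc : Summable fun k => sobolevWeight σ k * ‖c k‖ ^ 2) {M : ℝ}
    (hM : ∑' k, sobolevWeight σ k * ‖c k‖ ^ 2 ≤ M) :
    ∃ a : CoeffSpace d, ‖a‖ ≤ √M ∧ (∀ k, (invSqrtWeight σ k : ℂ) * a k = c k) ∧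
      ∀ x, HasSum (fun k => c k * UnitAddTorus.mFourier k x) (sobolevMap hd hσ a x) := by
  have h0 : ∀ k, ‖((invSqrtWeight σ k : ℂ))⁻¹ * c k‖ ^ 2 = sobolevWeight σ k * ‖c k‖ ^ 2 :=
    fun k => by
      rw [norm_mul, mul_pow, norm_inv, Complex.norm_real,
        Real.norm_of_nonneg (invSqrtWeight_pos σ k).le, inv_pow, invSqrtWeight_sq, inv_inv]
  let a := CoeffSpace.ofSummable (fun k => ((invSqrtWeight σ k : ℂ))⁻¹ * c k)
    (hc.congr fun k => (h0 k).symm)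
  have ha : ∀ k, (invSqrtWeight σ k : ℂ) * a k = c k := fun k => by
    have : (invSqrtWeight σ k : ℂ) ≠ 0 := by exact_mod_cast (invSqrtWeight_pos σ k).ne'
    rw [CoeffSpace.ofSummable_apply, mul_inv_cancel_left₀ this]
  refine ⟨a, a.norm_le_sqrt ?_, ha, fun x => ?_⟩
  · simpa only [a, CoeffSpace.ofSummable_apply, h0] using hM
  · simpa only [ha] using hasSum_sobolevMap_apply hd hσ a x

/-- The values on a `q`-separated set of a function in `W^r` are interpolated by a function in
`W^s`, with control of both norms. -/
theorem exists_smooth_interpolant {d r s : ℕ} (hd : 0 < d) (hr : (d : ℝ) / 2 < r)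
    (hs : (d : ℝ) / 2 < s) (hrs : r ≤ s) :
    ∃ C : ℝ, 0 < C ∧ ∀ q : ℝ, 0 < q → q ≤ 1 → ∀ X : Finset (Torus d),
      (∀ x ∈ X, ∀ y ∈ X, x ≠ y → 2 * q ≤ torusDist x y) → ∀ φ : CoeffSpace d,
      ∃ a a' : CoeffSpace d, sobolevMap hd hs a = sobolevMap hd hr a' ∧
        (∀ x ∈ X, sobolevMap hd hs a x = sobolevMap hd hr φ x) ∧
        ‖a‖ ≤ C * (q ^ (s - r))⁻¹ * ‖φ‖ ∧ ‖a'‖ ≤ C * ‖φ‖ := by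
  obtain ⟨β, hβ, -, hdecay, hK⟩ := exists_torusKernel d
  obtain ⟨C₁, hC₁, h₁⟩ := exists_smoothedCoeff_bound hd hr hrs hβ hdecay
  obtain ⟨C₂, hC₂, h₂⟩ := exists_smoothedCoeff_bound hd hr le_rfl hβ hdecay
  have hd' : (1 : ℝ) ≤ d := by exact_mod_cast hd
  refine ⟨√C₁ + √C₂, by positivity, fun q hq hq1 X hX φ => ?_⟩
  obtain ⟨-, ψ, h0, hz, hψ⟩ := hK (q / (2 * d)) (by positivity) (by
    rw [div_le_div_iff₀ (by positivity) (by norm_num)]; nlinarith)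
  have hψX : ∀ x ∈ X, ∀ y ∈ X, x ≠ y → ψ (x - y) = 0 := fun x hx y hy hxy =>
    hz _ (exists_le_norm_of_le_torusDist hd hq (hX x hx y hy hxy))
  -- One coefficient sequence is estimated twice, with `σ = s` and with `σ = r`; `a` and `a'`
  -- therefore represent the same function in the two scales.
  obtain ⟨hc1, hc1'⟩ := h₁ q hq hq1 X hX φ _ rfl
  obtain ⟨hc2, hc2'⟩ := h₂ q hq hq1 X hX φ _ rfl
  obtain ⟨a, ha, -, haS⟩ := exists_sobolevMap_of_summable hd hs hc1 hc1'
  obtain ⟨a', ha', -, haS'⟩ := exists_sobolevMap_of_summable hd hr hc2 hc2'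
  refine ⟨a, a', ContinuousMap.ext fun x => (haS x).unique (haS' x), fun x hx =>
    (haS x).unique (hasSum_smoothedCoeff hd hr q h0 hψ hψX φ hx), ?_, ?_⟩
  · refine ha.trans ?_
    rw [Real.sqrt_mul (by positivity), Real.sqrt_sq (norm_nonneg φ), Real.sqrt_mul hC₁.le]
    have : √((q ^ (2 * (s - r)))⁻¹) = (q ^ (s - r))⁻¹ := by
      rw [mul_comm 2, pow_mul, Real.sqrt_inv, Real.sqrt_sq (by positivity)]
    rw [this]
    gcongr
    exact le_add_of_nonneg_right (by positivity)
  · refine ha'.trans ?_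
    rw [Real.sqrt_mul (by positivity), Real.sqrt_sq (norm_nonneg φ), Nat.sub_self]
    simp only [mul_zero, pow_zero, inv_one, mul_one]
    gcongr
    exact le_add_of_nonneg_left (by positivity)

end

/-! ### Mesh norm against separation radius, and the two error bounds. -/

section

theorem torusDist_eq_norm {d : ℕ} (x y : Torus d) :
    torusDist x y = ‖(WithLp.toLp 2 (x - y) : PiLp 2 fun _ : Fin d => UnitAddCircle)‖ := by
  rw [PiLp.norm_eq_of_L2]
  rfl

theorem torusDist_triangle {d : ℕ} (x y z : Torus d) :
    torusDist x z ≤ torusDist x y + torusDist y z := by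
  rw [torusDist_eq_norm, torusDist_eq_norm, torusDist_eq_norm]
  have h : (WithLp.toLp 2 (x - z) : PiLp 2 fun _ : Fin d => UnitAddCircle) =
      WithLp.toLp 2 (x - y) + WithLp.toLp 2 (y - z) := by
    rw [← WithLp.toLp_add, sub_add_sub_cancel]
  rw [h]
  exact norm_add_le _ _

theorem torusDist_comm {d : ℕ} (x y : Torus d) : torusDist x y = torusDist y x := by
  simp only [torusDist, norm_sub_rev]

theorem torusDist_pos {d : ℕ} {x y : Torus d} (h : x ≠ y) : 0 < torusDist x y := by
  obtain ⟨j, hj⟩ := Function.ne_iff.1 h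
  exact (norm_pos_iff.2 (sub_ne_zero.2 hj)).trans_le (norm_sub_le_torusDist x y j)

theorem exists_torusDist_eq {d : ℕ} (hd : 0 < d) (x : Torus d) {ρ : ℝ} (h0 : 0 ≤ ρ)
    (h1 : ρ ≤ 1 / 2) : ∃ z, torusDist x z = ρ := by
  refine ⟨x - Pi.single (⟨0, hd⟩ : Fin d) (ρ : UnitAddCircle), ?_⟩
  have hρ : ‖(ρ : UnitAddCircle)‖ = ρ := by
    have := (AddCircle.norm_coe_eq_abs_iff (1 : ℝ) (x := ρ) one_ne_zero).2
      (by rw [abs_of_nonneg h0]; simpa using h1)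
    rw [this, abs_of_nonneg h0]
  rw [torusDist, Finset.sum_eq_single (⟨0, hd⟩ : Fin d)]
  · simp [hρ, Real.sqrt_sq h0]
  · intro j _ hj
    simp [hj]
  · simp

/-- A point at distance exactly `ρ` from `x` is, by the triangle inequality, no closer than `ρ` to
any other point of `X`. The bound `ρ ≤ 1 / 2` ensures that such a point exists on a coordinate
circle. -/
theorem le_meshNorm_of_separated {d : ℕ} (hd : 0 < d) {X : Finset (Torus d)} {x : Torus d}
    (hx : x ∈ X) {ρ : ℝ} (h0 : 0 ≤ ρ) (h1 : ρ ≤ 1 / 2)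
    (hX : ∀ y ∈ X, y ≠ x → 2 * ρ ≤ torusDist y x) : ρ ≤ meshNorm X := by
  obtain ⟨z, hz⟩ := exists_torusDist_eq hd x h0 h1
  have : Nonempty X := ⟨⟨x, hx⟩⟩
  refine le_trans (le_ciInf fun y => ?_) (iInf_torusDist_le_meshNorm ⟨x, hx⟩ z)
  by_cases hyx : y.1 = x
  · rw [hyx, hz]
  · have h2 := hX y.1 y.2 hyx
    have h3 := torusDist_triangle y.1 z x
    rw [torusDist_comm z x, hz] at h3
    linarith

theorem two_mul_sepRadius_le {d : ℕ} (X : Finset (Torus d)) :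
    ∀ x ∈ X, ∀ y ∈ X, x ≠ y → 2 * sepRadius X ≤ torusDist x y := by
  intro x hx y hy hxy
  have h := ciInf_le (Set.finite_range fun p : {p : X × X // p.1 ≠ p.2} =>
    torusDist p.1.1.1 p.1.2.1).bddBelow
    ⟨(⟨x, hx⟩, ⟨y, hy⟩), fun h => hxy (congr_arg Subtype.val h)⟩
  rw [sepRadius]
  linarith

/-- A single point would leave a hole of radius `1 / 2`, so the mesh condition forces at least two
points and a positive minimum distance. The minimum with `1 / 2` respects the range of the hole
argument, and the alternative `1 / 2 ≤ h_X` is excluded. -/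
theorem sepRadius_pos_and_le_meshNorm {d : ℕ} (hd : 0 < d) {X : Finset (Torus d)}
    (hX : X.Nonempty) (hh : meshNorm X ≤ 1 / 4) : 0 < sepRadius X ∧ sepRadius X ≤ meshNorm X := by
  obtain ⟨x, hx⟩ := hX
  have hpos : 0 < sepRadius X := by
    obtain ⟨y, hy, hyx⟩ : ∃ y ∈ X, y ≠ x := by
      by_contra! hall
      have := le_meshNorm_of_separated hd hx (ρ := 1 / 2) (by norm_num) le_rfl
        fun y hy hyx => absurd (hall y hy) hyx
      linarith
    have : Nonempty {p : X × X // p.1 ≠ p.2} :=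
      ⟨⟨(⟨y, hy⟩, ⟨x, hx⟩), fun h => hyx (congr_arg Subtype.val h)⟩⟩
    obtain ⟨p, hp⟩ := exists_eq_ciInf_of_finite
      (f := fun p : {p : X × X // p.1 ≠ p.2} => torusDist p.1.1.1 p.1.2.1)
    rw [sepRadius, ← hp]
    have := torusDist_pos fun h => p.2 (Subtype.ext h)
    positivity
  refine ⟨hpos, ?_⟩
  have h1 := le_meshNorm_of_separated hd hx (ρ := min (sepRadius X) (1 / 2))
    (le_min hpos.le (by norm_num)) (min_le_right _ _) fun y hy hyx => by
      have := two_mul_sepRadius_le X y hy x hx hyx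
      have := min_le_left (sepRadius X) (1 / 2)
      linarith
  rcases min_le_iff.1 h1 with h | h
  · exact h
  · linarith

theorem lqError_top_le {d : ℕ} (f g : C(Torus d, ℂ)) :
    lqError ∞ f g ≤ ENNReal.ofReal ‖f - g‖ :=
  eLpNorm_continuousMap_le ∞ (f - g)

/-- Every function of finite norm that has the prescribed data on `X` is at most its own norm away
from the minimum norm interpolant. -/
theorem IsMinNormInterpolant.exists_coeff_top {d s : ℕ} (hd : 0 < d) (hs : (d : ℝ) / 2 < s)
    {X : Finset (Torus d)} {y : Torus d → ℂ} {g : C(Torus d, ℂ)}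
    (hg : IsMinNormInterpolant s X y ⊤ g) {b : CoeffSpace d}
    (hb : ∀ x ∈ X, sobolevMap hd hs b x = y x) :
    ∃ a, sobolevMap hd hs a = g ∧ ‖b - a‖ ≤ ‖b‖ ∧ ∀ x ∈ X, sobolevMap hd hs (b - a) x = 0 := by
  obtain ⟨a, ha, hag, hmin⟩ := IsMinNormInterpolant.exists_coeff hd hs hg
  have h1 := hmin b ⟨fun k hk => absurd (mem_firstFreqs_top k) hk, hb⟩
  refine ⟨a, hag, le_of_sq_le_sq (by nlinarith [sq_nonneg ‖a‖]) (norm_nonneg b), fun x hx => ?_⟩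
  rw [map_sub, ContinuousMap.sub_apply, hb x hx, ha.2 x hx, sub_self]

/-- Here `f` itself is a competitor, so `f - g` vanishes on `X` and has norm at most that of `f`;
the zeros estimate applies directly. -/
theorem exists_error_bound_smooth {d s : ℕ} (hd : 0 < d) (hs : (d : ℝ) / 2 < s) :
    ∃ C : ℝ, 0 < C ∧ ∀ X : Finset (Torus d), X.Nonempty → 0 < meshNorm X → meshNorm X ≤ 1 →
      ∀ f : C(Torus d, ℂ), sobolevNorm s f < ∞ → ∀ g, IsMinNormInterpolant s X f ⊤ g →
        lqError ∞ f g ≤ ENNReal.ofReal (C * meshNorm X ^ ((s : ℝ) - d / 2)) * sobolevNorm s f := by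
  obtain ⟨C, hC, hzero⟩ := exists_norm_sobolevMap_le_of_vanishing hd hs
  refine ⟨C, hC, fun X hX hh hh1 f hf g hg => ?_⟩
  obtain ⟨φ, rfl⟩ := exists_sobolevMap_eq hd hs f hf
  obtain ⟨a, rfl, hle, hvan⟩ := hg.exists_coeff_top hd hs (b := φ) fun _ _ => rfl
  refine (lqError_top_le _ _).trans ?_
  rw [sobolevNorm_sobolevMap, ← ENNReal.ofReal_mul (by positivity), ← map_sub]
  refine ENNReal.ofReal_le_ofReal ((hzero X hX hh hh1 _ hvan).trans ?_)
  gcongr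

/-- Split at the smooth interpolant `b`: the zeros estimate is used in `W^r` for `f - b` and in
`W^s` for `b - g`, whose norm is at most that of `b`. Since `q ≤ h`, the ratio factor is at least
one and also dominates the first contribution. -/
theorem exists_error_bound_rough {d r s : ℕ} (hd : 0 < d) (hr : (d : ℝ) / 2 < r)
    (hs : (d : ℝ) / 2 < s) (hrs : r < s) :
    ∃ C : ℝ, 0 < C ∧ ∀ X : Finset (Torus d), X.Nonempty → meshNorm X ≤ 1 → 0 < sepRadius X →
      sepRadius X ≤ meshNorm X →
      ∀ f : C(Torus d, ℂ), sobolevNorm r f < ∞ → ∀ g, IsMinNormInterpolant s X f ⊤ g →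
        lqError ∞ f g ≤ ENNReal.ofReal (C * meshNorm X ^ ((r : ℝ) - d / 2) *
          (meshNorm X / sepRadius X) ^ ((s : ℝ) - r)) * sobolevNorm r f := by
  obtain ⟨Cr, hCr, hzr⟩ := exists_norm_sobolevMap_le_of_vanishing hd hr
  obtain ⟨Cs, hCs, hzs⟩ := exists_norm_sobolevMap_le_of_vanishing hd hs
  obtain ⟨C, hC, hinterp⟩ := exists_smooth_interpolant hd hr hs hrs.le
  refine ⟨Cr * (1 + C) + Cs * C, by positivity, fun X hX hh1 hq hqh f hf g hg => ?_⟩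
  have hh : 0 < meshNorm X := hq.trans_le hqh
  obtain ⟨φ, rfl⟩ := exists_sobolevMap_eq hd hr f hf
  obtain ⟨b, b', hbb, hbX, hb, hb'⟩ := hinterp (sepRadius X) hq (hqh.trans hh1) X
    (two_mul_sepRadius_le X) φ
  obtain ⟨a, rfl, hle, hvan⟩ := hg.exists_coeff_top hd hs hbX
  refine (lqError_top_le _ _).trans ?_
  rw [sobolevNorm_sobolevMap, ← ENNReal.ofReal_mul (by positivity)]
  refine ENNReal.ofReal_le_ofReal ?_
  set h := meshNorm X
  set q := sepRadius X
  have h1 : ‖sobolevMap hd hr (φ - b')‖ ≤ Cr * h ^ ((r : ℝ) - d / 2) * ((1 + C) * ‖φ‖) := by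
    refine (hzr X hX hh hh1 _ fun x hx => ?_).trans ?_
    · rw [map_sub, ContinuousMap.sub_apply, ← hbb, hbX x hx, sub_self]
    · gcongr
      refine (norm_sub_le _ _).trans ?_
      linarith
  have h2 : ‖sobolevMap hd hs (b - a)‖ ≤
      Cs * h ^ ((s : ℝ) - d / 2) * (C * (q ^ (s - r))⁻¹ * ‖φ‖) := by
    refine (hzs X hX hh hh1 _ hvan).trans ?_
    gcongr
    exact hle.trans hb
  have h3 : sobolevMap hd hr φ - sobolevMap hd hs a =
      sobolevMap hd hr (φ - b') + sobolevMap hd hs (b - a) := by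
    rw [map_sub, map_sub, ← hbb]; abel
  set ratio := (h / q) ^ ((s : ℝ) - r) with hratio
  have hsr : 0 ≤ (s : ℝ) - r := by
    have : (r : ℝ) ≤ s := by exact_mod_cast hrs.le
    linarith
  have h4 : 1 ≤ ratio := Real.one_le_rpow ((one_le_div hq).2 hqh) hsr
  have h5 : h ^ ((s : ℝ) - d / 2) * (q ^ (s - r))⁻¹ = h ^ ((r : ℝ) - d / 2) * ratio := by
    rw [hratio, Real.div_rpow hh.le hq.le, ← Real.rpow_natCast q (s - r), Nat.cast_sub hrs.le,
      div_eq_mul_inv (h ^ ((s : ℝ) - r)), ← mul_assoc, ← Real.rpow_add hh]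
    congr 2
    ring
  rw [h3]
  calc ‖sobolevMap hd hr (φ - b') + sobolevMap hd hs (b - a)‖
      ≤ Cr * h ^ ((r : ℝ) - d / 2) * ((1 + C) * ‖φ‖) +
        Cs * h ^ ((s : ℝ) - d / 2) * (C * (q ^ (s - r))⁻¹ * ‖φ‖) :=
        (norm_add_le _ _).trans (add_le_add h1 h2)
    _ = Cr * (1 + C) * h ^ ((r : ℝ) - d / 2) * 1 * ‖φ‖ +
        Cs * C * (h ^ ((s : ℝ) - d / 2) * (q ^ (s - r))⁻¹) * ‖φ‖ := by ring
    _ ≤ Cr * (1 + C) * h ^ ((r : ℝ) - d / 2) * ratio * ‖φ‖ +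
        Cs * C * (h ^ ((r : ℝ) - d / 2) * ratio) * ‖φ‖ := by
        rw [h5]
        gcongr
    _ = _ := by ring

end

end TorusInterp

end

theorem mainTheorem6 (d : ℕ) (hd : 0 < d) (s : ℕ) (hs : (d : ℝ) / 2 < s) :
    ∃ h : ℝ, 0 < h ∧ ∀ r : ℕ, (d : ℝ) / 2 < r →
      ∃ C : ℝ, 0 < C ∧
        ∀ X : Finset (TorusInterp.Torus d), X.Nonempty → TorusInterp.meshNorm X ≤ h →
        ∀ f : TorusInterp.Torus d → ℂ, TorusInterp.IsCr r f →
          TorusInterp.IsSamplingSet X ∧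
          (∀ p : ℕ∞, (TorusInterp.samplingIndex X : ℕ∞) ≤ p →
            ∃! g : C(TorusInterp.Torus d, ℂ), TorusInterp.IsMinNormInterpolant s X f p g) ∧
          ∀ F : ℕ∞ → C(TorusInterp.Torus d, ℂ),
            (∀ p : ℕ∞, (TorusInterp.samplingIndex X : ℕ∞) ≤ p →
              TorusInterp.IsMinNormInterpolant s X f p (F p)) →
            (∀ q : ℝ≥0∞, 1 ≤ q →
              Tendsto (fun p : ℕ => TorusInterp.lqError q f (F p)) atTop
                (𝓝 (TorusInterp.lqError q f (F ⊤))) ∧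
              TorusInterp.lqError q f (F ⊤) ≤ TorusInterp.lqError ∞ f (F ⊤)) ∧
            (s ≤ r →
              TorusInterp.sobolevNorm s f < ∞ ∧
              TorusInterp.lqError ∞ f (F ⊤) ≤
                ENNReal.ofReal (C * TorusInterp.meshNorm X ^ ((s : ℝ) - d / 2)) *
                  TorusInterp.sobolevNorm s f) ∧
            (r < s →
              TorusInterp.lqError ∞ f (F ⊤) ≤
                ENNReal.ofReal (C * TorusInterp.meshNorm X ^ ((r : ℝ) - d / 2) *
                    (TorusInterp.meshNorm X / TorusInterp.sepRadius X) ^ ((s : ℝ) - r)) *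
                  TorusInterp.crNorm r f) := by
  have pos_of_half_lt : ∀ {m : ℕ}, (d : ℝ) / 2 < m → 0 < m := fun {m} hm => by
    have : (0 : ℝ) < m := lt_of_le_of_lt (by positivity) hm
    exact_mod_cast this
  -- Any threshold below `1 / 2` rules out one-point sets; `1 / 4` also keeps `h_X` and `q_X` at
  -- most one, as the estimates require.
  refine ⟨1 / 4, by norm_num, fun r hr => ?_⟩
  obtain ⟨C₁, hC₁, hsmooth⟩ := TorusInterp.exists_error_bound_smooth hd hs
  obtain ⟨C₂, hC₂, hrough⟩ : ∃ C : ℝ, 0 < C ∧ (r < s → ∀ X : Finset (TorusInterp.Torus d),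
      X.Nonempty → TorusInterp.meshNorm X ≤ 1 → 0 < TorusInterp.sepRadius X →
      TorusInterp.sepRadius X ≤ TorusInterp.meshNorm X → ∀ f : C(TorusInterp.Torus d, ℂ),
      TorusInterp.sobolevNorm r f < ∞ → ∀ g, TorusInterp.IsMinNormInterpolant s X f ⊤ g →
      TorusInterp.lqError ∞ f g ≤ ENNReal.ofReal (C * TorusInterp.meshNorm X ^ ((r : ℝ) - d / 2) *
        (TorusInterp.meshNorm X / TorusInterp.sepRadius X) ^ ((s : ℝ) - r)) *
          TorusInterp.sobolevNorm r f) := by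
    by_cases hrs : r < s
    · obtain ⟨C, hC, h⟩ := TorusInterp.exists_error_bound_rough hd hr hs hrs
      exact ⟨C, hC, fun _ => h⟩
    · exact ⟨1, one_pos, fun h => absurd h hrs⟩
  -- One constant for both regimes; `(d + 1) ^ r` is the price of passing from the `W^r` norm to the
  -- `C^r` norm.
  refine ⟨C₁ + C₂ * (d + 1) ^ r, by positivity, fun X hX hh f hf => ?_⟩
  obtain ⟨hq, hqh⟩ := TorusInterp.sepRadius_pos_and_le_meshNorm hd hX hh
  have hh0 : 0 < TorusInterp.meshNorm X := hq.trans_le hqh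
  have hh1 : TorusInterp.meshNorm X ≤ 1 := hh.trans (by norm_num)
  let fC : C(TorusInterp.Torus d, ℂ) := ⟨f, hf.continuous⟩
  refine ⟨TorusInterp.isSamplingSet X,
    fun p hp => TorusInterp.existsUnique_isMinNormInterpolant hd hs X f hp,
    fun F hF => ⟨fun q hq1 => ⟨TorusInterp.tendsto_lqError hf.continuous
      (TorusInterp.tendsto_isMinNormInterpolant hd hs hF) hq1,
      TorusInterp.lqError_le_lqError_top hf.continuous _ q⟩, fun hsr => ?_, fun hrs => ?_⟩⟩
  · have hfin : TorusInterp.sobolevNorm s f < ∞ :=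
      TorusInterp.IsCr.sobolevNorm_lt_top (pos_of_half_lt hs) (hf.of_le hsr)
    refine ⟨hfin, (hsmooth X hX hh0 hh1 fC hfin (F ⊤) (hF ⊤ le_top)).trans ?_⟩
    refine mul_le_mul_left (ENNReal.ofReal_le_ofReal ?_) _
    gcongr
    exact le_add_of_nonneg_right (by positivity)
  · have hfin : TorusInterp.sobolevNorm r f < ∞ := hf.sobolevNorm_lt_top (pos_of_half_lt hr)
    refine (hrough hrs X hX hh1 hq hqh fC hfin (F ⊤) (hF ⊤ le_top)).trans ?_
    refine (mul_le_mul_right (TorusInterp.sobolevNorm_le_crNorm (pos_of_half_lt hr) hf) _).trans ?_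
    rw [← mul_assoc, ← ENNReal.ofReal_mul (by positivity)]
    refine mul_le_mul_left (ENNReal.ofReal_le_ofReal ?_) _
    set A := TorusInterp.meshNorm X ^ ((r : ℝ) - d / 2)
    set B := (TorusInterp.meshNorm X / TorusInterp.sepRadius X) ^ ((s : ℝ) - r)
    calc C₂ * A * B * (d + 1) ^ r = (C₂ * (d + 1) ^ r) * A * B := by ring
      _ ≤ (C₁ + C₂ * (d + 1) ^ r) * A * B := by
        gcongr
        exact le_add_of_nonneg_left hC₁.le
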